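/- **Setting.** Let $\mathbb M=\mathbb R^d$ and let $\mathcal P_2(\mathbb M)$ be the set of Borel probability measures on $\mathbb M$ with finite second moment, with the Wasserstein distance $W_2$. Let $\Gamma(\mu,\nu)$ be the set of couplings of $\mu,\nu$, and $\Gamma_o(\mu,\nu)$ the set of optimal ones, i.e. those with $W_2^2(\mu,\nu)=\int|a-b|^2\,d\gamma(a,b)$. Let $\mathcal B_r$ be the closed $W_2$-ball of radius $r$ centered at $\delta_0$. For $m\ge1$ and $q\in\mathbb M^m$ put $\mu_q^{(m)}=\frac1m\sum_{i=1}^m\delta_{q_i}$, and $\mathbb B_r^m=\{q\in\mathbb M^m:\frac1m\sum_j|q_j|^2\le r^2\}$. For matrices and tensors, $|A|_\infty$ is the largest absolute value of an entry. A function $\mathcal U:\mathcal P_2(\mathbb M)\to\mathbb R$ is differentiable at $\mu$ with Wasserstein gradient $\nabla_w\mathcal U(\mu)=\xi$ if $\xi$ lies in the closure of $\nabla C_c^\infty(\mathbb M)$ in $L^2(\mu)$ and $\mathcal U(\nu)-\mathcal U(\mu)-\int\xi(a)\cdot(b-a)\,d\gamma=o(W_2(\mu,\nu))$ uniformly over $\gamma\in\Gamma_o(\mu,\nu)$;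 the representative of $\xi$ that is continuous on $\operatorname{spt}\mu$ is used when it exists. For $\mathcal B\subseteq\mathcal P_2(\mathbb M)$, $\mathcal U$ is continuously differentiable on $\mathcal B$ if it is differentiable at every $\mu\in\mathcal B$ and, for $\mu\in\mathcal B$, $\int|\nabla_w\mathcal U(\nu)(b)-\nabla_w\mathcal U(\mu)(a)|^2d\gamma(a,b)\to0$ as $\int|a-b|^2d\gamma\to0$ with $\nu\in\mathcal B$, $\gamma\in\Gamma(\mu,\nu)$. $\mathcal U\in C^{1,1}(\mathcal B)$ means that $\mathcal U$ is continuously differentiable on $\mathcal B$ and there is $C\ge 0$ such that, for all $\mu,\nu\in\mathcal B$ and $\gamma\in\Gamma_o(\mu,\nu)$, $\nabla_w\mathcal U(\mu)$ is $C$-Lipschitz on $\operatorname{spt}\mu$ and $|\mathcal U(\nu)-\mathcal U(\mu)-\int\nabla_w\mathcal U(\mu)(a)\cdot(b-a)\,d\gamma|\le CW_2^2(\mu,\nu)$. $\mathcal U\in C^{2,1,w}(\mathcal B)$ means that $\mathcal U\in C^{1,1}(\mathcal B)$ and there are $C>0$, $\Lambda_0:\mathbb M\times\mathcal B\to\mathbb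 R^{d\times d}$ and $\Lambda_1:\mathbb M^2\times\mathcal B\to\mathbb R^{d\times d}$ with $\Lambda_0(\cdot,\mu)\in L^\infty(\mu)$ and $\Lambda_1(\cdot,\cdot,\mu)\in L^\infty(\mu\otimes\mu)$ for $\mu\in\mathcal B$, such that for all $\mu,\nu\in\mathcal B$, $(q_1,\bar q_1),(q_2,\bar q_2)\in\operatorname{spt}\mu\times\operatorname{spt}\nu$ and $\gamma\in\Gamma_o(\mu,\nu)$: 1. $\big|\nabla_w\mathcal U(\nu)(\bar q_1)-\nabla_w\mathcal U(\mu)(q_1)-\Lambda_0(q_1,\mu)(\bar q_1-q_1)-\int\Lambda_1(q_1,a,\mu)(b-a)\,d\gamma(a,b)\big|\le C(|q_1-\bar q_1|^2+W_2^2(\mu,\nu))$; 2. $|\Lambda_0(q_1,\mu)-\Lambda_0(\bar q_1,\nu)|_\infty\le C(|q_1-\bar q_1|+W_2(\mu,\nu))$ and $|\Lambda_1(q_1,q_2,\mu)-\Lambda_1(\bar q_1,\bar q_2,\nu)|_\infty\le C(|q_1-\bar q_1|+|q_2-\bar q_2|+W_2(\mu,\nu))$. The classes $C^{1,1}_{\rm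 loc}$ and $C^{2,1,w}_{\rm loc}$ of $\mathcal P_2(\mathbb M)$ require the respective property on $\mathcal B_r$ for every $r>0$. **Theorem.** Let $\mathcal U\in C^{1,1}_{\rm loc}(\mathcal P_2(\mathbb M))$ and $U^{(m)}(q):=\mathcal U(\mu_q^{(m)})$ for $m\ge1$, $q\in\mathbb M^m$. Suppose that $U^{(m)}\in C^3(\mathbb M^m)$ for every $m$ and that there is a nondecreasing function $r\mapsto C_0(r)$, independent of $m$, such that for all $r>0$, $m\ge1$, $q\in\mathbb B^m_r$ and all indices $i,j,k$: - $|D^2_{q_iq_j}U^{(m)}(q)|_\infty\le C_0(r)m^{-1}$ if $i=j$, and $\le C_0(r)m^{-2}$ if $i\ne j$; - $|D^3_{q_iq_jq_k}U^{(m)}(q)|_\infty\le C_0(r)m^{-1}$ if $i=j=k$, $\le C_0(r)m^{-2}$ if exactly two of $i,j,k$ coincide, and $\le C_0(r)m^{-3}$ if $i,j,k$ are pairwise distinct. Then $\mathcal U\in C^{2,1,w}_{\rm loc}(\mathcal P_2(\mathbb M))$. Moreover there are a nondecreasing $C:(0,\infty)\to(0,\infty)$ and continuous maps $\Lambda_0:\mathbb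 M\times\mathcal P_2(\mathbb M)\to\mathbb R^{d\times d}$, $\Lambda_1:\mathbb M\times\mathbb M\times\mathcal P_2(\mathbb M)\to\mathbb R^{d\times d}$ (independent of $r$) which for every $r>0$ satisfy the definition of $C^{2,1,w}(\mathcal B_r)$ with the constant $C(r)$, and such that for every $r>0$: - (i) $\sup_{\mu\in\mathcal B_r}\|\Lambda_0(\cdot,\mu)\|_{L^\infty(\mu)}\le C(r)$ and $\sup_{\mu\in\mathcal B_r}\|\Lambda_1(\cdot,\cdot,\mu)\|_{L^\infty(\mu\otimes\mu)}\le C(r)$; - (ii) for all $\mu,\nu\in\mathcal B_r$, $\gamma\in\Gamma_o(\mu,\nu)$ and $(q,\bar q)\in\operatorname{spt}\mu\times\operatorname{spt}\nu$, $$\Big|\nabla_w\mathcal U(\nu)(\bar q)-\nabla_w\mathcal U(\mu)(q)-\Lambda_0(q,\mu)(\bar q-q)-\int_{\mathbb M^2}\Lambda_1(q,a,\mu)(b-a)\,d\gamma(a,b)\Big|\le C(r)\big(|q-\bar q|^2+W_2^2(\mu,\nu)\big)$$ and $$\big|\nabla_w\mathcal U(\mu)(q)-\nabla_w\mathcal U(\nu)(\bar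 q)\big|\le C(r)\big(|q-\bar q|+W_2(\mu,\nu)\big).$$ -/

import Mathlib

open MeasureTheory Set
open scoped ENNReal ContDiff

/- Matrices carry the norm `‖A‖ = max_{i,j} |A i j|`. -/
attribute [local instance] Matrix.normedAddCommGroup

noncomputable section

namespace Wass

/-- The Euclidean space `𝕄 = ℝ^d`. -/
abbrev M (d : ℕ) : Type := EuclideanSpace ℝ (Fin d)

/-- Real `d × d` matrices. -/
abbrev Mat (d : ℕ) : Type := Matrix (Fin d) (Fin d) ℝ

/-- The action of a matrix on a vector of `ℝ^d`. -/
def mulV {d : ℕ} (A : Mat d) (v : M d) : M d := WithLp.toLp 2 (A.mulVec v.ofLp)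

/-- `𝒫₂(𝕄)`: Borel probability measures on `ℝ^d` with finite second moment. -/
structure P2 (d : ℕ) where
  /-- the underlying measure -/
  meas : Measure (M d)
  isProb : IsProbabilityMeasure meas
  memLp_id : MemLp (fun q : M d => q) 2 meas

instance {d : ℕ} (μ : P2 d) : IsProbabilityMeasure μ.meas := μ.isProb

/-- The support of `μ`. -/
def P2.spt {d : ℕ} (μ : P2 d) : Set (M d) := μ.meas.support

/-- `Γ(μ, ν)`: the Borel measures on `𝕄 × 𝕄` with marginals `μ` and `ν`. -/
def couplings {d : ℕ} (μ ν : P2 d) : Set (Measure (M d × M d)) :=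
  {γ | γ.map Prod.fst = μ.meas ∧ γ.map Prod.snd = ν.meas}

/-- `∫ |a - b|² dγ(a, b)`. -/
def cost {d : ℕ} (γ : Measure (M d × M d)) : ℝ := ∫ p, ‖p.1 - p.2‖ ^ 2 ∂γ

/-- The Wasserstein distance `W₂`. -/
def W2 {d : ℕ} (μ ν : P2 d) : ℝ := Real.sqrt (⨅ γ : couplings μ ν, cost γ.1)

/-- `Γ_o(μ, ν)`: the optimal plans. -/
def optPlans {d : ℕ} (μ ν : P2 d) : Set (Measure (M d × M d)) :=
  {γ | γ ∈ couplings μ ν ∧ W2 μ ν ^ 2 = cost γ}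

lemma memLp_id_dirac {d : ℕ} (q : M d) : MemLp (fun x : M d => x) 2 (Measure.dirac q) := by
  refine ⟨aestronglyMeasurable_id, ?_⟩
  rw [eLpNorm_lt_top_iff_lintegral_rpow_enorm_lt_top (by norm_num) (by norm_num)]
  rw [lintegral_dirac]
  simp

/-- The Dirac mass at `q`. -/
def diracP2 {d : ℕ} (q : M d) : P2 d where
  meas := Measure.dirac q
  isProb := inferInstance
  memLp_id := memLp_id_dirac q

/-- The empirical measure `μ_q^{(m)} = m⁻¹ ∑ᵢ δ_{qᵢ}`, `m ≥ 1`. -/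
def empirical {d m : ℕ} [NeZero m] (q : Fin m → M d) : P2 d where
  meas := (m : ℝ≥0∞)⁻¹ • ∑ i, Measure.dirac (q i)
  isProb := ⟨by
    simp [ENNReal.inv_mul_cancel (Nat.cast_ne_zero.2 (NeZero.ne m)) (ENNReal.natCast_ne_top m)]⟩
  memLp_id := by
    refine MemLp.smul_measure ?_ (by simp [NeZero.ne m])
    refine ⟨aestronglyMeasurable_id, ?_⟩
    rw [eLpNorm_lt_top_iff_lintegral_rpow_enorm_lt_top (by norm_num) (by norm_num)]
    rw [lintegral_finsetSum_measure]
    simp [lintegral_dirac, ENNReal.sum_lt_top]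

/-- `ℬ_r`: the closed `W₂`-ball of radius `r` centered at `δ₀`. -/
def ballP2 (d : ℕ) (r : ℝ) : Set (P2 d) := {μ | W2 μ (diracP2 0) ≤ r}

/-- `𝔹_r^m = {q ∈ 𝕄^m : m⁻¹ ∑ⱼ |qⱼ|² ≤ r²}`. -/
def ballM (d m : ℕ) (r : ℝ) : Set (Fin m → M d) := {q | (m : ℝ)⁻¹ * ∑ j, ‖q j‖ ^ 2 ≤ r ^ 2}

/-- The tangent space `T_μ𝒫₂(𝕄)`: the closure of `∇ C_c^∞(𝕄)` in `L²(μ)`. -/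
def IsTangent {d : ℕ} (μ : P2 d) (ξ : M d → M d) : Prop :=
  MemLp ξ 2 μ.meas ∧
    ∀ ε : ℝ≥0∞, 0 < ε → ∃ φ : M d → ℝ, ContDiff ℝ ∞ φ ∧ HasCompactSupport φ ∧
      eLpNorm (fun q => ξ q - gradient φ q) 2 μ.meas < ε

/-- `ξ` is (a representative of) the Wasserstein gradient of `U` at `μ`: it is tangent at `μ` and
`U(ν) = U(μ) + ∫ ξ(a)·(b - a) dγ(a, b) + o(W₂(μ, ν))`, uniformly over `γ ∈ Γ_o(μ, ν)`. -/
def HasWGradientAt {d : ℕ} (U : P2 d → ℝ) (ξ : M d → M d) (μ : P2 d) : Prop :=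
  IsTangent μ ξ ∧
    ∀ ε : ℝ, 0 < ε → ∃ δ : ℝ, 0 < δ ∧ ∀ ν : P2 d, W2 μ ν < δ → ∀ γ ∈ optPlans μ ν,
      |U ν - U μ - ∫ p, inner ℝ (ξ p.1) (p.2 - p.1) ∂γ| ≤ ε * W2 μ ν

/-- Differentiability of `U` at `μ`. -/
def WDifferentiableAt {d : ℕ} (U : P2 d → ℝ) (μ : P2 d) : Prop :=
  ∃ ξ : M d → M d, HasWGradientAt U ξ μ

open Classical in
/-- The Wasserstein gradient `∇_w U(μ)`. The gradient is unique as an element of `L²(μ)`; the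
representative that is continuous on `spt μ` is taken as soon as there is one (its values on
`spt μ` are then unique). The value is `0` where `U` is not differentiable. -/
def wgrad {d : ℕ} (U : P2 d → ℝ) (μ : P2 d) : M d → M d :=
  if h : ∃ ξ : M d → M d, HasWGradientAt U ξ μ ∧ ContinuousOn ξ μ.spt then h.choose
  else if h : WDifferentiableAt U μ then h.choose
  else fun _ => 0

/-- `U` is continuously differentiable on `B`: it is differentiable at each point of `B` and its
gradient is continuous in `L²`, that is, if the law of `(x, y)` is `γ ∈ Γ(μ, ν)` and `y → x` in
`L²`, then `∇_w U(ν) ∘ y → ∇_w U(μ) ∘ x` in `L²`. -/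
def IsC1On {d : ℕ} (U : P2 d → ℝ) (B : Set (P2 d)) : Prop :=
  (∀ μ ∈ B, WDifferentiableAt U μ) ∧
    ∀ μ ∈ B, ∀ ε : ℝ, 0 < ε → ∃ δ : ℝ, 0 < δ ∧ ∀ ν ∈ B, ∀ γ ∈ couplings μ ν,
      cost γ < δ → ∫ p, ‖wgrad U ν p.2 - wgrad U μ p.1‖ ^ 2 ∂γ < ε

/-- The class `C^{1,1}(B)`. -/
def IsC11On {d : ℕ} (U : P2 d → ℝ) (B : Set (P2 d)) : Prop :=
  IsC1On U B ∧ ∃ C : ℝ, 0 ≤ C ∧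
    (∀ μ ∈ B, ∀ q₁ ∈ μ.spt, ∀ q₂ ∈ μ.spt, ‖wgrad U μ q₁ - wgrad U μ q₂‖ ≤ C * ‖q₁ - q₂‖) ∧
    (∀ μ ∈ B, ∀ ν ∈ B, ∀ γ ∈ optPlans μ ν,
      |U ν - U μ - ∫ p, inner ℝ (wgrad U μ p.1) (p.2 - p.1) ∂γ| ≤ C * W2 μ ν ^ 2)

/-- The class `C^{1,1}_loc(𝒫₂(𝕄))`. -/
def IsC11Loc {d : ℕ} (U : P2 d → ℝ) : Prop := ∀ r : ℝ, 0 < r → IsC11On U (ballP2 d r)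

/-- `Λ₀`, `Λ₁` are second order coefficients of `U` on `B` with constant `C`: they are essentially
bounded, they give the second order expansion of `∇_w U` along optimal plans, and they are
Lipschitz, where all points are taken in the supports of the measures. -/
structure HasSecondOrder {d : ℕ} (U : P2 d → ℝ) (B : Set (P2 d)) (Λ₀ : M d → P2 d → Mat d)
    (Λ₁ : M d → M d → P2 d → Mat d) (C : ℝ) : Prop where
  memLp_zero : ∀ μ ∈ B, MemLp (fun q => Λ₀ q μ) ⊤ μ.meas
  memLp_one : ∀ μ ∈ B, MemLp (fun p : M d × M d => Λ₁ p.1 p.2 μ) ⊤ (μ.meas.prod μ.meas)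
  expansion : ∀ μ ∈ B, ∀ ν ∈ B, ∀ γ ∈ optPlans μ ν, ∀ q ∈ μ.spt, ∀ q' ∈ ν.spt,
    ‖wgrad U ν q' - wgrad U μ q - mulV (Λ₀ q μ) (q' - q)
        - ∫ p, mulV (Λ₁ q p.1 μ) (p.2 - p.1) ∂γ‖ ≤ C * (‖q - q'‖ ^ 2 + W2 μ ν ^ 2)
  lip_zero : ∀ μ ∈ B, ∀ ν ∈ B, ∀ q ∈ μ.spt, ∀ q' ∈ ν.spt,
    ‖Λ₀ q μ - Λ₀ q' ν‖ ≤ C * (‖q - q'‖ + W2 μ ν)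
  lip_one : ∀ μ ∈ B, ∀ ν ∈ B, ∀ q₁ ∈ μ.spt, ∀ q₁' ∈ ν.spt, ∀ q₂ ∈ μ.spt, ∀ q₂' ∈ ν.spt,
    ‖Λ₁ q₁ q₂ μ - Λ₁ q₁' q₂' ν‖ ≤ C * (‖q₁ - q₁'‖ + ‖q₂ - q₂'‖ + W2 μ ν)

/-- The class `C^{2,1,w}(B)`. -/
def IsC21wOn {d : ℕ} (U : P2 d → ℝ) (B : Set (P2 d)) : Prop :=
  IsC11On U B ∧ ∃ C : ℝ, 0 < C ∧ ∃ (Λ₀ : M d → P2 d → Mat d) (Λ₁ : M d → M d → P2 d → Mat d),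
    HasSecondOrder U B Λ₀ Λ₁ C

/-- The class `C^{2,1,w}_loc(𝒫₂(𝕄))`. -/
def IsC21wLoc {d : ℕ} (U : P2 d → ℝ) : Prop := ∀ r : ℝ, 0 < r → IsC21wOn U (ballP2 d r)

/-- Continuity of a matrix field on `𝕄 × 𝒫₂(𝕄)`, the second factor with the distance `W₂`. -/
def ContinuousMP {d : ℕ} (Λ : M d → P2 d → Mat d) : Prop :=
  ∀ q μ, ∀ ε : ℝ, 0 < ε → ∃ δ : ℝ, 0 < δ ∧ ∀ q' ν, ‖q - q'‖ < δ → W2 μ ν < δ →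
    ‖Λ q μ - Λ q' ν‖ < ε

/-- Continuity of a matrix field on `𝕄 × 𝕄 × 𝒫₂(𝕄)`, the last factor with the distance `W₂`. -/
def ContinuousMMP {d : ℕ} (Λ : M d → M d → P2 d → Mat d) : Prop :=
  ∀ q₁ q₂ μ, ∀ ε : ℝ, 0 < ε → ∃ δ : ℝ, 0 < δ ∧ ∀ q₁' q₂' ν,
    ‖q₁ - q₁'‖ < δ → ‖q₂ - q₂'‖ < δ → W2 μ ν < δ → ‖Λ q₁ q₂ μ - Λ q₁' q₂' ν‖ < ε

/-- The coordinate direction `e_α` in the `i`-th factor of `𝕄^m`. -/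
def dir {d m : ℕ} (i : Fin m) (α : Fin d) : Fin m → M d :=
  Pi.single i (EuclideanSpace.single α (1 : ℝ))

/-- The entry `(α, β)` of the block `D²_{qᵢqⱼ} G(q)`. -/
def D2 {d m : ℕ} (G : (Fin m → M d) → ℝ) (q : Fin m → M d) (i j : Fin m) (α β : Fin d) : ℝ :=
  iteratedFDeriv ℝ 2 G q ![dir i α, dir j β]

/-- The entry `(α, β, κ)` of the block `D³_{qᵢqⱼqₖ} G(q)`. -/
def D3 {d m : ℕ} (G : (Fin m → M d) → ℝ) (q : Fin m → M d) (i j k : Fin m) (α β κ : Fin d) : ℝ :=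
  iteratedFDeriv ℝ 3 G q ![dir i α, dir j β, dir k κ]

/-- The restriction `U^{(m)}(q) = U(μ_q^{(m)})` of `U` to the empirical measures. -/
def restr {d : ℕ} (U : P2 d → ℝ) (m : ℕ) [NeZero m] (q : Fin m → M d) : ℝ := U (empirical q)

/-- The scaling of the second derivatives: the `U^{(m)}` are `C²` (hence `C^{1,1}_loc`) and on
`𝔹_r^m` the entries of `D²_{qᵢqⱼ} U^{(m)}` are bounded by `C(r) m⁻¹` if `i = j` and by `C(r) m⁻²`
if `i ≠ j`, where `C(r)` is nondecreasing in `r` and does not depend on `m`. -/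
def SecondDerivScaling {d : ℕ} (U : P2 d → ℝ) : Prop :=
  (∀ (m : ℕ) [NeZero m], ContDiff ℝ 2 (restr U m)) ∧
    ∃ C : ℝ → ℝ, MonotoneOn C (Ioi 0) ∧
      ∀ r : ℝ, 0 < r → ∀ (m : ℕ) [NeZero m], ∀ q ∈ ballM d m r, ∀ (i j : Fin m) (α β : Fin d),
        (i = j → |D2 (restr U m) q i j α β| ≤ C r / (m : ℝ)) ∧
        (i ≠ j → |D2 (restr U m) q i j α β| ≤ C r / (m : ℝ) ^ 2)

/-- The scaling of the third derivatives: the `U^{(m)}` are `C³` (hence `C^{2,1}_loc`) and on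
`𝔹_r^m` the entries of `D³_{qᵢqⱼqₖ} U^{(m)}` are bounded by `C(r) m⁻¹` if `i = j = k`, by
`C(r) m⁻²` if exactly two of the indices coincide and by `C(r) m⁻³` if the indices are pairwise
distinct, where `C(r)` is nondecreasing in `r` and does not depend on `m`. -/
def ThirdDerivScaling {d : ℕ} (U : P2 d → ℝ) : Prop :=
  (∀ (m : ℕ) [NeZero m], ContDiff ℝ 3 (restr U m)) ∧
    ∃ C : ℝ → ℝ, MonotoneOn C (Ioi 0) ∧
      ∀ r : ℝ, 0 < r → ∀ (m : ℕ) [NeZero m], ∀ q ∈ ballM d m r,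
        ∀ (i j k : Fin m) (α β κ : Fin d),
        (i = j ∧ j = k → |D3 (restr U m) q i j k α β κ| ≤ C r / (m : ℝ)) ∧
        ((i = j ∧ j ≠ k) ∨ (i ≠ j ∧ j = k) ∨ (i = k ∧ k ≠ j) →
          |D3 (restr U m) q i j k α β κ| ≤ C r / (m : ℝ) ^ 2) ∧
        (i ≠ j ∧ j ≠ k ∧ i ≠ k → |D3 (restr U m) q i j k α β κ| ≤ C r / (m : ℝ) ^ 3)

end Wass

end

open Wass

noncomputable section

/-! The coefficients are limits of rescaled derivatives of the symmetric functions `restr U m`.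
Approximate `μ` by `n` equally weighted points `x` and add two marked points `q` and `p`, which
carry vanishing mass. At the configuration `(q, p, x)` the derivative in `q` times `n + 2`, the
second derivative in `q` times `n + 2`, and the mixed derivative in `p, q` times `n (n + 2)` play
the roles of `∇_w U(μ)(q)`, `Λ₀(q, μ)` and `Λ₁(q, p, μ)`. When `p` is not needed it is parked at the
origin. The assumed powers of `m` make the last two quantities bounded, and all three Lipschitz in
the marked points and in the mean displacement of `x`, uniformly in `n` (`ScaledOn.lip_grad`,
`ScaledOn.lip_diag`, `ScaledOn.lip_off`). They also give a Taylor formula for the first with a mean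
square remainder (`ScaledOn.taylor_grad`).

Two measures are compared through a plan `γ` between them. The approximating points come with
fractional transports (`Alloc`), so `γ` induces a doubly stochastic matrix between the two families
of points, which by Birkhoff's theorem is a convex combination of matchings. By symmetry every
estimate holds along every matching; averaging turns it into an estimate along `γ`
(`Alloc.abs_sub_integral_mix_le`), and letting the transport costs tend to zero gives bounds in `W2`
(`abs_sub_le_of_matchings`). Optimality of `γ` plays no role until the cost is renamed `W2 μ ν ^ 2`.

The first derivatives really converge to `wgrad U μ` on the support (`tendsto_gradApx`): at an
empirical measure the Wasserstein gradient is the rescaled partial gradient (`wgrad_empirical`), and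
continuity of the gradient in `L²` carries this to `μ`. The second derivatives need not be shown to
converge: their limits along a fixed free ultrafilter are taken as `LamZero` and `LamOne`, and
bounds, Lipschitz estimates and the expansion all pass to the limit. Neither the approximating
sequences nor the ultrafilter refer to a radius, so the coefficients are the same on all balls.

For the expansion, the Taylor sum contains mixed derivatives at the points `x i` themselves.
Exchange symmetry identifies them, up to a negligible error, with the approximation of `Λ₁` at `p =
x i`, and a finite net yields the integral of `Λ₁` along `γ`
(`eventually_abs_mixedApx_sub_LamOne_le`, `integral_abs_mix_sub_le`). -/

namespace Wass

/-! ### Partial derivatives on `𝕄^m`: mean value and Taylor bounds, effect of relabelling -/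

section Derivatives
variable {d m : ℕ}

/-- The component `α` of the gradient of `G` with respect to the `i`-th point. -/
def D1 (G : (Fin m → M d) → ℝ) (q : Fin m → M d) (i : Fin m) (α : Fin d) : ℝ :=
  fderiv ℝ G q (dir i α)

lemma eq_sum_dir (v : Fin m → M d) : v = ∑ k, ∑ β, (v k) β • dir k β := by
  ext k β
  simp [dir, Finset.sum_apply, Pi.single_apply, apply_ite, Finset.sum_ite_eq]

lemma clm_eq_sum_dir (L : (Fin m → M d) →L[ℝ] ℝ) (v : Fin m → M d) :
    L v = ∑ k, ∑ β, (v k) β * L (dir k β) := by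
  conv_lhs => rw [eq_sum_dir v]
  simp [map_sum]

lemma abs_coord_le (v : M d) (β : Fin d) : |v β| ≤ ‖v‖ := by
  simpa using PiLp.norm_apply_le v β

lemma abs_sum_coord_mul_le (v : M d) (a : Fin d → ℝ) (b : ℝ) (h : ∀ β, |a β| ≤ b) :
    |∑ β, v β * a β| ≤ d * (b * ‖v‖) := by
  refine (Finset.abs_sum_le_sum_abs _ _).trans ?_
  calc ∑ β, |v β * a β| ≤ ∑ _β : Fin d, b * ‖v‖ := by
        refine Finset.sum_le_sum fun β _ => ?_
        rw [abs_mul, mul_comm]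
        exact mul_le_mul (h β) (abs_coord_le v β) (abs_nonneg _) ((abs_nonneg _).trans (h β))
    _ = _ := by simp

lemma norm_le_sum_coord (v : M d) : ‖v‖ ≤ ∑ α, |v α| := by
  have : v = ∑ α, v α • EuclideanSpace.single α (1 : ℝ) := by
    ext β; simp [Pi.single_apply]
  conv_lhs => rw [this]
  refine (norm_sum_le _ _).trans (le_of_eq ?_)
  simp [norm_smul]

lemma abs_sum_clm_le (L : (Fin m → M d) →L[ℝ] ℝ) (v : Fin m → M d) (b : Fin m → ℝ)
    (h : ∀ k β, |L (dir k β)| ≤ b k) : |L v| ≤ d * ∑ k, b k * ‖v k‖ := by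
  rw [clm_eq_sum_dir]
  refine (Finset.abs_sum_le_sum_abs _ _).trans ?_
  rw [Finset.mul_sum]
  exact Finset.sum_le_sum fun k _ => abs_sum_coord_mul_le _ _ _ (h k)

lemma hasDerivAt_segment {g : (Fin m → M d) → ℝ} (hg : Differentiable ℝ g) (z v : Fin m → M d)
    (t : ℝ) : HasDerivAt (fun s : ℝ => g (z + s • v)) (fderiv ℝ g (z + t • v) v) t := by
  have h1 : HasDerivAt (fun s : ℝ => z + s • v) v t := by
    simpa using ((hasDerivAt_id t).smul_const v).const_add z
  exact (hg _).hasFDerivAt.comp_hasDerivAt t h1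

lemma segment_mem {S : Set (Fin m → M d)} (hS : Convex ℝ S) {z z' : Fin m → M d} (hz : z ∈ S)
    (hz' : z' ∈ S) {t : ℝ} (ht : t ∈ Icc (0 : ℝ) 1) : z + t • (z' - z) ∈ S :=
  hS.add_smul_sub_mem hz hz' ht

/-- Mean value inequality with a bound for each partial derivative. -/
lemma abs_sub_le_of_partial {g : (Fin m → M d) → ℝ} (hg : Differentiable ℝ g)
    {S : Set (Fin m → M d)} (hS : Convex ℝ S) {z z' : Fin m → M d} (hz : z ∈ S) (hz' : z' ∈ S)
    (b : Fin m → ℝ) (hb : ∀ w ∈ S, ∀ k β, |fderiv ℝ g w (dir k β)| ≤ b k) :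
    |g z' - g z| ≤ d * ∑ k, b k * ‖z' k - z k‖ := by
  have := norm_image_sub_le_of_norm_deriv_le_segment_01'
    (f := fun s : ℝ => g (z + s • (z' - z))) (C := d * ∑ k, b k * ‖z' k - z k‖)
    (fun t _ => (hasDerivAt_segment hg z (z' - z) t).hasDerivWithinAt)
    (fun t ht => by
      exact abs_sum_clm_le _ _ b (hb _ (segment_mem hS hz hz' ⟨ht.1, ht.2.le⟩)))
  simpa using this

/-- First order Taylor formula with a bound for each second partial derivative. -/
lemma abs_taylor_le_of_partial {g : (Fin m → M d) → ℝ} (hg : Differentiable ℝ g)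
    (hg' : ∀ k β, Differentiable ℝ (fun w => fderiv ℝ g w (dir k β)))
    {S : Set (Fin m → M d)} (hS : Convex ℝ S) {z z' : Fin m → M d} (hz : z ∈ S) (hz' : z' ∈ S)
    (b : Fin m → Fin m → ℝ) (hb0 : ∀ k l, 0 ≤ b k l)
    (hb : ∀ w ∈ S, ∀ k β l κ,
      |fderiv ℝ (fun w => fderiv ℝ g w (dir k β)) w (dir l κ)| ≤ b k l) :
    |g z' - g z - fderiv ℝ g z (z' - z)| ≤
      d * ∑ k, (d * ∑ l, b k l * ‖z' l - z l‖) * ‖z' k - z k‖ := by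
  have := norm_image_sub_le_of_norm_deriv_le_segment_01'
    (f := fun s : ℝ => g (z + s • (z' - z)) - s * fderiv ℝ g z (z' - z))
    (C := d * ∑ k, (d * ∑ l, b k l * ‖z' l - z l‖) * ‖z' k - z k‖)
    (fun t _ => ((hasDerivAt_segment hg z (z' - z) t).sub
      ((hasDerivAt_id t).mul_const _)).hasDerivWithinAt)
    (fun t ht => by
      have hzt := segment_mem hS hz hz' ⟨ht.1, ht.2.le⟩
      rw [one_mul, ← sub_apply]
      refine abs_sum_clm_le _ _ (fun k => d * ∑ l, b k l * ‖z' l - z l‖) fun k β => ?_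
      rw [sub_apply]
      refine (abs_sub_le_of_partial (hg' k β) hS hz hzt (b k)
        (fun w hw l κ => hb w hw k β l κ)).trans ?_
      gcongr with l
      · exact hb0 k l
      · simp only [Pi.add_apply, Pi.smul_apply, Pi.sub_apply, add_sub_cancel_left, norm_smul]
        refine mul_le_of_le_one_left (norm_nonneg _) ?_
        rw [Real.norm_of_nonneg ht.1]; exact ht.2.le)
  have e : g z' - g z - fderiv ℝ g z (z' - z) = (g (z + (1 : ℝ) • (z' - z)) -
    1 * fderiv ℝ g z (z' - z)) - (g (z + (0 : ℝ) • (z' - z)) - 0 * fderiv ℝ g z (z' - z)) := by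
    simp; ring
  rw [e]; exact this

/-- Convexity keeps the segments between two configurations inside the set where the derivative
bounds are assumed. -/
lemma convex_ballM (R : ℝ) : Convex ℝ (ballM d m R) := by
  have : ConvexOn ℝ univ (fun q : Fin m → M d => (m : ℝ)⁻¹ * ∑ j, ‖q j‖ ^ 2) := by
    have h : ConvexOn ℝ univ (fun q : Fin m → M d => ∑ j, ‖q j‖ ^ 2) := by
      have hj : ∀ j, ConvexOn ℝ univ (fun q : Fin m → M d => ‖q j‖ ^ 2) := fun j =>
        ((convexOn_univ_norm (E := M d)).comp_linearMap
          (LinearMap.proj (R := ℝ) (φ := fun _ : Fin m => M d) j)).pow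
            (fun _ _ => norm_nonneg _) 2
      have := Finset.sum_induction (s := Finset.univ)
        (fun j => fun q : Fin m → M d => ‖q j‖ ^ 2) (fun g => ConvexOn ℝ univ g)
        (fun _ _ h1 h2 => h1.add h2) (convexOn_const 0 convex_univ) (fun j _ => hj j)
      convert this using 1
      ext q; simp
    exact h.smul (by positivity)
  simpa [ballM] using this.convex_le (R ^ 2)

/-- The new derivative enters in the first slot. The scaling hypotheses cover every order of the
indices, so the symmetry of higher derivatives is never invoked. -/
lemma fderiv_D1 {f : (Fin m → M d) → ℝ} (hf : ContDiff ℝ 2 f) (z : Fin m → M d) (k j : Fin m)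
    (β α : Fin d) : fderiv ℝ (fun w => D1 f w j α) z (dir k β) = D2 f z k j β α := by
  have : (fun w => D1 f w j α) = fun w => iteratedFDeriv ℝ 1 f w ![dir j α] := by
    ext w; simp [D1]
  rw [this, fderiv_continuousMultilinear_apply_const, D2, iteratedFDeriv_succ_apply_left]
  · rfl
  · exact (hf.differentiable_iteratedFDeriv (m := 1) (by norm_num)) z

lemma fderiv_D2 {f : (Fin m → M d) → ℝ} (hf : ContDiff ℝ 3 f) (z : Fin m → M d) (k i j : Fin m)
    (κ α β : Fin d) : fderiv ℝ (fun w => D2 f w i j α β) z (dir k κ) = D3 f z k i j κ α β := by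
  unfold D2
  rw [fderiv_continuousMultilinear_apply_const, D3, iteratedFDeriv_succ_apply_left]
  · rfl
  · exact (hf.differentiable_iteratedFDeriv (m := 2) (by norm_num)) z

lemma differentiable_D1 {f : (Fin m → M d) → ℝ} (hf : ContDiff ℝ 2 f) (j : Fin m) (α : Fin d) :
    Differentiable ℝ (fun w => D1 f w j α) := by
  have : (fun w => D1 f w j α) = fun w => iteratedFDeriv ℝ 1 f w ![dir j α] := by
    ext w; simp [D1]
  rw [this]
  intro z
  exact ((hf.differentiable_iteratedFDeriv (m := 1) (by norm_num)) z).continuousMultilinear_apply_const _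

lemma differentiable_D2 {f : (Fin m → M d) → ℝ} (hf : ContDiff ℝ 3 f) (i j : Fin m)
    (α β : Fin d) : Differentiable ℝ (fun w => D2 f w i j α β) := fun z =>
  ((hf.differentiable_iteratedFDeriv (m := 2) (by norm_num)) z).continuousMultilinear_apply_const _

lemma dir_comp_perm (σ : Equiv.Perm (Fin m)) (i : Fin m) (α : Fin d) :
    (dir (σ i) α : Fin m → M d) ∘ σ = dir i α := by
  ext k : 1
  simp [dir, Pi.single_apply, σ.injective.eq_iff]

/-- The relabelling `z ↦ z ∘ σ`. -/
def permCLM (σ : Equiv.Perm (Fin m)) : (Fin m → M d) →L[ℝ] (Fin m → M d) :=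
  ContinuousLinearMap.pi fun i => ContinuousLinearMap.proj (σ i)

lemma permCLM_apply (σ : Equiv.Perm (Fin m)) (z : Fin m → M d) : permCLM σ z = z ∘ σ := rfl

/-- Chain rule for the linear map `permCLM σ`, under which `f` is invariant; it sends `dir (σ i) α`
to `dir i α`. -/
lemma D1_perm {f : (Fin m → M d) → ℝ} (hf : Differentiable ℝ f) (σ : Equiv.Perm (Fin m))
    (hs : ∀ z, f (z ∘ σ) = f z) (z : Fin m → M d) (i : Fin m) (α : Fin d) :
    D1 f (z ∘ σ) i α = D1 f z (σ i) α := by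
  have e : f ∘ permCLM σ = f := funext hs
  have h : fderiv ℝ f z = (fderiv ℝ f (permCLM σ z)).comp (permCLM σ) := by
    conv_lhs => rw [← e]
    rw [fderiv_comp z (hf _) (permCLM σ).differentiableAt, ContinuousLinearMap.fderiv]
  rw [D1, D1, h, ContinuousLinearMap.comp_apply, permCLM_apply, permCLM_apply, dir_comp_perm]

lemma D2_perm {f : (Fin m → M d) → ℝ} (hf : ContDiff ℝ 2 f) (σ : Equiv.Perm (Fin m))
    (hs : ∀ z, f (z ∘ σ) = f z) (z : Fin m → M d) (i j : Fin m) (α β : Fin d) :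
    D2 f (z ∘ σ) i j α β = D2 f z (σ i) (σ j) α β := by
  have e : f ∘ permCLM σ = f := funext hs
  have h := (permCLM σ).iteratedFDeriv_comp_right hf z (i := 2) le_rfl
  rw [e] at h
  rw [D2, D2, h, ContinuousMultilinearMap.compContinuousLinearMap_apply]
  congr 1
  ext k : 1
  fin_cases k
  · exact (dir_comp_perm σ i α).symm
  · exact (dir_comp_perm σ j β).symm

end Derivatives

/-! ### Estimates uniform in `m` under the mean-field scaling -/

section Scaled
variable {d m : ℕ}

/-- The derivatives of `f` of order two and three have the mean-field scaling on `𝔹_R^m`. -/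
structure ScaledOn (f : (Fin m → M d) → ℝ) (R C : ℝ) : Prop where
  smooth : ContDiff ℝ 3 f
  nonneg : 0 ≤ C
  second : ∀ q ∈ ballM d m R, ∀ (i j : Fin m) (α β : Fin d),
    (i = j → |D2 f q i j α β| ≤ C / (m : ℝ)) ∧ (i ≠ j → |D2 f q i j α β| ≤ C / (m : ℝ) ^ 2)
  third : ∀ q ∈ ballM d m R, ∀ (i j k : Fin m) (α β κ : Fin d),
    (i = j ∧ j = k → |D3 f q i j k α β κ| ≤ C / (m : ℝ)) ∧
    ((i = j ∧ j ≠ k) ∨ (i ≠ j ∧ j = k) ∨ (i = k ∧ k ≠ j) →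
      |D3 f q i j k α β κ| ≤ C / (m : ℝ) ^ 2) ∧
    (i ≠ j ∧ j ≠ k ∧ i ≠ k → |D3 f q i j k α β κ| ≤ C / (m : ℝ) ^ 3)

/-- The weight of the `k`-th point relative to the marked point `j`. -/
def wt (m : ℕ) (j k : Fin m) : ℝ := (if k = j then 1 else 0) + (m : ℝ)⁻¹

lemma wt_nonneg (j k : Fin m) : 0 ≤ wt m j k := by
  unfold wt; split_ifs <;> positivity

/-- Weighted sums split into the value at the marked point plus a mean. With `g` the displacements,
the mean is the cost of a matching, which survives as `m → ∞`. -/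
lemma sum_wt_mul (j : Fin m) (g : Fin m → ℝ) :
    ∑ k, wt m j k * g k = g j + (m : ℝ)⁻¹ * ∑ k, g k := by
  simp [wt, add_mul, Finset.sum_add_distrib, Finset.mul_sum]

variable [NeZero m] {f : (Fin m → M d) → ℝ} {R C : ℝ} {z z' : Fin m → M d}

lemma one_le_natCast : (1 : ℝ) ≤ m := by
  exact_mod_cast Nat.one_le_iff_ne_zero.2 (NeZero.ne m)

lemma ScaledOn.abs_D2_le (h : ScaledOn f R C) (hz : z ∈ ballM d m R) (k j : Fin m)
    (β α : Fin d) : |m * D2 f z k j β α| ≤ C * wt m j k := by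
  have hm : (1 : ℝ) ≤ m := one_le_natCast
  have hm0 : (0 : ℝ) < m := by linarith
  have hC := h.nonneg
  obtain ⟨h1, h2⟩ := h.second z hz k j β α
  rw [abs_mul, abs_of_pos hm0, wt]
  split_ifs with hk
  · calc (m : ℝ) * |D2 f z k j β α| ≤ m * (C / m) := by gcongr; exact h1 hk
      _ = C * 1 := by field_simp
      _ ≤ _ := by gcongr; simp
  · calc (m : ℝ) * |D2 f z k j β α| ≤ m * (C / m ^ 2) := by gcongr; exact h2 hk
      _ = _ := by field_simp; simp

lemma ScaledOn.abs_D3_diag_le (h : ScaledOn f R C) (hz : z ∈ ballM d m R) (k j : Fin m)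
    (κ β α : Fin d) : |m * D3 f z k j j κ β α| ≤ C * wt m j k := by
  have hm : (1 : ℝ) ≤ m := one_le_natCast
  have hm0 : (0 : ℝ) < m := by linarith
  have hC := h.nonneg
  obtain ⟨h1, h2, -⟩ := h.third z hz k j j κ β α
  rw [abs_mul, abs_of_pos hm0, wt]
  split_ifs with hk
  · calc (m : ℝ) * |D3 f z k j j κ β α| ≤ m * (C / m) := by gcongr; exact h1 ⟨hk, rfl⟩
      _ = C * 1 := by field_simp
      _ ≤ _ := by gcongr; simp
  · calc (m : ℝ) * |D3 f z k j j κ β α| ≤ m * (C / m ^ 2) := by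
          gcongr; exact h2 (Or.inr (Or.inl ⟨hk, rfl⟩))
      _ = _ := by field_simp; simp

/-- There are now two marked points `i ≠ j`. If `k` is one of them the derivative is at most `C / m
^ 2`, otherwise at most `C / m ^ 3`; the factor `c` absorbs two powers of `m`. It is left free
because the normalization used later is slightly smaller than `m ^ 2`. -/
lemma ScaledOn.abs_D3_off_le (h : ScaledOn f R C) (hz : z ∈ ballM d m R) {c : ℝ} (hc0 : 0 ≤ c)
    (hc : c ≤ (m : ℝ) ^ 2) (k : Fin m) {i j : Fin m} (hij : i ≠ j) (κ β α : Fin d) :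
    |c * D3 f z k i j κ β α| ≤ C * ((if k = i then 1 else 0) + wt m j k) := by
  have hm : (1 : ℝ) ≤ m := one_le_natCast
  have hm0 : (0 : ℝ) < m := by linarith
  have hC := h.nonneg
  obtain ⟨-, h2, h3⟩ := h.third z hz k i j κ β α
  rw [abs_mul, abs_of_nonneg hc0, wt]
  have key : k = i ∨ k = j → c * |D3 f z k i j κ β α| ≤ C := fun hk => by
    calc c * |D3 f z k i j κ β α| ≤ m ^ 2 * (C / m ^ 2) := by
          gcongr
          apply h2
          rcases hk with hk | hk
          · exact Or.inl ⟨hk, hij⟩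
          · exact Or.inr (Or.inr ⟨hk, hij.symm⟩)
      _ = C := by field_simp
  have hm' : 0 ≤ (m : ℝ)⁻¹ := by positivity
  by_cases hki : k = i
  · refine (key (Or.inl hki)).trans (le_mul_of_one_le_right hC ?_)
    rw [if_pos hki]; split_ifs <;> linarith
  by_cases hkj : k = j
  · refine (key (Or.inr hkj)).trans (le_mul_of_one_le_right hC ?_)
    rw [if_neg hki, if_pos hkj]; linarith
  rw [if_neg hki, if_neg hkj]
  calc c * |D3 f z k i j κ β α| ≤ m ^ 2 * (C / m ^ 3) := by gcongr; exact h3 ⟨hki, hij, hkj⟩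
    _ = _ := by field_simp; simp

/-- The Hessian of the rescaled gradient at `j` is dominated by a rank-one part `wt l * wt k` and a
diagonal part. The diagonal part is needed for `l = k ≠ j`, where two indices coincide and the
product of weights would be of order `m⁻²` instead of `m⁻¹`. -/
lemma ScaledOn.abs_D3_le (h : ScaledOn f R C) (hz : z ∈ ballM d m R) (l k j : Fin m)
    (κ β α : Fin d) :
    |m * D3 f z l k j κ β α| ≤ C * (wt m j l * wt m j k + if l = k then wt m j k else 0) := by
  have hm : (1 : ℝ) ≤ m := one_le_natCast
  have hm0 : (0 : ℝ) < m := by linarith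
  have hC := h.nonneg
  by_cases hkj : k = j
  · subst hkj
    refine (h.abs_D3_diag_le hz l k κ β α).trans ?_
    gcongr
    have h1 : 1 ≤ wt m k k := by simp [wt]
    have h2 := wt_nonneg k l
    have h3 := wt_nonneg k k
    split_ifs <;> nlinarith
  · have hc := h.abs_D3_off_le (c := m ^ 2) hz (by positivity) le_rfl l hkj κ β α
    -- Only one factor `m` is present here, so the bound for `m ^ 2` gains `m⁻¹`, which is exactly
    -- `wt m j k` for `k ≠ j`.
    have e : |(m : ℝ) * D3 f z l k j κ β α| = (m : ℝ)⁻¹ * |(m : ℝ) ^ 2 * D3 f z l k j κ β α| := by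
      rw [abs_mul, abs_mul, abs_of_pos hm0, abs_of_pos (by positivity : (0 : ℝ) < m ^ 2)]
      field_simp
    rw [e]
    have e2 : wt m j k = (m : ℝ)⁻¹ := by simp [wt, hkj]
    rw [e2]
    calc (m : ℝ)⁻¹ * |(m : ℝ) ^ 2 * D3 f z l k j κ β α|
        ≤ (m : ℝ)⁻¹ * (C * ((if l = k then 1 else 0) + wt m j l)) := by gcongr
      _ = _ := by split_ifs <;> ring

lemma ScaledOn.lip_grad (h : ScaledOn f R C) (hz : z ∈ ballM d m R) (hz' : z' ∈ ballM d m R)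
    (j : Fin m) (α : Fin d) :
    |m * D1 f z' j α - m * D1 f z j α| ≤
      d * (C * (‖z' j - z j‖ + (m : ℝ)⁻¹ * ∑ k, ‖z' k - z k‖)) := by
  have hf : ContDiff ℝ 2 f := h.smooth.of_le (by norm_num)
  refine (abs_sub_le_of_partial (g := fun w => m * D1 f w j α)
    ((differentiable_D1 hf j α).const_mul _) (convex_ballM R) hz hz' (fun k => C * wt m j k)
    fun w hw k β => ?_).trans (le_of_eq ?_)
  · rw [fderiv_const_mul (differentiable_D1 hf j α w), smul_apply, fderiv_D1 hf]
    exact h.abs_D2_le hw k j β α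
  · simp_rw [mul_assoc]; rw [← Finset.mul_sum, sum_wt_mul]

lemma ScaledOn.lip_diag (h : ScaledOn f R C) (hz : z ∈ ballM d m R) (hz' : z' ∈ ballM d m R)
    (j : Fin m) (β α : Fin d) :
    |m * D2 f z' j j β α - m * D2 f z j j β α| ≤
      d * (C * (‖z' j - z j‖ + (m : ℝ)⁻¹ * ∑ k, ‖z' k - z k‖)) := by
  refine (abs_sub_le_of_partial (g := fun w => m * D2 f w j j β α)
    ((differentiable_D2 h.smooth j j β α).const_mul _) (convex_ballM R) hz hz'
    (fun k => C * wt m j k) fun w hw k κ => ?_).trans (le_of_eq ?_)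
  · rw [fderiv_const_mul (differentiable_D2 h.smooth j j β α w), smul_apply, fderiv_D2 h.smooth]
    exact h.abs_D3_diag_le hw k j κ β α
  · simp_rw [mul_assoc]; rw [← Finset.mul_sum, sum_wt_mul]

lemma ScaledOn.lip_off (h : ScaledOn f R C) (hz : z ∈ ballM d m R) (hz' : z' ∈ ballM d m R)
    {c : ℝ} (hc0 : 0 ≤ c) (hc : c ≤ (m : ℝ) ^ 2) {i j : Fin m} (hij : i ≠ j) (β α : Fin d) :
    |c * D2 f z' i j β α - c * D2 f z i j β α| ≤
      d * (C * (‖z' i - z i‖ + ‖z' j - z j‖ + (m : ℝ)⁻¹ * ∑ k, ‖z' k - z k‖)) := by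
  refine (abs_sub_le_of_partial (g := fun w => c * D2 f w i j β α)
    ((differentiable_D2 h.smooth i j β α).const_mul _) (convex_ballM R) hz hz'
    (fun k => C * ((if k = i then 1 else 0) + wt m j k)) fun w hw k κ => ?_).trans (le_of_eq ?_)
  · rw [fderiv_const_mul (differentiable_D2 h.smooth i j β α w), smul_apply, fderiv_D2 h.smooth]
    exact h.abs_D3_off_le hw hc0 hc k hij κ β α
  · simp_rw [mul_assoc]
    rw [← Finset.mul_sum]
    simp_rw [add_mul]
    rw [Finset.sum_add_distrib, sum_wt_mul]
    simp [add_assoc]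

lemma ScaledOn.abs_off_le (h : ScaledOn f R C) (hz : z ∈ ballM d m R)
    {c : ℝ} (hc0 : 0 ≤ c) (hc : c ≤ (m : ℝ) ^ 2) {i j : Fin m} (hij : i ≠ j) (β α : Fin d) :
    |c * D2 f z i j β α| ≤ C := by
  have hm0 : (0 : ℝ) < m := by linarith [one_le_natCast (m := m)]
  have hC := h.nonneg
  rw [abs_mul, abs_of_nonneg hc0]
  calc c * |D2 f z i j β α| ≤ m ^ 2 * (C / m ^ 2) := by
        gcongr; exact (h.second z hz i j β α).2 hij
    _ = C := by field_simp

lemma ScaledOn.abs_diag_le (h : ScaledOn f R C) (hz : z ∈ ballM d m R) (j : Fin m)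
    (β α : Fin d) : |m * D2 f z j j β α| ≤ C := by
  have hm0 : (0 : ℝ) < m := by linarith [one_le_natCast (m := m)]
  have hC := h.nonneg
  rw [abs_mul, abs_of_pos hm0]
  calc m * |D2 f z j j β α| ≤ m * (C / m) := by
        gcongr; exact (h.second z hz j j β α).1 rfl
    _ = C := by field_simp

/-- With `v` the displacements and `w` the weights at `j`, the third derivatives give the quadratic
form `(∑ w v)² + ∑ w v²`. The weights have total mass 2, so by Cauchy–Schwarz the first term is at
most `2 ∑ w v²`, whence the factor 3. -/
lemma ScaledOn.taylor_grad (h : ScaledOn f R C) (hz : z ∈ ballM d m R) (hz' : z' ∈ ballM d m R)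
    (j : Fin m) (α : Fin d) :
    |m * D1 f z' j α - m * D1 f z j α - ∑ k, ∑ β, (z' k - z k) β * (m * D2 f z k j β α)| ≤
      3 * d ^ 2 * C * (‖z' j - z j‖ ^ 2 + (m : ℝ)⁻¹ * ∑ k, ‖z' k - z k‖ ^ 2) := by
  have hf : ContDiff ℝ 2 f := h.smooth.of_le (by norm_num)
  have hC := h.nonneg
  have hm0 : (0 : ℝ) < m := by linarith [one_le_natCast (m := m)]
  have e1 : ∀ k β, (fun w => fderiv ℝ (fun w => (m : ℝ) * D1 f w j α) w (dir k β)) =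
      fun w => (m : ℝ) * D2 f w k j β α := fun k β => by
    ext w
    rw [fderiv_const_mul (differentiable_D1 hf j α w), smul_apply, fderiv_D1 hf, smul_eq_mul]
  have key := abs_taylor_le_of_partial (g := fun w => m * D1 f w j α)
    ((differentiable_D1 hf j α).const_mul _)
    (fun k β => by rw [e1]; exact (differentiable_D2 h.smooth k j β α).const_mul _)
    (convex_ballM R) hz hz'
    (fun k l => C * (wt m j l * wt m j k + if l = k then wt m j k else 0))
    (fun k l => by
      have := wt_nonneg j l
      have := wt_nonneg j k
      split_ifs <;> positivity)
    (fun w hw k β l κ => by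
      rw [e1, fderiv_const_mul (differentiable_D2 h.smooth k j β α w), smul_apply,
        fderiv_D2 h.smooth]
      exact h.abs_D3_le hw l k j κ β α)
  rw [clm_eq_sum_dir] at key
  have e2 : ∀ k β, fderiv ℝ (fun w => (m : ℝ) * D1 f w j α) z (dir k β) =
      (m : ℝ) * D2 f z k j β α := fun k β => congrFun (e1 k β) z
  simp_rw [e2] at key
  refine key.trans ?_
  set v : Fin m → ℝ := fun k => ‖z' k - z k‖
  have s1 : ∀ k, ∑ l, C * (wt m j l * wt m j k + if l = k then wt m j k else 0) * v l =
      C * (wt m j k * ∑ l, wt m j l * v l + wt m j k * v k) := fun k => by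
    simp_rw [mul_assoc]
    rw [← Finset.mul_sum]
    congr 1
    simp_rw [add_mul, Finset.sum_add_distrib, ite_mul, zero_mul]
    rw [Finset.sum_ite_eq' Finset.univ k, if_pos (Finset.mem_univ k), Finset.mul_sum]
    congr 1
    exact Finset.sum_congr rfl fun l _ => by ring
  have s2 : d * ∑ k, (d * ∑ l, C * (wt m j l * wt m j k + if l = k then wt m j k else 0) * v l)
      * v k = d ^ 2 * C * ((∑ k, wt m j k * v k) ^ 2 + ∑ k, wt m j k * v k ^ 2) := by
    simp_rw [s1]
    set A := ∑ l, wt m j l * v l with hA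
    have : ∑ k, d * (C * (wt m j k * A + wt m j k * v k)) * v k =
        d * C * (A * ∑ k, wt m j k * v k + ∑ k, wt m j k * v k ^ 2) := by
      rw [Finset.mul_sum, ← Finset.sum_add_distrib, Finset.mul_sum]
      exact Finset.sum_congr rfl fun k _ => by ring
    rw [this, ← hA]; ring
  have s3 : (∑ k, wt m j k * v k) ^ 2 ≤ (∑ k, wt m j k) * ∑ k, wt m j k * v k ^ 2 :=
    Finset.sum_sq_le_sum_mul_sum_of_sq_le_mul _ (fun k _ => wt_nonneg j k)
      (fun k _ => mul_nonneg (wt_nonneg j k) (sq_nonneg _)) (fun k _ => le_of_eq (by ring))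
  have s4 : ∑ k, wt m j k = 2 := by
    have := sum_wt_mul j (fun _ => (1 : ℝ))
    simp only [mul_one, Finset.sum_const, Finset.card_univ, Fintype.card_fin, nsmul_eq_mul,
      inv_mul_cancel₀ hm0.ne'] at this
    rw [this]; norm_num
  change d * ∑ k, (d * ∑ l, C * (wt m j l * wt m j k + if l = k then wt m j k else 0) * v l)
      * v k ≤ _
  rw [s2, ← sum_wt_mul j (fun k => ‖z' k - z k‖ ^ 2)]
  rw [s4] at s3
  change _ ≤ 3 * d ^ 2 * C * ∑ k, wt m j k * v k ^ 2
  have : 0 ≤ (d : ℝ) ^ 2 * C := by positivity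
  nlinarith

end Scaled

/-! ### Couplings, `W₂`, and plans between empirical measures -/

section Plans
variable {d m : ℕ}

lemma P2.integrable_sq (μ : P2 d) : Integrable (fun a : M d => ‖a‖ ^ 2) μ.meas :=
  (memLp_two_iff_integrable_sq_norm μ.memLp_id.1).1 μ.memLp_id

lemma coupling_mp_fst {μ ν : P2 d} {γ : Measure (M d × M d)} (h : γ ∈ couplings μ ν) :
    MeasurePreserving Prod.fst γ μ.meas := ⟨measurable_fst, h.1⟩

lemma coupling_mp_snd {μ ν : P2 d} {γ : Measure (M d × M d)} (h : γ ∈ couplings μ ν) :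
    MeasurePreserving Prod.snd γ ν.meas := ⟨measurable_snd, h.2⟩

lemma coupling_isProb {μ ν : P2 d} {γ : Measure (M d × M d)} (h : γ ∈ couplings μ ν) :
    IsProbabilityMeasure γ := by
  constructor
  rw [← preimage_univ (f := Prod.fst), (coupling_mp_fst h).measure_preimage nullMeasurableSet_univ]
  exact measure_univ

lemma coupling_memLp_sub {μ ν : P2 d} {γ : Measure (M d × M d)} (h : γ ∈ couplings μ ν) :
    MemLp (fun p : M d × M d => p.1 - p.2) 2 γ :=
  (μ.memLp_id.comp_measurePreserving (coupling_mp_fst h)).sub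
    (ν.memLp_id.comp_measurePreserving (coupling_mp_snd h))

lemma coupling_integrable_sq {μ ν : P2 d} {γ : Measure (M d × M d)} (h : γ ∈ couplings μ ν) :
    Integrable (fun p : M d × M d => ‖p.1 - p.2‖ ^ 2) γ :=
  (memLp_two_iff_integrable_sq_norm (coupling_memLp_sub h).1).1 (coupling_memLp_sub h)

lemma coupling_integrable_norm {μ ν : P2 d} {γ : Measure (M d × M d)} (h : γ ∈ couplings μ ν) :
    Integrable (fun p : M d × M d => ‖p.1 - p.2‖) γ :=
  have := coupling_isProb h
  ((coupling_memLp_sub h).integrable one_le_two).norm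

lemma cost_nonneg (γ : Measure (M d × M d)) : 0 ≤ cost γ :=
  integral_nonneg fun _ => by positivity

/-- Nonnegativity of the variance of the displacement under the probability measure `γ`. -/
lemma integral_dist_le_sqrt_cost {μ ν : P2 d} {γ : Measure (M d × M d)} (h : γ ∈ couplings μ ν) :
    ∫ p, ‖p.1 - p.2‖ ∂γ ≤ Real.sqrt (cost γ) := by
  have := coupling_isProb h
  have hi := coupling_integrable_norm h
  set c := ∫ p, ‖p.1 - p.2‖ ∂γ with hc
  apply Real.le_sqrt_of_sq_le
  have h1 : 0 ≤ ∫ p, (‖p.1 - p.2‖ - c) ^ 2 ∂γ := integral_nonneg fun _ => sq_nonneg _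
  have h2 : ∫ p, (‖p.1 - p.2‖ - c) ^ 2 ∂γ = cost γ - 2 * c * c + c ^ 2 := by
    have : ∀ p : M d × M d, (‖p.1 - p.2‖ - c) ^ 2 = ‖p.1 - p.2‖ ^ 2 - 2 * c * ‖p.1 - p.2‖ + c ^ 2 :=
      fun p => by ring
    simp_rw [this]
    rw [integral_add (f := fun p : M d × M d => ‖p.1 - p.2‖ ^ 2 - 2 * c * ‖p.1 - p.2‖) ((coupling_integrable_sq h).sub (hi.const_mul _)) (integrable_const _),
      integral_sub (coupling_integrable_sq h) (hi.const_mul _), integral_const_mul]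
    simp [cost, hc]
  nlinarith

lemma prod_mem_couplings (μ ν : P2 d) : μ.meas.prod ν.meas ∈ couplings μ ν := by
  constructor <;> simp

instance (μ ν : P2 d) : Nonempty (couplings μ ν) := ⟨⟨_, prod_mem_couplings μ ν⟩⟩

lemma W2_sq (μ ν : P2 d) : W2 μ ν ^ 2 = ⨅ γ : couplings μ ν, cost γ.1 :=
  Real.sq_sqrt (Real.iInf_nonneg fun γ => cost_nonneg γ.1)

lemma W2_nonneg (μ ν : P2 d) : 0 ≤ W2 μ ν := Real.sqrt_nonneg _

/-- Nearly optimal plans suffice for the Lipschitz bounds, so the existence of optimal plans is not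
needed. -/
lemma exists_coupling_cost_lt (μ ν : P2 d) {ε : ℝ} (hε : W2 μ ν ^ 2 < ε) :
    ∃ γ ∈ couplings μ ν, cost γ < ε := by
  rw [W2_sq] at hε
  obtain ⟨γ, hγ⟩ := exists_lt_of_ciInf_lt hε
  exact ⟨γ.1, γ.2, hγ⟩

lemma W2_sq_eq_of_forall_le {μ ν : P2 d} {γ : Measure (M d × M d)} (h : γ ∈ couplings μ ν)
    (hle : ∀ γ' ∈ couplings μ ν, cost γ ≤ cost γ') : W2 μ ν ^ 2 = cost γ := by
  rw [W2_sq]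
  apply le_antisymm
  · exact ciInf_le ⟨0, by rintro _ ⟨γ', rfl⟩; exact cost_nonneg γ'.1⟩ (⟨γ, h⟩ : couplings μ ν)
  · exact le_ciInf fun γ' => hle γ'.1 γ'.2

/-- The second coordinate vanishes almost surely, so all couplings with `δ₀` have the same cost and
`W₂` to `δ₀` is a second moment. -/
lemma cost_eq_of_mem_couplings_dirac {μ : P2 d} {γ : Measure (M d × M d)}
    (h : γ ∈ couplings μ (diracP2 0)) : cost γ = ∫ a, ‖a‖ ^ 2 ∂μ.meas := by
  have h0 : ∀ᵐ p ∂γ, p.2 = 0 := by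
    have h1 : ∀ᵐ x ∂(diracP2 (0 : M d)).meas, x = 0 := by
      change ∀ᵐ x ∂(Measure.dirac (0 : M d)), x = 0
      rw [ae_dirac_eq]; rfl
    exact (coupling_mp_snd h).quasiMeasurePreserving.ae h1
  rw [cost, ← (coupling_mp_fst h).map_eq, integral_map measurable_fst.aemeasurable
    (by fun_prop)]
  refine integral_congr_ae ?_
  filter_upwards [h0] with p hp
  simp [hp]

lemma mem_ballP2_iff {μ : P2 d} {r : ℝ} (hr : 0 ≤ r) :
    μ ∈ ballP2 d r ↔ ∫ a, ‖a‖ ^ 2 ∂μ.meas ≤ r ^ 2 := by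
  have h : W2 μ (diracP2 0) ^ 2 = ∫ a, ‖a‖ ^ 2 ∂μ.meas := by
    rw [W2_sq_eq_of_forall_le (prod_mem_couplings _ _) (fun γ' h' => ?_),
      cost_eq_of_mem_couplings_dirac (prod_mem_couplings _ _)]
    rw [cost_eq_of_mem_couplings_dirac (prod_mem_couplings _ _), cost_eq_of_mem_couplings_dirac h']
  rw [← h, ballP2, mem_ofPred_eq, sq_le_sq₀ (W2_nonneg _ _) hr]

lemma integral_average_dirac {E : Type*} [MeasurableSpace E] [MeasurableSingletonClass E]
    (z : Fin m → E) (g : E → ℝ) :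
    ∫ a, g a ∂((m : ℝ≥0∞)⁻¹ • ∑ i, Measure.dirac (z i)) = (m : ℝ)⁻¹ * ∑ i, g (z i) := by
  rw [integral_smul_measure, integral_finsetSum_measure (fun i _ => integrable_dirac (by simp))]
  simp [integral_dirac]

/-- The plan `m⁻¹ ∑ᵢ δ_{(zᵢ, zᵢ')}`. -/
def diagPlan (z z' : Fin m → M d) : Measure (M d × M d) :=
  (m : ℝ≥0∞)⁻¹ • ∑ i, Measure.dirac (z i, z' i)

lemma cost_diagPlan (z z' : Fin m → M d) :
    cost (diagPlan z z') = (m : ℝ)⁻¹ * ∑ i, ‖z i - z' i‖ ^ 2 :=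
  integral_average_dirac (fun i => (z i, z' i)) _

section Empirical
variable [NeZero m]

lemma integral_empirical (z : Fin m → M d) (g : M d → ℝ) :
    ∫ a, g a ∂(empirical z).meas = (m : ℝ)⁻¹ * ∑ i, g (z i) :=
  integral_average_dirac z g

lemma empirical_mem_ballP2 {z : Fin m → M d} {r : ℝ} (hr : 0 ≤ r) (hz : z ∈ ballM d m r) :
    empirical z ∈ ballP2 d r := by
  rw [mem_ballP2_iff hr, integral_empirical]; exact hz

lemma P2.ext {μ ν : P2 d} (h : μ.meas = ν.meas) : μ = ν := by
  cases μ; cases ν; simp_all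

lemma empirical_comp_perm (z : Fin m → M d) (σ : Equiv.Perm (Fin m)) :
    empirical (z ∘ σ) = empirical z := by
  apply P2.ext
  simp only [empirical, Function.comp_apply]
  rw [Equiv.sum_comp σ (fun i => Measure.dirac (z i))]

lemma restr_comp_perm (U : P2 d → ℝ) (z : Fin m → M d) (σ : Equiv.Perm (Fin m)) :
    restr U m (z ∘ σ) = restr U m z := by
  rw [restr, restr, empirical_comp_perm]

lemma diagPlan_mem (z z' : Fin m → M d) :
    diagPlan z z' ∈ couplings (empirical z) (empirical z') := by
  constructor
  · simp [diagPlan, empirical, Measure.map_smul, Measure.map_finset_sum' measurable_fst.aemeasurable,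
      Measure.map_dirac' measurable_fst]
  · simp [diagPlan, empirical, Measure.map_smul, Measure.map_finset_sum' measurable_snd.aemeasurable,
      Measure.map_dirac' measurable_snd]

lemma ae_empirical (z : Fin m → M d) : ∀ᵐ a ∂(empirical z).meas, ∃ i, a = z i := by
  have h : (empirical z).meas (range z)ᶜ = 0 := by
    simp [empirical, (finite_range z).measurableSet]
  have h' : ∀ᵐ a ∂(empirical z).meas, a ∈ range z := h
  filter_upwards [h'] with a ha
  obtain ⟨i, hi⟩ := ha
  exact ⟨i, hi.symm⟩

/-- A plan that moves every point `zᵢ` to `zᵢ'`, while no other point `zₖ` is nearer to `zᵢ'`, is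
optimal. -/
lemma diagPlan_mem_optPlans (z z' : Fin m → M d) (h : ∀ i k, ‖z i - z' i‖ ≤ ‖z k - z' i‖) :
    diagPlan z z' ∈ optPlans (empirical z) (empirical z') := by
  refine ⟨diagPlan_mem z z', W2_sq_eq_of_forall_le (diagPlan_mem z z') fun γ' h' => ?_⟩
  -- Squared distance to the source points, used as a dual certificate: every plan costs at least
  -- the integral of `φ` against the target, and the diagonal plan attains it.
  set φ : M d → ℝ := fun b => (⨅ k, ‖z k - b‖) ^ 2 with hφ_def
  have hbdd : ∀ b, BddBelow (range fun k => ‖z k - b‖) := fun b =>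
    ⟨0, by rintro _ ⟨k, rfl⟩; exact norm_nonneg _⟩
  have hφ : ∀ i, φ (z' i) = ‖z i - z' i‖ ^ 2 := fun i => by
    have : (⨅ k, ‖z k - z' i‖) = ‖z i - z' i‖ :=
      le_antisymm (ciInf_le (hbdd _) i) (le_ciInf (h i))
    simp [hφ_def, this]
  have hφm : Measurable φ := by
    refine Measurable.pow_const (Measurable.iInf fun k => ?_) 2
    fun_prop
  have h1 : ∫ p, φ p.2 ∂γ' = cost (diagPlan z z') := by
    have e := integral_map (μ := γ') measurable_snd.aemeasurable
      (hφm.aestronglyMeasurable (μ := γ'.map Prod.snd))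
    rw [← e, h'.2, integral_empirical, cost_diagPlan]
    simp_rw [hφ]
  rw [← h1]
  refine integral_mono_of_nonneg (ae_of_all _ fun _ => sq_nonneg _) (coupling_integrable_sq h') ?_
  filter_upwards [(coupling_mp_fst h').quasiMeasurePreserving.ae (ae_empirical z)] with p hp
  obtain ⟨k, hk⟩ := hp
  have h0 : 0 ≤ ⨅ k, ‖z k - p.2‖ := Real.iInf_nonneg fun _ => norm_nonneg _
  change (⨅ k, ‖z k - p.2‖) ^ 2 ≤ _
  gcongr
  rw [hk]
  exact ciInf_le (hbdd _) k

end Empirical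
end Plans

/-! ### Fractional transports to equally weighted points, and Birkhoff's theorem -/

section Allocations
variable {d m : ℕ}

/-- A transport of `μ` to `m` equally weighted points `x i`: the fraction `w i a` of the mass at
`a` is sent to `x i`. -/
structure Alloc (μ : P2 d) (m : ℕ) where
  /-- the points -/
  x : Fin m → M d
  /-- the fractions -/
  w : Fin m → M d → ℝ
  meas : ∀ i, Measurable (w i)
  nonneg : ∀ i a, 0 ≤ w i a
  sum_eq : ∀ a, ∑ i, w i a = 1
  integral_eq : ∀ i, ∫ a, w i a ∂μ.meas = (m : ℝ)⁻¹

namespace Alloc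
variable {μ ν : P2 d}

/-- The mean square displacement of the mass at `a`. -/
def dev (A : Alloc μ m) (a : M d) : ℝ := ∑ i, A.w i a * ‖a - A.x i‖ ^ 2

/-- The mean displacement of the mass at `a`. -/
def dev1 (A : Alloc μ m) (a : M d) : ℝ := ∑ i, A.w i a * ‖a - A.x i‖

/-- The cost of the transport. -/
def tcost (A : Alloc μ m) : ℝ := ∫ a, A.dev a ∂μ.meas

lemma w_le_one (A : Alloc μ m) (i : Fin m) (a : M d) : A.w i a ≤ 1 := by
  rw [← A.sum_eq a]
  exact Finset.single_le_sum (f := fun i => A.w i a) (fun j _ => A.nonneg j a) (Finset.mem_univ i)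

lemma norm_w_le_one (A : Alloc μ m) (i : Fin m) (a : M d) : ‖A.w i a‖ ≤ 1 := by
  rw [Real.norm_of_nonneg (A.nonneg i a)]; exact A.w_le_one i a

lemma integrable_w (A : Alloc μ m) (i : Fin m) : Integrable (A.w i) μ.meas :=
  Integrable.of_bound (A.meas i).aestronglyMeasurable 1 (ae_of_all _ (A.norm_w_le_one i))

lemma integrable_w_mul (A : Alloc μ m) (i : Fin m) {g : M d → ℝ} (hg : Integrable g μ.meas) :
    Integrable (fun a => A.w i a * g a) μ.meas :=
  hg.bdd_mul (A.meas i).aestronglyMeasurable (ae_of_all _ (A.norm_w_le_one i))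

lemma integrable_sq_sub (μ : P2 d) (y : M d) :
    Integrable (fun a : M d => ‖a - y‖ ^ 2) μ.meas := by
  have h : MemLp (fun a : M d => a - y) 2 μ.meas := μ.memLp_id.sub (memLp_const y)
  exact (memLp_two_iff_integrable_sq_norm h.1).1 h

lemma integrable_dev (A : Alloc μ m) : Integrable A.dev μ.meas :=
  integrable_finsetSum _ fun i _ => A.integrable_w_mul i (integrable_sq_sub μ _)

lemma dev_nonneg (A : Alloc μ m) (a : M d) : 0 ≤ A.dev a :=
  Finset.sum_nonneg fun i _ => mul_nonneg (A.nonneg i a) (sq_nonneg _)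

lemma tcost_nonneg (A : Alloc μ m) : 0 ≤ A.tcost := integral_nonneg A.dev_nonneg

lemma dev1_sq_le (A : Alloc μ m) (a : M d) : A.dev1 a ^ 2 ≤ A.dev a := by
  have := Finset.sum_sq_le_sum_mul_sum_of_sq_le_mul Finset.univ
    (r := fun i => A.w i a * ‖a - A.x i‖) (f := fun i => A.w i a)
    (g := fun i => A.w i a * ‖a - A.x i‖ ^ 2) (fun i _ => A.nonneg i a)
    (fun i _ => mul_nonneg (A.nonneg i a) (sq_nonneg _)) (fun i _ => le_of_eq (by ring))
  rwa [A.sum_eq, one_mul] at this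

/-- The average of `h` over the pairs of points to which the mass at `p` is sent. -/
def mix (A : Alloc μ m) (B : Alloc ν m) (h : Fin m → Fin m → ℝ) (p : M d × M d) : ℝ :=
  ∑ i, ∑ j, A.w i p.1 * B.w j p.2 * h i j

lemma mix_eq_of_separated (A : Alloc μ m) (B : Alloc ν m) (c : ℝ) (f g : Fin m → ℝ)
    (p : M d × M d) : A.mix B (fun i j => c + f i + g j) p =
      c + ∑ i, A.w i p.1 * f i + ∑ j, B.w j p.2 * g j := by
  simp only [mix, mul_add, Finset.sum_add_distrib]
  congr 1
  · congr 1
    · simp_rw [← Finset.sum_mul, ← Finset.mul_sum, B.sum_eq, mul_one, A.sum_eq, one_mul]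
    · refine Finset.sum_congr rfl fun i _ => ?_
      rw [← Finset.sum_mul, ← Finset.mul_sum, B.sum_eq, mul_one]
  · rw [Finset.sum_comm]
    refine Finset.sum_congr rfl fun j _ => ?_
    simp_rw [mul_assoc]
    rw [← Finset.sum_mul, A.sum_eq, one_mul]

lemma mix_mono (A : Alloc μ m) (B : Alloc ν m) {h k : Fin m → Fin m → ℝ}
    (hk : ∀ i j, h i j ≤ k i j) (p : M d × M d) : A.mix B h p ≤ A.mix B k p := by
  refine Finset.sum_le_sum fun i _ => Finset.sum_le_sum fun j _ => ?_
  exact mul_le_mul_of_nonneg_left (hk i j) (mul_nonneg (A.nonneg _ _) (B.nonneg _ _))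

/-- The triangle inequality through the pair `p` bounds all the costs used later by such separated
expressions; since both families of fractions sum to one, only one-sided averages remain, and these
are controlled by the transport costs. -/
lemma mix_le_of_separated (A : Alloc μ m) (B : Alloc ν m) {h : Fin m → Fin m → ℝ} {c : ℝ}
    {f g : Fin m → ℝ} (H : ∀ i j, h i j ≤ c + f i + g j) (p : M d × M d) :
    A.mix B h p ≤ c + ∑ i, A.w i p.1 * f i + ∑ j, B.w j p.2 * g j :=
  (A.mix_mono B H p).trans (A.mix_eq_of_separated B c f g p).le

lemma mix_const (A : Alloc μ m) (B : Alloc ν m) (c : ℝ) (p : M d × M d) :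
    A.mix B (fun _ _ => c) p = c := by
  simpa using A.mix_eq_of_separated B c (fun _ => 0) (fun _ => 0) p

lemma abs_mix_sub_le (A : Alloc μ m) (B : Alloc ν m) (h : Fin m → Fin m → ℝ) (t : ℝ)
    (p : M d × M d) : |A.mix B h p - t| ≤ A.mix B (fun i j => |h i j - t|) p := by
  have e : A.mix B h p - t = A.mix B (fun i j => h i j - t) p := by
    conv_lhs => rw [← A.mix_const B t p]
    simp only [mix, ← Finset.sum_sub_distrib, ← mul_sub]
  rw [e, mix]
  refine (Finset.abs_sum_le_sum_abs _ _).trans (Finset.sum_le_sum fun i _ => ?_)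
  refine (Finset.abs_sum_le_sum_abs _ _).trans (Finset.sum_le_sum fun j _ => ?_)
  rw [abs_mul, abs_of_nonneg (mul_nonneg (A.nonneg _ _) (B.nonneg _ _))]

variable {γ : Measure (M d × M d)}

lemma integrable_ww (A : Alloc μ m) (B : Alloc ν m) (hγ : γ ∈ couplings μ ν) (i j : Fin m) :
    Integrable (fun p : M d × M d => A.w i p.1 * B.w j p.2) γ := by
  have := coupling_isProb hγ
  refine Integrable.of_bound (((A.meas i).comp measurable_fst).mul
    ((B.meas j).comp measurable_snd)).aestronglyMeasurable 1 (ae_of_all _ fun p => ?_)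
  rw [norm_mul]
  exact mul_le_one₀ (A.norm_w_le_one i _) (norm_nonneg _) (B.norm_w_le_one j _)

lemma integrable_mix (A : Alloc μ m) (B : Alloc ν m) (hγ : γ ∈ couplings μ ν)
    (h : Fin m → Fin m → ℝ) : Integrable (A.mix B h) γ :=
  integrable_finsetSum _ fun i _ => integrable_finsetSum _ fun j _ =>
    (A.integrable_ww B hγ i j).mul_const _

lemma integral_mix (A : Alloc μ m) (B : Alloc ν m) (hγ : γ ∈ couplings μ ν)
    (h : Fin m → Fin m → ℝ) :
    ∫ p, A.mix B h p ∂γ = ∑ i, ∑ j, (∫ p, A.w i p.1 * B.w j p.2 ∂γ) * h i j := by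
  unfold mix
  rw [integral_finsetSum _ fun i _ => integrable_finsetSum _ fun j _ =>
    (A.integrable_ww B hγ i j).mul_const _]
  refine Finset.sum_congr rfl fun i _ => ?_
  rw [integral_finsetSum _ fun j _ => (A.integrable_ww B hγ i j).mul_const _]
  simp_rw [integral_mul_const]

/-- The mass that `γ` carries from point `i` to point `j`. Summing over one index removes its
fractions, the marginal condition reduces the rest to a single measure, and there each point
receives mass `m⁻¹`. -/
lemma mem_doublyStochastic [NeZero m] (A : Alloc μ m) (B : Alloc ν m) (hγ : γ ∈ couplings μ ν) :
    (Matrix.of fun i j => (m : ℝ) * ∫ p, A.w i p.1 * B.w j p.2 ∂γ) ∈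
      doublyStochastic ℝ (Fin m) := by
  have hm : (m : ℝ) ≠ 0 := by exact_mod_cast NeZero.ne m
  rw [mem_doublyStochastic_iff_sum]
  refine ⟨fun i j => ?_, fun i => ?_, fun j => ?_⟩
  · exact mul_nonneg (by positivity)
      (integral_nonneg fun p => mul_nonneg (A.nonneg _ _) (B.nonneg _ _))
  · simp only [Matrix.of_apply]
    rw [← Finset.mul_sum, ← integral_finsetSum _ fun j _ => A.integrable_ww B hγ i j]
    simp_rw [← Finset.mul_sum, B.sum_eq, mul_one]
    have e := integral_map (μ := γ) measurable_fst.aemeasurable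
      ((A.meas i).aestronglyMeasurable (μ := γ.map Prod.fst))
    rw [← e, hγ.1, A.integral_eq, mul_inv_cancel₀ hm]
  · simp only [Matrix.of_apply]
    rw [← Finset.mul_sum, ← integral_finsetSum _ fun i _ => A.integrable_ww B hγ i j]
    simp_rw [← Finset.sum_mul, A.sum_eq, one_mul]
    have e := integral_map (μ := γ) measurable_snd.aemeasurable
      ((B.meas j).aestronglyMeasurable (μ := γ.map Prod.snd))
    rw [← e, hγ.2, B.integral_eq, mul_inv_cancel₀ hm]

/-- By Birkhoff's theorem, the average of a cost along two transports is a convex combination of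
its averages along the matchings of the points. -/
lemma exists_perm_weights [NeZero m] (A : Alloc μ m) (B : Alloc ν m) (hγ : γ ∈ couplings μ ν) :
    ∃ c : Equiv.Perm (Fin m) → ℝ, (∀ σ, 0 ≤ c σ) ∧ ∑ σ, c σ = 1 ∧
      ∀ h : Fin m → Fin m → ℝ,
        ∫ p, A.mix B h p ∂γ = ∑ σ, c σ * ((m : ℝ)⁻¹ * ∑ i, h i (σ i)) := by
  have hm : (m : ℝ) ≠ 0 := by exact_mod_cast NeZero.ne m
  obtain ⟨c, h0, h1, hc⟩ := exists_eq_sum_perm_of_mem_doublyStochastic (A.mem_doublyStochastic B hγ)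
  refine ⟨c, h0, h1, fun h => ?_⟩
  have hc' : ∀ i j, ∫ p, A.w i p.1 * B.w j p.2 ∂γ =
      (m : ℝ)⁻¹ * ∑ σ, c σ * if σ i = j then 1 else 0 := fun i j => by
    have := congrFun (congrFun hc i) j
    simp only [Matrix.of_apply, Matrix.sum_apply, Matrix.smul_apply, smul_eq_mul,
      Equiv.Perm.permMatrix, PEquiv.toMatrix_toPEquiv_apply, Pi.single_apply] at this
    rw [eq_inv_mul_iff_mul_eq₀ hm, ← this]
    simp [eq_comm]
  rw [A.integral_mix B hγ]
  simp_rw [hc', Finset.mul_sum, Finset.sum_mul]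
  have : ∀ i, ∑ j, ∑ σ, (m : ℝ)⁻¹ * (c σ * if σ i = j then 1 else 0) * h i j =
      ∑ σ, c σ * ((m : ℝ)⁻¹ * h i (σ i)) := fun i => by
    rw [Finset.sum_comm]
    refine Finset.sum_congr rfl fun σ _ => ?_
    rw [Finset.sum_eq_single (σ i)]
    · simp; ring
    · intro j _ hj; simp [Ne.symm hj]
    · simp
  simp_rw [this]
  rw [Finset.sum_comm]

/-- Average the bound over the permutations with the Birkhoff weights. Since `c` does not depend on
`σ`, this is where invariance under relabelling pays off; the plan is arbitrary. -/
lemma abs_sub_integral_mix_le [NeZero m] (A : Alloc μ m) (B : Alloc ν m)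
    (hγ : γ ∈ couplings μ ν) (h k : Fin m → Fin m → ℝ) (c c₀ : ℝ)
    (H : ∀ σ : Equiv.Perm (Fin m),
      |c - (m : ℝ)⁻¹ * ∑ i, h i (σ i)| ≤ c₀ + (m : ℝ)⁻¹ * ∑ i, k i (σ i)) :
    |c - ∫ p, A.mix B h p ∂γ| ≤ c₀ + ∫ p, A.mix B k p ∂γ := by
  obtain ⟨w, h0, h1, hw⟩ := A.exists_perm_weights B hγ
  rw [hw, hw]
  have e : ∀ t : ℝ, t = ∑ σ, w σ * t := fun t => by rw [← Finset.sum_mul, h1, one_mul]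
  rw [e c, e c₀, ← Finset.sum_sub_distrib, ← Finset.sum_add_distrib]
  refine (Finset.abs_sum_le_sum_abs _ _).trans (Finset.sum_le_sum fun σ _ => ?_)
  rw [← mul_sub, ← mul_add, abs_mul, abs_of_nonneg (h0 σ)]
  exact mul_le_mul_of_nonneg_left (H σ) (h0 σ)

end Alloc
end Allocations

/-! ### Transports to `m` points with cost tending to zero -/

section Existence
variable {d : ℕ}

lemma exists_simpleFunc_near (μ : P2 d) {ε : ℝ} (hε : 0 < ε) :
    ∃ s : SimpleFunc (M d) (M d), Integrable (fun a => ‖a - s a‖ ^ 2) μ.meas ∧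
      ∫ a, ‖a - s a‖ ^ 2 ∂μ.meas < ε := by
  obtain ⟨s, hs, hm⟩ := μ.memLp_id.exists_simpleFunc_eLpNorm_sub_lt (by norm_num)
    (ε := ENNReal.ofReal (Real.sqrt ε)) (by simp [hε])
  have hsub : MemLp (fun a : M d => a - s a) 2 μ.meas := μ.memLp_id.sub hm
  have hi := (memLp_two_iff_integrable_sq_norm hsub.1).1 hsub
  refine ⟨s, hi, ?_⟩
  have h1 : eLpNorm (fun a : M d => a - s a) 2 μ.meas < ENNReal.ofReal (Real.sqrt ε) := hs
  rw [hsub.eLpNorm_eq_integral_rpow_norm (by norm_num) (by norm_num),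
    ENNReal.ofReal_lt_ofReal_iff (by positivity)] at h1
  simp only [ENNReal.toReal_ofNat, Real.rpow_ofNat] at h1
  rw [← one_div, ← Real.sqrt_eq_rpow] at h1
  exact lt_of_not_ge fun h => not_lt.2 (Real.sqrt_le_sqrt h) h1

/-- Rounding of probability weights to multiples of `1 / m`, with a positive remainder. -/
lemma exists_rounding {L : Type*} [Fintype L] (p : L → ℝ) (hp : ∀ l, 0 ≤ p l) (hsum : ∑ l, p l = 1)
    {m : ℕ} (hm : m ≠ 0) : ∃ n : L → ℕ, ∑ l, n l < m ∧ (∀ l, p l = 0 → n l = 0) ∧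
      (∀ l, (n l : ℝ) ≤ m * p l) ∧ ∀ l, m * p l - n l ≤ 1 := by
  have hm0 : (0 : ℝ) < m := by exact_mod_cast Nat.pos_of_ne_zero hm
  have key : ∀ l, ∃ n : ℕ, (p l = 0 → n = 0) ∧ (n : ℝ) ≤ m * p l ∧ (0 < p l → (n : ℝ) < m * p l) ∧
      m * p l - n ≤ 1 := fun l => by
    rcases (hp l).eq_or_lt with h | h
    · exact ⟨0, by simp [← h]⟩
    · have ht : 0 < m * p l := by positivity
      have h1 : 0 < ⌈(m : ℝ) * p l⌉₊ := Nat.ceil_pos.2 ht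
      have h2 := Nat.ceil_lt_add_one ht.le
      have h3 := Nat.le_ceil ((m : ℝ) * p l)
      have h4 : ((⌈(m : ℝ) * p l⌉₊ - 1 : ℕ) : ℝ) = ⌈(m : ℝ) * p l⌉₊ - 1 := by
        rw [Nat.cast_sub h1]; simp
      -- Ceiling minus one rather than the floor: it is strictly below `m * p l` even when this is
      -- an integer, so at least one point is always left over to receive the remainders.
      refine ⟨⌈(m : ℝ) * p l⌉₊ - 1, fun h' => absurd h' h.ne', ?_, fun _ => ?_, ?_⟩ <;>
        rw [h4] <;> linarith
  choose n h1 h2 h3 h4 using key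
  refine ⟨n, ?_, h1, h2, h4⟩
  have hlt : ∃ l, 0 < p l := by
    by_contra! h
    have : ∑ l, p l ≤ 0 := Finset.sum_nonpos fun l _ => h l
    linarith
  obtain ⟨l, hl⟩ := hlt
  have : ∑ l, (n l : ℝ) < ∑ l, m * p l :=
    Finset.sum_lt_sum (fun l _ => h2 l) ⟨l, Finset.mem_univ l, h3 l hl⟩
  rw [← Finset.mul_sum, hsum, mul_one] at this
  exact_mod_cast this

lemma integral_comp_simpleFunc (μ : P2 d) (s : SimpleFunc (M d) (M d)) (g : M d → ℝ) :
    ∫ a, g (s a) ∂μ.meas = ∑ l : s.range, μ.meas.real (s ⁻¹' {(l : M d)}) * g l := by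
  have e : ∀ a, g (s a) = ∑ l : s.range, indicator (s ⁻¹' {(l : M d)}) (fun _ => g l) a := fun a => by
    rw [Finset.sum_eq_single ⟨s a, s.mem_range_self a⟩]
    · simp
    · rintro ⟨l, hl⟩ - hne
      apply indicator_of_notMem
      intro h
      exact hne (Subtype.ext (by simpa using h.symm))
    · simp
  simp_rw [e]
  rw [integral_finsetSum _ fun l _ => (integrable_const _).indicator (s.measurableSet_fiber _)]
  refine Finset.sum_congr rfl fun l _ => ?_
  rw [integral_indicator (s.measurableSet_fiber _)]
  simp

/-- For each value `l` of `s`, whose fibre has mass `p l`, about `m * p l` points are placed at `l`,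
and each receives the fraction `1 / (m * p l)` of that fibre. The leftover points sit at the origin
and share the remainders equally. The remainder of a fibre is a fraction at most `1 / (m * p l)` of
it, and moving it to the origin costs `‖a‖ ^ 2`; hence the error term, with `ρ` the inverse mass of
the fibre. -/
lemma exists_alloc_of_simpleFunc (μ : P2 d) (s : SimpleFunc (M d) (M d)) :
    ∃ ρ : M d → ℝ, ∀ m : ℕ, m ≠ 0 → ∃ A : Alloc μ m, ∀ᵐ a ∂μ.meas,
      A.dev a ≤ ‖a - s a‖ ^ 2 + (m : ℝ)⁻¹ * (ρ (s a) * ‖a‖ ^ 2) := by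
  classical
  set p : s.range → ℝ := fun l => μ.meas.real (s ⁻¹' {(l : M d)}) with hp
  have hp0 : ∀ l, 0 ≤ p l := fun l => measureReal_nonneg
  have hp1 : ∑ l, p l = 1 := by
    have := integral_comp_simpleFunc μ s (fun _ => 1)
    simpa using this.symm
  let cls : M d → s.range := fun a => ⟨s a, s.mem_range_self a⟩
  refine ⟨fun y => (μ.meas.real (s ⁻¹' {y}))⁻¹, fun m hm => ?_⟩
  have hm0 : (0 : ℝ) < m := by exact_mod_cast Nat.pos_of_ne_zero hm
  obtain ⟨n, hn, hn0, hnle, hn1⟩ := exists_rounding p hp0 hp1 hm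
  set R := m - ∑ l, n l with hR
  have hRpos : 0 < R := Nat.sub_pos_of_lt hn
  have hR0 : (0 : ℝ) < R := by exact_mod_cast hRpos
  have hRm : (R : ℝ) = m - ∑ l, (n l : ℝ) := by
    rw [hR, Nat.cast_sub hn.le]; simp
  have hcard : Fintype.card (Fin m) = Fintype.card ((Σ l, Fin (n l)) ⊕ Fin R) := by
    simp only [Fintype.card_fin, Fintype.card_sum, Fintype.card_sigma]; omega
  let e : Fin m ≃ (Σ l, Fin (n l)) ⊕ Fin R := Fintype.equivOfCardEq hcard
  -- On a fibre of mass zero the division gives `0`, so `rem l = 1` and the whole fibre goes to the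
  -- origin. The fractions thus sum to one everywhere, while the cost bound is claimed only almost
  -- everywhere.
  set rem : s.range → ℝ := fun l => 1 - n l / (m * p l) with hrem
  have hrem0 : ∀ l, 0 ≤ rem l := fun l => by
    have : (n l : ℝ) / (m * p l) ≤ 1 := div_le_one_of_le₀ (hnle l) (by have := hp0 l; positivity)
    simp only [hrem]; linarith
  let w : (Σ l, Fin (n l)) ⊕ Fin R → M d → ℝ := fun k a =>
    Sum.elim (fun c => if cls a = c.1 then (m * p c.1)⁻¹ else 0) (fun _ => rem (cls a) / R) k
  let y : (Σ l, Fin (n l)) ⊕ Fin R → M d := Sum.elim (fun c => (c.1 : M d)) (fun _ => 0)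
  have hsumw : ∀ (g : (Σ l, Fin (n l)) ⊕ Fin R → ℝ) (a : M d),
      ∑ i, w (e i) a * g (e i) = ∑ k, w k a * g k := fun g a =>
    Equiv.sum_comp e (fun k => w k a * g k)
  have hsum2 : ∀ (g : M d → ℝ) (a : M d), ∑ k, w k a * g (y k) =
      n (cls a) / (m * p (cls a)) * g (s a) + rem (cls a) * g 0 := fun g a => by
    rw [Fintype.sum_sum_type, Fintype.sum_sigma]
    simp only [w, y, Sum.elim_inl, Sum.elim_inr, Finset.sum_const, Finset.card_univ,
      Fintype.card_fin, nsmul_eq_mul]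
    congr 1
    · rw [Finset.sum_eq_single (cls a)]
      · rw [if_pos rfl]; simp only [cls]; ring
      · intro l _ hl; rw [if_neg (Ne.symm hl)]; simp
      · simp
    · field_simp
  have hmeas_cls : ∀ g : s.range → ℝ, Measurable (fun a => g (cls a)) := fun g => by
    have : (fun a => g (cls a)) = fun a => s.map (fun y => if h : y ∈ s.range then g ⟨y, h⟩ else 0) a := by
      ext a; simp [cls]
    rw [this]; exact SimpleFunc.measurable _
  have hint : ∀ g : s.range → ℝ, ∫ a, g (cls a) ∂μ.meas = ∑ l, p l * g l := fun g => by
    have := integral_comp_simpleFunc μ s (fun y => if h : y ∈ s.range then g ⟨y, h⟩ else 0)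
    simpa [cls] using this
  refine ⟨⟨fun i => y (e i), fun i => w (e i), fun i => ?_, fun i a => ?_, fun a => ?_,
    fun i => ?_⟩, ?_⟩
  · rcases e i with c | c
    · exact hmeas_cls (fun l => if l = c.1 then (m * p c.1)⁻¹ else 0)
    · exact hmeas_cls (fun l => rem l / R)
  · rcases e i with c | c
    · change 0 ≤ if cls a = c.1 then (m * p c.1)⁻¹ else 0
      have := hp0 c.1
      split_ifs <;> positivity
    · exact div_nonneg (hrem0 _) hR0.le
  · have h1 := hsumw (fun _ => 1) a
    have h2 := hsum2 (fun _ => 1) a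
    simp only [mul_one] at h1 h2
    rw [h1, h2]; simp only [hrem]; ring
  · rcases e i with c | c
    · have := hint (fun l => if l = c.1 then (m * p c.1)⁻¹ else 0)
      have hc : p c.1 ≠ 0 := fun h => by
        have h0 := hn0 _ h
        exact (Fin.cast h0 c.2).elim0
      change ∫ a, (if cls a = c.1 then (m * p c.1)⁻¹ else 0) ∂μ.meas = _
      rw [this]
      simp only [mul_ite, mul_zero, Finset.sum_ite_eq', Finset.mem_univ, if_true]
      field_simp
    · have := hint (fun l => rem l / R)
      change ∫ a, rem (cls a) / R ∂μ.meas = _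
      rw [this]
      have h1 : ∀ l, p l * (rem l / R) = (R : ℝ)⁻¹ * (p l - n l / m) := fun l => by
        by_cases h : p l = 0
        · rw [h, hn0 l h]; simp
        · simp only [hrem]; field_simp
      simp_rw [h1]
      rw [← Finset.mul_sum, Finset.sum_sub_distrib, hp1, ← Finset.sum_div]
      have : (∑ l, (n l : ℝ)) = m - R := by rw [hRm]; ring
      rw [this]; field_simp; ring
  · have hae : ∀ᵐ a ∂μ.meas, 0 < p (cls a) := by
      have h0 : μ.meas (⋃ l : {l : s.range // p l = 0}, s ⁻¹' {(l.1 : M d)}) = 0 := by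
        rw [measure_iUnion_null_iff]
        rintro ⟨l, hl⟩
        simpa [hp, Measure.real, ENNReal.toReal_eq_zero_iff] using hl
      have h1 := measure_eq_zero_iff_ae_notMem.1 h0
      filter_upwards [h1] with a ha
      refine lt_of_le_of_ne (hp0 _) fun h => ha ?_
      rw [mem_iUnion]
      exact ⟨⟨cls a, h.symm⟩, rfl⟩
    filter_upwards [hae] with a ha
    have h1 : ∑ i, w (e i) a * ‖a - y (e i)‖ ^ 2 = _ :=
      (hsumw (fun k => ‖a - y k‖ ^ 2) a).trans (hsum2 (fun z => ‖a - z‖ ^ 2) a)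
    change ∑ i, w (e i) a * ‖a - y (e i)‖ ^ 2 ≤ _
    rw [h1, sub_zero]
    gcongr ?_ + ?_
    · refine mul_le_of_le_one_left (by positivity) ?_
      have := hrem0 (cls a)
      simp only [hrem] at this; linarith
    · rw [← mul_assoc]
      gcongr
      change rem (cls a) ≤ (m : ℝ)⁻¹ * (p (cls a))⁻¹
      have := hn1 (cls a)
      simp only [hrem]
      rw [← mul_inv, ← one_div, le_div_iff₀ (by positivity), sub_mul, one_mul,
        div_mul_cancel₀ _ (by positivity)]
      exact this

lemma exists_alloc_tcost_lt (μ : P2 d) {ε : ℝ} (hε : 0 < ε) :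
    ∀ᶠ m in Filter.atTop, ∃ A : Alloc μ m, A.tcost < ε := by
  obtain ⟨s, hsi, hs⟩ := exists_simpleFunc_near μ (half_pos hε)
  obtain ⟨ρ, hρ⟩ := exists_alloc_of_simpleFunc μ s
  set T := ∫ a, ρ (s a) * ‖a‖ ^ 2 ∂μ.meas with hT
  have hTi : Integrable (fun a => ρ (s a) * ‖a‖ ^ 2) μ.meas := by
    obtain ⟨c, hc⟩ := (s.map ρ).exists_forall_norm_le
    exact μ.integrable_sq.bdd_mul (s.map ρ).aestronglyMeasurable (ae_of_all _ hc)
  have hlim : Filter.Tendsto (fun m : ℕ => (m : ℝ)⁻¹ * T) Filter.atTop (nhds 0) := by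
    simpa using tendsto_inv_atTop_nhds_zero_nat (𝕜 := ℝ).mul_const T
  filter_upwards [hlim.eventually (gt_mem_nhds (half_pos hε)), Filter.eventually_ne_atTop 0]
    with m hm hm0
  obtain ⟨A, hA⟩ := hρ m hm0
  refine ⟨A, ?_⟩
  have h1 : A.tcost ≤ ∫ a, (‖a - s a‖ ^ 2 + (m : ℝ)⁻¹ * (ρ (s a) * ‖a‖ ^ 2)) ∂μ.meas :=
    integral_mono_ae A.integrable_dev (hsi.add (hTi.const_mul _)) hA
  rw [integral_add hsi (hTi.const_mul _), integral_const_mul] at h1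
  linarith

/-- Taking for each `m` a transport optimal up to `1 / (m + 1)` makes one sequence work for all `ε`
at once. -/
lemma exists_alloc_seq (μ : P2 d) : ∃ A : ∀ m, Alloc μ (m + 1),
    Filter.Tendsto (fun m => (A m).tcost) Filter.atTop (nhds 0) := by
  have hne : ∀ m, Nonempty (Alloc μ (m + 1)) := fun m => by
    obtain ⟨ρ, hρ⟩ := exists_alloc_of_simpleFunc μ (SimpleFunc.const _ 0)
    exact ⟨(hρ (m + 1) (by omega)).choose⟩
  have hch : ∀ m, ∃ A : Alloc μ (m + 1), ∀ B : Alloc μ (m + 1),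
      A.tcost ≤ B.tcost + ((m : ℝ) + 1)⁻¹ := fun m => by
    have hbdd : BddBelow (range fun B : Alloc μ (m + 1) => B.tcost) :=
      ⟨0, by rintro _ ⟨B, rfl⟩; exact B.tcost_nonneg⟩
    have hlt : (⨅ B : Alloc μ (m + 1), B.tcost) <
        (⨅ B : Alloc μ (m + 1), B.tcost) + ((m : ℝ) + 1)⁻¹ := by
      have : 0 < ((m : ℝ) + 1)⁻¹ := by positivity
      linarith
    obtain ⟨A, hA⟩ := exists_lt_of_ciInf_lt hlt
    exact ⟨A, fun B => hA.le.trans (by gcongr; exact ciInf_le hbdd B)⟩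
  choose A hA using hch
  refine ⟨A, ?_⟩
  rw [Metric.tendsto_atTop]
  intro ε hε
  have h1 := (Filter.tendsto_add_atTop_nat 1).eventually (exists_alloc_tcost_lt μ (half_pos hε))
  have h2 := (tendsto_one_div_add_atTop_nhds_zero_nat (𝕜 := ℝ)).eventually
    (gt_mem_nhds (half_pos hε))
  obtain ⟨N, hN⟩ := Filter.eventually_atTop.1 (h1.and h2)
  refine ⟨N, fun m hm => ?_⟩
  obtain ⟨⟨B, hB⟩, h3⟩ := hN m hm
  rw [one_div] at h3
  rw [Real.dist_eq, sub_zero, abs_of_nonneg (A m).tcost_nonneg]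
  linarith [hA m B]

end Existence

/-! ### Configurations with two marked points and passage to the limit along plans -/

section Limits
open Filter Topology
variable {d n : ℕ}

/-- Two marked points followed by the points of `x`. -/
def cfg (q p : M d) (x : Fin n → M d) : Fin (n + 2) → M d := Fin.cons q (Fin.cons p x)

@[simp] lemma cfg_zero (q p : M d) (x : Fin n → M d) : cfg q p x 0 = q := rfl
@[simp] lemma cfg_one (q p : M d) (x : Fin n → M d) : cfg q p x 1 = p := rfl
@[simp] lemma cfg_succ_succ (q p : M d) (x : Fin n → M d) (i : Fin n) :
    cfg q p x i.succ.succ = x i := rfl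

lemma sum_cfg {E : Type*} [AddCommMonoid E] (g : Fin (n + 2) → E) :
    ∑ k, g k = g 0 + (g 1 + ∑ i : Fin n, g i.succ.succ) := by
  rw [Fin.sum_univ_succ, Fin.sum_univ_succ]; rfl

/-- A permutation that fixes the two marked points. -/
def extPerm (σ : Equiv.Perm (Fin n)) : Equiv.Perm (Fin (n + 2)) :=
  Equiv.Perm.decomposeFin.symm (0, Equiv.Perm.decomposeFin.symm (0, σ))

lemma extPerm_zero (σ : Equiv.Perm (Fin n)) : extPerm σ 0 = 0 := by
  simp [extPerm]

lemma extPerm_one (σ : Equiv.Perm (Fin n)) : extPerm σ 1 = 1 := by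
  rw [extPerm, ← Fin.succ_zero_eq_one, Equiv.Perm.decomposeFin_symm_apply_succ]
  simp

lemma extPerm_succ_succ (σ : Equiv.Perm (Fin n)) (i : Fin n) :
    extPerm σ i.succ.succ = (σ i).succ.succ := by
  rw [extPerm, Equiv.Perm.decomposeFin_symm_apply_succ, Equiv.Perm.decomposeFin_symm_apply_succ]
  simp

lemma cfg_comp_perm (q p : M d) (x : Fin n → M d) (σ : Equiv.Perm (Fin n)) :
    cfg q p (x ∘ σ) = cfg q p x ∘ extPerm σ := by
  funext k
  refine Fin.cases ?_ (fun k => Fin.cases ?_ (fun k => ?_) k) k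
  · simp [extPerm_zero]
  · simp [extPerm_one]
  · simp [extPerm_succ_succ]

section Apx
variable (U : P2 d → ℝ)

/-- The approximation of the gradient by the first derivative at the marked point. -/
def gradApx (q : M d) (x : Fin n → M d) (α : Fin d) : ℝ :=
  ((n + 2 : ℕ) : ℝ) * D1 (restr U (n + 2)) (cfg q 0 x) 0 α

/-- The approximation of `Λ₀`. -/
def lamZero (q : M d) (x : Fin n → M d) (α β : Fin d) : ℝ :=
  ((n + 2 : ℕ) : ℝ) * D2 (restr U (n + 2)) (cfg q 0 x) 0 0 β α

/-- The approximation of `Λ₁`. -/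
def lamOne (q p : M d) (x : Fin n → M d) (α β : Fin d) : ℝ :=
  ((n : ℝ) * ((n + 2 : ℕ) : ℝ)) * D2 (restr U (n + 2)) (cfg q p x) 1 0 β α

variable {U}

/-- `restr U` sees only the empirical measure, and `extPerm σ` fixes the marked points at which the
derivatives are taken. The same reason serves the two lemmas after this one. -/
lemma gradApx_perm (hU : ContDiff ℝ 3 (restr U (n + 2))) (q : M d) (x : Fin n → M d)
    (σ : Equiv.Perm (Fin n)) (α : Fin d) : gradApx U q (x ∘ σ) α = gradApx U q x α := by
  rw [gradApx, cfg_comp_perm, D1_perm (hU.differentiable (by norm_num)) _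
    (fun z => restr_comp_perm U z _), extPerm_zero, gradApx]

lemma lamZero_perm (hU : ContDiff ℝ 3 (restr U (n + 2))) (q : M d) (x : Fin n → M d)
    (σ : Equiv.Perm (Fin n)) (α β : Fin d) : lamZero U q (x ∘ σ) α β = lamZero U q x α β := by
  rw [lamZero, cfg_comp_perm, D2_perm (hU.of_le (by norm_num)) _
    (fun z => restr_comp_perm U z _), extPerm_zero, lamZero]

lemma lamOne_perm (hU : ContDiff ℝ 3 (restr U (n + 2))) (q p : M d) (x : Fin n → M d)
    (σ : Equiv.Perm (Fin n)) (α β : Fin d) : lamOne U q p (x ∘ σ) α β = lamOne U q p x α β := by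
  rw [lamOne, cfg_comp_perm, D2_perm (hU.of_le (by norm_num)) _
    (fun z => restr_comp_perm U z _), extPerm_zero, extPerm_one, lamOne]

/-- The normalization `n * (n + 2)` of mixed derivatives turns the Taylor sum over the `n` unmarked
points into an exact mean; the scaling bounds only require that it not exceed `(n + 2) ^ 2`. -/
lemma mul_succ_succ_le_sq : (n : ℝ) * ((n + 2 : ℕ) : ℝ) ≤ ((n + 2 : ℕ) : ℝ) ^ 2 := by
  push_cast; nlinarith [(Nat.cast_nonneg n : (0 : ℝ) ≤ n)]

lemma inv_mul_sum_cfg_le [NeZero n] (q q' p p' : M d) (x x' : Fin n → M d) :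
    ((n + 2 : ℕ) : ℝ)⁻¹ * ∑ k, ‖cfg q p x k - cfg q' p' x' k‖ ≤
      ‖q - q'‖ + ‖p - p'‖ + (n : ℝ)⁻¹ * ∑ i, ‖x i - x' i‖ := by
  have hn : (1 : ℝ) ≤ n := one_le_natCast
  rw [sum_cfg]
  simp only [cfg_zero, cfg_one, cfg_succ_succ]
  have h0 : 0 ≤ ∑ i, ‖x i - x' i‖ := Finset.sum_nonneg fun _ _ => norm_nonneg _
  have h1 : ((n + 2 : ℕ) : ℝ)⁻¹ ≤ 1 := inv_le_one_of_one_le₀ (by push_cast; linarith)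
  have h2 : ((n + 2 : ℕ) : ℝ)⁻¹ ≤ (n : ℝ)⁻¹ := inv_anti₀ (by linarith) (by push_cast; linarith)
  have h3 := mul_le_mul_of_nonneg_right h2 h0
  have h4 := mul_le_mul_of_nonneg_right h1 (norm_nonneg (q - q'))
  have h5 := mul_le_mul_of_nonneg_right h1 (norm_nonneg (p - p'))
  linarith

variable {R C : ℝ}

lemma gradApx_lip [NeZero n] (hS : ScaledOn (restr U (n + 2)) R C) {q q' : M d}
    {x x' : Fin n → M d} (hx : cfg q 0 x ∈ ballM d (n + 2) R)
    (hx' : cfg q' 0 x' ∈ ballM d (n + 2) R) (α : Fin d) :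
    |gradApx U q x α - gradApx U q' x' α| ≤
      d * C * (2 * ‖q - q'‖ + (n : ℝ)⁻¹ * ∑ i, ‖x i - x' i‖) := by
  refine (hS.lip_grad hx' hx 0 α).trans ?_
  have h := inv_mul_sum_cfg_le q q' 0 0 x x'
  have hC := hS.nonneg
  rw [mul_assoc]
  refine mul_le_mul_of_nonneg_left (mul_le_mul_of_nonneg_left ?_ hC) (Nat.cast_nonneg d)
  simp only [cfg_zero, sub_self, norm_zero] at h ⊢
  linarith

lemma lamZero_lip [NeZero n] (hS : ScaledOn (restr U (n + 2)) R C) {q q' : M d}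
    {x x' : Fin n → M d} (hx : cfg q 0 x ∈ ballM d (n + 2) R)
    (hx' : cfg q' 0 x' ∈ ballM d (n + 2) R) (α β : Fin d) :
    |lamZero U q x α β - lamZero U q' x' α β| ≤
      d * C * (2 * ‖q - q'‖ + (n : ℝ)⁻¹ * ∑ i, ‖x i - x' i‖) := by
  refine (hS.lip_diag hx' hx 0 β α).trans ?_
  have h := inv_mul_sum_cfg_le q q' 0 0 x x'
  have hC := hS.nonneg
  rw [mul_assoc]
  refine mul_le_mul_of_nonneg_left (mul_le_mul_of_nonneg_left ?_ hC) (Nat.cast_nonneg d)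
  simp only [cfg_zero, sub_self, norm_zero] at h ⊢
  linarith

lemma lamOne_lip [NeZero n] (hS : ScaledOn (restr U (n + 2)) R C) {q q' p p' : M d}
    {x x' : Fin n → M d} (hx : cfg q p x ∈ ballM d (n + 2) R)
    (hx' : cfg q' p' x' ∈ ballM d (n + 2) R) (α β : Fin d) :
    |lamOne U q p x α β - lamOne U q' p' x' α β| ≤
      d * C * (2 * (‖q - q'‖ + ‖p - p'‖) + (n : ℝ)⁻¹ * ∑ i, ‖x i - x' i‖) := by
  refine (hS.lip_off hx' hx (by positivity) mul_succ_succ_le_sq (by simp) β α).trans ?_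
  have h := inv_mul_sum_cfg_le q q' p p' x x'
  have hC := hS.nonneg
  rw [mul_assoc]
  refine mul_le_mul_of_nonneg_left (mul_le_mul_of_nonneg_left ?_ hC) (Nat.cast_nonneg d)
  simp only [cfg_zero, cfg_one] at h ⊢
  linarith

lemma lamZero_bound (hS : ScaledOn (restr U (n + 2)) R C) {q : M d}
    {x : Fin n → M d} (hx : cfg q 0 x ∈ ballM d (n + 2) R) (α β : Fin d) :
    |lamZero U q x α β| ≤ C := hS.abs_diag_le hx 0 β α

lemma lamOne_bound (hS : ScaledOn (restr U (n + 2)) R C) {q p : M d}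
    {x : Fin n → M d} (hx : cfg q p x ∈ ballM d (n + 2) R) (α β : Fin d) :
    |lamOne U q p x α β| ≤ C :=
  hS.abs_off_le hx (by positivity) mul_succ_succ_le_sq (by simp) β α

end Apx

section AllocSeq

/-- Transports of `μ` to `m + 1` points with cost tending to zero. -/
def allocSeq (μ : P2 d) (m : ℕ) : Alloc μ (m + 1) := (exists_alloc_seq μ).choose m

lemma tendsto_tcost (μ : P2 d) : Tendsto (fun m => (allocSeq μ m).tcost) atTop (𝓝 0) :=
  (exists_alloc_seq μ).choose_spec

/-- Each point has mass `n⁻¹`, so the left side is the integral of the averaged `‖A.x i‖ ^ 2`, to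
which `‖x‖ ^ 2 ≤ 2 * ‖a‖ ^ 2 + 2 * ‖a - x‖ ^ 2` applies. -/
lemma Alloc.inv_mul_sum_sq_le {μ : P2 d} (A : Alloc μ n) :
    (n : ℝ)⁻¹ * ∑ i, ‖A.x i‖ ^ 2 ≤ 2 * ∫ a, ‖a‖ ^ 2 ∂μ.meas + 2 * A.tcost := by
  have h1 : (n : ℝ)⁻¹ * ∑ i, ‖A.x i‖ ^ 2 = ∫ a, ∑ i, A.w i a * ‖A.x i‖ ^ 2 ∂μ.meas := by
    rw [integral_finsetSum _ fun i _ => (A.integrable_w i).mul_const _, Finset.mul_sum]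
    refine Finset.sum_congr rfl fun i _ => ?_
    rw [integral_mul_const, A.integral_eq]
  rw [h1, Alloc.tcost, ← integral_const_mul, ← integral_const_mul, ← integral_add
    (μ.integrable_sq.const_mul _) (A.integrable_dev.const_mul _)]
  refine integral_mono (integrable_finsetSum _ fun i _ => (A.integrable_w i).mul_const _)
    ((μ.integrable_sq.const_mul _).add (A.integrable_dev.const_mul _)) fun a => ?_
  change ∑ i, A.w i a * ‖A.x i‖ ^ 2 ≤ 2 * ‖a‖ ^ 2 + 2 * ∑ i, A.w i a * ‖a - A.x i‖ ^ 2
  have e : 2 * ‖a‖ ^ 2 = ∑ i, A.w i a * (2 * ‖a‖ ^ 2) := by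
    rw [← Finset.sum_mul, A.sum_eq, one_mul]
  rw [e, Finset.mul_sum, ← Finset.sum_add_distrib]
  refine Finset.sum_le_sum fun i _ => ?_
  have h : ‖A.x i‖ ≤ ‖a‖ + ‖a - A.x i‖ := by
    have := norm_sub_le a (a - A.x i); rwa [sub_sub_cancel] at this
  have h2 : ‖A.x i‖ ^ 2 ≤ 2 * ‖a‖ ^ 2 + 2 * ‖a - A.x i‖ ^ 2 := by
    nlinarith [norm_nonneg (A.x i), sq_nonneg (‖a‖ - ‖a - A.x i‖)]
  nlinarith [mul_le_mul_of_nonneg_left h2 (A.nonneg i a)]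

variable {μ : P2 d} {r : ℝ}

lemma eventually_sum_sq_le (hr : 0 < r) (hμ : μ ∈ ballP2 d r) {ε : ℝ} (hε : 0 < ε) :
    ∀ᶠ m in atTop, ∑ i, ‖(allocSeq μ m).x i‖ ^ 2 ≤ ((m + 1 : ℕ) : ℝ) * (2 * r ^ 2 + ε) := by
  filter_upwards [(tendsto_tcost μ).eventually (gt_mem_nhds (half_pos hε))] with m hm
  have h1 := (allocSeq μ m).inv_mul_sum_sq_le
  have h2 := (mem_ballP2_iff hr.le).1 hμ
  have hm0 : (0 : ℝ) < ((m + 1 : ℕ) : ℝ) := by positivity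
  rw [inv_mul_le_iff₀ hm0] at h1
  refine h1.trans ?_
  gcongr
  linarith

/-- The condition on `q` and `p` lets them be fixed points or any of the points of the transport,
with one threshold for all of them. In the worst case the sum of squares is counted three times,
giving roughly `7.5 * r ^ 2` per point; hence the radius `3 * r`. -/
lemma eventually_cfg_mem (hr : 0 < r) (hμ : μ ∈ ballP2 d r) (ρ : ℝ) :
    ∀ᶠ m in atTop, ∀ q p : M d, ‖q‖ ^ 2 ≤ ρ + ∑ i, ‖(allocSeq μ m).x i‖ ^ 2 →
      ‖p‖ ^ 2 ≤ ρ + ∑ i, ‖(allocSeq μ m).x i‖ ^ 2 →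
      cfg q p (allocSeq μ m).x ∈ ballM d (m + 1 + 2) (3 * r) := by
  have hr2 : 0 < r ^ 2 := by positivity
  have hlim : ∀ᶠ m : ℕ in atTop, 2 * ρ / r ^ 2 ≤ m :=
    tendsto_natCast_atTop_atTop.eventually (eventually_ge_atTop _)
  filter_upwards [eventually_sum_sq_le hr hμ (half_pos hr2), hlim] with m h1 h2 q p hq hp
  change ((m + 1 + 2 : ℕ) : ℝ)⁻¹ * ∑ k, ‖cfg q p (allocSeq μ m).x k‖ ^ 2 ≤ (3 * r) ^ 2
  rw [inv_mul_le_iff₀ (by positivity), sum_cfg]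
  simp only [cfg_zero, cfg_one, cfg_succ_succ]
  rw [div_le_iff₀ hr2] at h2
  push_cast at h1 ⊢
  nlinarith

/-- A bounded mean of squares forces each point to have norm of order `√m`. Hence moving a single
marked point from the origin to some `x i` changes the mean displacement negligibly. -/
lemma eventually_norm_x_le (hr : 0 < r) (hμ : μ ∈ ballP2 d r) {η : ℝ} (hη : 0 < η) :
    ∀ᶠ m in atTop, ∀ i, ‖(allocSeq μ m).x i‖ ≤ η * ((m + 1 + 2 : ℕ) : ℝ) := by
  have hr2 : 0 < r ^ 2 := by positivity
  have hlim : ∀ᶠ m : ℕ in atTop, 3 * r ^ 2 / η ^ 2 ≤ m :=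
    tendsto_natCast_atTop_atTop.eventually (eventually_ge_atTop _)
  filter_upwards [eventually_sum_sq_le hr hμ hr2, hlim] with m h1 h2 i
  rw [div_le_iff₀ (by positivity)] at h2
  have h3 : ‖(allocSeq μ m).x i‖ ^ 2 ≤ ∑ i, ‖(allocSeq μ m).x i‖ ^ 2 :=
    Finset.single_le_sum (f := fun i => ‖(allocSeq μ m).x i‖ ^ 2) (fun _ _ => sq_nonneg _)
      (Finset.mem_univ i)
  refine le_of_sq_le_sq ?_ (by positivity)
  push_cast at h1 ⊢
  have hm : (0 : ℝ) ≤ m := Nat.cast_nonneg m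
  have : ((m : ℝ) + 1) * (2 * r ^ 2 + r ^ 2) ≤ (m + 1) * (m * η ^ 2) := by
    gcongr; linarith
  nlinarith [mul_nonneg hm (sq_nonneg η), sq_nonneg η]

/-- A linearized form of `dev1 ≤ √dev`: after integration only the transport cost is needed. -/
lemma Alloc.dev1_le (A : Alloc μ n) {η : ℝ} (hη : 0 < η) (a : M d) :
    A.dev1 a ≤ η + η⁻¹ * A.dev a := by
  have h := A.dev1_sq_le a
  have : η⁻¹ * A.dev1 a ^ 2 ≤ η⁻¹ * A.dev a := by gcongr
  have h2 : A.dev1 a ≤ η + η⁻¹ * A.dev1 a ^ 2 := by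
    have : η + η⁻¹ * A.dev1 a ^ 2 - A.dev1 a =
        η⁻¹ * ((A.dev1 a - η / 2) ^ 2 + 3 / 4 * η ^ 2) := by field_simp; ring
    have h3 : 0 ≤ η⁻¹ * ((A.dev1 a - η / 2) ^ 2 + 3 / 4 * η ^ 2) := by positivity
    linarith
  linarith

variable {ν : P2 d} {γ : Measure (M d × M d)}

lemma Alloc.integrable_dev_fst (A : Alloc μ n) (hγ : γ ∈ couplings μ ν) :
    Integrable (fun p : M d × M d => A.dev p.1) γ :=
  (coupling_mp_fst hγ).integrable_comp_of_integrable A.integrable_dev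

lemma Alloc.integrable_dev_snd (B : Alloc ν n) (hγ : γ ∈ couplings μ ν) :
    Integrable (fun p : M d × M d => B.dev p.2) γ :=
  (coupling_mp_snd hγ).integrable_comp_of_integrable B.integrable_dev

lemma Alloc.integral_dev_fst (A : Alloc μ n) (hγ : γ ∈ couplings μ ν) :
    ∫ p, A.dev p.1 ∂γ = A.tcost := by
  have := integral_map (μ := γ) measurable_fst.aemeasurable
    (f := A.dev) (by rw [hγ.1]; exact A.integrable_dev.1)
  rw [← this, hγ.1]; rfl

lemma Alloc.integral_dev_snd (B : Alloc ν n) (hγ : γ ∈ couplings μ ν) :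
    ∫ p, B.dev p.2 ∂γ = B.tcost := by
  have := integral_map (μ := γ) measurable_snd.aemeasurable
    (f := B.dev) (by rw [hγ.2]; exact B.integrable_dev.1)
  rw [← this, hγ.2]; rfl

end AllocSeq

/-- A bound by the distance of the points for every matching passes to the limit. -/
lemma abs_sub_le_of_matchings {μ ν : P2 d} {L : Filter ℕ} [L.NeBot] (hL : L ≤ atTop) {u v : ℕ → ℝ}
    {s t K D : ℝ} (hK : 0 ≤ K) (hu : Tendsto u L (𝓝 s)) (hv : Tendsto v L (𝓝 t))
    (H : ∀ᶠ m in atTop, ∀ σ : Equiv.Perm (Fin (m + 1)), |u m - v m| ≤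
      K * (D + ((m + 1 : ℕ) : ℝ)⁻¹ * ∑ i, ‖(allocSeq μ m).x i - (allocSeq ν m).x (σ i)‖)) :
    |s - t| ≤ K * (D + W2 μ ν) := by
  have key : ∀ γ ∈ couplings μ ν, ∀ η > 0,
      |s - t| ≤ K * (D + (Real.sqrt (cost γ) + 4 * η)) := fun γ hγ η hη => by
    refine le_of_tendsto ((hu.sub hv).abs) (hL ?_)
    -- Costs below `η ^ 2` contribute `η⁻¹ * η ^ 2 = η` each; with the constants `η` from
    -- `Alloc.dev1_le` for both measures the error is `4 * η`.
    have hη2 : 0 < η ^ 2 := by positivity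
    filter_upwards [H, (tendsto_tcost μ).eventually (gt_mem_nhds hη2),
      (tendsto_tcost ν).eventually (gt_mem_nhds hη2)] with m hm h1 h2
    set A := allocSeq μ m
    set B := allocSeq ν m
    have := coupling_isProb hγ
    have e := A.abs_sub_integral_mix_le B hγ (fun _ _ => 0) (fun i j => K * ‖A.x i - B.x j‖)
      (u m - v m) (K * D) (fun σ => by
        simp only [Finset.sum_const_zero, mul_zero, sub_zero]
        refine (hm σ).trans (le_of_eq ?_)
        rw [← Finset.mul_sum]; ring)
    simp only [A.mix_const B, integral_zero, sub_zero] at e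
    refine e.trans ?_
    rw [mul_add]
    gcongr
    have hA := A.integrable_dev_fst hγ
    have hB := B.integrable_dev_snd hγ
    have hle : ∀ p, A.mix B (fun i j => K * ‖A.x i - B.x j‖) p ≤
        K * (‖p.1 - p.2‖ + ((2 * η + η⁻¹ * A.dev p.1) + η⁻¹ * B.dev p.2)) := fun p => by
      have h := A.mix_le_of_separated B (h := fun i j => K * ‖A.x i - B.x j‖)
        (c := K * ‖p.1 - p.2‖) (f := fun i => K * ‖p.1 - A.x i‖) (g := fun j => K * ‖p.2 - B.x j‖)
        (fun i j => by
          rw [← mul_add, ← mul_add]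
          gcongr
          calc ‖A.x i - B.x j‖ = ‖(p.1 - p.2) - (p.1 - A.x i) + (p.2 - B.x j)‖ := by congr 1; abel
            _ ≤ _ := (norm_add_le _ _).trans (by gcongr; exact norm_sub_le _ _)) p
      refine h.trans ?_
      have e1 : ∑ i, A.w i p.1 * (K * ‖p.1 - A.x i‖) = K * A.dev1 p.1 := by
        rw [Alloc.dev1, Finset.mul_sum]; exact Finset.sum_congr rfl fun i _ => by ring
      have e2 : ∑ j, B.w j p.2 * (K * ‖p.2 - B.x j‖) = K * B.dev1 p.2 := by
        rw [Alloc.dev1, Finset.mul_sum]; exact Finset.sum_congr rfl fun i _ => by ring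
      rw [e1, e2, ← mul_add, ← mul_add]
      refine mul_le_mul_of_nonneg_left ?_ hK
      linarith [A.dev1_le hη p.1, B.dev1_le hη p.2]
    have hi1 : Integrable (fun p : M d × M d => 2 * η + η⁻¹ * A.dev p.1) γ :=
      (integrable_const _).add (hA.const_mul _)
    have hi2 : Integrable (fun p : M d × M d => (2 * η + η⁻¹ * A.dev p.1) + η⁻¹ * B.dev p.2) γ :=
      hi1.add (hB.const_mul _)
    refine (integral_mono (A.integrable_mix B hγ _)
      (((coupling_integrable_norm hγ).add hi2).const_mul K) hle).trans ?_
    rw [integral_const_mul, integral_add' (coupling_integrable_norm hγ) hi2,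
      integral_add hi1 (hB.const_mul _), integral_add (integrable_const _) (hA.const_mul _),
      integral_const_mul, integral_const_mul, integral_const_mul, A.integral_dev_fst hγ, B.integral_dev_snd hγ]
    simp only [integral_const, probReal_univ, one_smul]
    gcongr
    · exact integral_dist_le_sqrt_cost hγ
    · have h3 : η⁻¹ * A.tcost ≤ η⁻¹ * η ^ 2 := by gcongr
      have h4 : η⁻¹ * B.tcost ≤ η⁻¹ * η ^ 2 := by gcongr
      have h5 : η⁻¹ * η ^ 2 = η := by field_simp
      linarith
  refine le_of_forall_pos_le_add fun ε hε => ?_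
  have hK1 : 0 < K + 1 := by linarith
  -- Four parts for the transports and one for the plan that is only nearly optimal.
  set η := ε / (5 * (K + 1)) with hη_def
  have hη : 0 < η := by positivity
  have hlt : W2 μ ν ^ 2 < (W2 μ ν + η) ^ 2 := by
    have := W2_nonneg μ ν; gcongr; linarith
  obtain ⟨γ, hγ, hc⟩ := exists_coupling_cost_lt μ ν hlt
  have h1 : Real.sqrt (cost γ) ≤ W2 μ ν + η :=
    (Real.sqrt_le_sqrt hc.le).trans (by
      rw [Real.sqrt_sq (by have := W2_nonneg μ ν; linarith)])
  refine (key γ hγ η hη).trans ?_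
  have h2 : K * (D + (Real.sqrt (cost γ) + 4 * η)) ≤ K * (D + W2 μ ν) + K * (5 * η) := by
    rw [← mul_add]; exact mul_le_mul_of_nonneg_left (by linarith) hK
  have h3 : K * (5 * η) ≤ ε := by
    rw [hη_def]
    have : K * (5 * (ε / (5 * (K + 1)))) = K / (K + 1) * ε := by field_simp
    rw [this]
    exact mul_le_of_le_one_left hε.le ((div_le_one hK1).2 (by linarith))
  linarith

end Limits

/-! ### Identification of the Wasserstein gradient with the limit of first derivatives -/

section Gradient
open Filter Topology
variable {d m n : ℕ} {U : P2 d → ℝ} {μ ν : P2 d}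

lemma hasWGradientAt_wgrad (h : WDifferentiableAt U μ) : HasWGradientAt U (wgrad U μ) μ := by
  unfold wgrad
  split_ifs with h1
  · exact h1.choose_spec.1
  · exact h.choose_spec

lemma memLp_wgrad (h : WDifferentiableAt U μ) : MemLp (wgrad U μ) 2 μ.meas :=
  (hasWGradientAt_wgrad h).1.1

lemma hasDerivAt_of_abs_sub_le_sq {φ : ℝ → ℝ} {a C : ℝ}
    (h : ∀ᶠ t in 𝓝 (0 : ℝ), |φ t - φ 0 - t * a| ≤ C * t ^ 2) : HasDerivAt φ a 0 := by
  rw [hasDerivAt_iff_isLittleO_nhds_zero]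
  have h1 : (fun t : ℝ => φ (0 + t) - φ 0 - t • a) =O[𝓝 0] fun t : ℝ => t ^ 2 := by
    refine Asymptotics.IsBigO.of_bound C ?_
    filter_upwards [h] with t ht
    rw [zero_add, smul_eq_mul, Real.norm_eq_abs, Real.norm_eq_abs, abs_of_nonneg (sq_nonneg t)]
    exact ht
  exact h1.trans_isLittleO (Asymptotics.isLittleO_pow_id one_lt_two)

/-- Move the single point `z i` by `t e_α`. For small `t` the diagonal plan is optimal, so the
`C^{1,1}` expansion shows that `restr U m` along this line has slope `m⁻¹` times the component of
the gradient at `z i`. Coinciding points are harmless, since only one copy moves. -/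
lemma wgrad_empirical [NeZero m] (hU : IsC11Loc U) (hd : Differentiable ℝ (restr U m))
    (z : Fin m → M d) (i : Fin m) (α : Fin d) :
    (wgrad U (empirical z) (z i)) α = m * D1 (restr U m) z i α := by
  have hm0 : (0 : ℝ) < m := by linarith [one_le_natCast (m := m)]
  set ξ := wgrad U (empirical z)
  -- The `1` added to each norm leaves room for all moves with `|t| ≤ 1`.
  set r : ℝ := Real.sqrt ((m : ℝ)⁻¹ * ∑ j, (‖z j‖ + 1) ^ 2) + 1 with hr_def
  have hr : 0 < r := by positivity
  have hr2 : (m : ℝ)⁻¹ * ∑ j, (‖z j‖ + 1) ^ 2 ≤ r ^ 2 := by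
    have h := Real.sq_sqrt (show 0 ≤ (m : ℝ)⁻¹ * ∑ j, (‖z j‖ + 1) ^ 2 by positivity)
    have h0 := Real.sqrt_nonneg ((m : ℝ)⁻¹ * ∑ j, (‖z j‖ + 1) ^ 2)
    rw [hr_def]; nlinarith
  obtain ⟨-, C, hC, -, hT⟩ := hU r hr
  have hball : ∀ t : ℝ, |t| ≤ 1 → empirical (z + t • dir i α) ∈ ballP2 d r := fun t ht => by
    refine empirical_mem_ballP2 hr.le (le_trans ?_ hr2)
    gcongr with j
    refine (norm_add_le _ _).trans ?_
    gcongr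
    rw [Pi.smul_apply, norm_smul, Real.norm_eq_abs]
    refine mul_le_one₀ ht (norm_nonneg _) ?_
    rw [dir, Pi.single_apply]; split_ifs <;> simp
  have hopt : ∀ᶠ t in 𝓝 (0 : ℝ),
      diagPlan z (z + t • dir i α) ∈ optPlans (empirical z) (empirical (z + t • dir i α)) := by
    -- As long as `|t|` is below half the distance to every other location, `z i` stays a nearest
    -- source point of its image.
    have h1 : ∀ k, ∀ᶠ t in 𝓝 (0 : ℝ), z k ≠ z i → |t| ≤ ‖z k - z i‖ - |t| := fun k => by
      by_cases hk : z k = z i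
      · simp [hk]
      · have hpos : 0 < ‖z k - z i‖ / 2 := half_pos (norm_pos_iff.2 (sub_ne_zero.2 hk))
        filter_upwards [Metric.ball_mem_nhds (0 : ℝ) hpos] with t ht _
        rw [Metric.mem_ball, Real.dist_eq, sub_zero] at ht
        linarith
    filter_upwards [eventually_all.2 h1] with t ht
    refine diagPlan_mem_optPlans _ _ fun j k => ?_
    simp only [Pi.add_apply, Pi.smul_apply, dir, Pi.single_apply]
    split_ifs with hj
    · subst hj
      rw [sub_add_cancel_left, norm_neg, ← sub_sub]
      by_cases hk : z k = z j
      · simp [hk]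
      · have e : ‖t • (EuclideanSpace.single α (1 : ℝ) : M d)‖ = |t| := by simp [norm_smul]
        calc ‖t • (EuclideanSpace.single α (1 : ℝ) : M d)‖ = |t| := e
          _ ≤ ‖z k - z j‖ - |t| := ht k hk
          _ ≤ _ := by rw [← e]; exact norm_sub_norm_le _ _
    · simp
  have hder : HasDerivAt (fun t : ℝ => restr U m (z + t • dir i α)) ((m : ℝ)⁻¹ * ξ (z i) α) 0 := by
    refine hasDerivAt_of_abs_sub_le_sq (C := C * (m : ℝ)⁻¹) ?_
    filter_upwards [hopt, Metric.ball_mem_nhds (0 : ℝ) one_pos] with t ht ht1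
    rw [Metric.mem_ball, Real.dist_eq, sub_zero] at ht1
    have h0 := hball 0 (by simp)
    rw [zero_smul, add_zero] at h0
    have key := hT _ h0 _ (hball t ht1.le) _ ht
    rw [ht.2, cost_diagPlan] at key
    have e1 : ∫ p, inner ℝ (ξ p.1) (p.2 - p.1) ∂(diagPlan z (z + t • dir i α)) =
        t * ((m : ℝ)⁻¹ * ξ (z i) α) := by
      rw [diagPlan, integral_average_dirac, Finset.sum_eq_single i]
      · simp [dir, inner_smul_right, EuclideanSpace.inner_single_right]; ring
      · intro j _ hj; simp [dir, hj]
      · simp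
    have e2 : ∑ j, ‖z j - (z + t • dir i α) j‖ ^ 2 = t ^ 2 := by
      rw [Finset.sum_eq_single i]
      · simp [dir, norm_smul]
      · intro j _ hj; simp [dir, hj]
      · simp
    rw [e1, e2] at key
    simp only [zero_smul, add_zero]
    rw [mul_assoc]
    exact key
  have hder2 := hasDerivAt_segment hd z (dir i α) 0
  rw [zero_smul, add_zero] at hder2
  have := hder.unique hder2
  rw [D1, ← this]; field_simp

namespace Alloc

/-- The plan between `μ` and the empirical measure of the points. -/
def plan (A : Alloc μ m) : Measure (M d × M d) :=
  ∑ i, (μ.meas.withDensity fun a => ENNReal.ofReal (A.w i a)).map fun a => (a, A.x i)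

lemma lintegral_w (A : Alloc μ m) (hm : m ≠ 0) (i : Fin m) :
    ∫⁻ a, ENNReal.ofReal (A.w i a) ∂μ.meas = (m : ℝ≥0∞)⁻¹ := by
  rw [← ofReal_integral_eq_lintegral_ofReal (A.integrable_w i) (ae_of_all _ (A.nonneg i)),
    A.integral_eq, ENNReal.ofReal_inv_of_pos (by positivity), ENNReal.ofReal_natCast]

lemma plan_mem [NeZero m] (A : Alloc μ m) : A.plan ∈ couplings μ (empirical A.x) := by
  have hp : ∀ i, Measurable fun a : M d => (a, A.x i) := fun i => by fun_prop
  have hm : ∀ i, Measurable fun a => ENNReal.ofReal (A.w i a) := fun i =>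
    (A.meas i).ennreal_ofReal
  constructor
  · rw [plan, Measure.map_finset_sum' measurable_fst.aemeasurable]
    simp_rw [Measure.map_map measurable_fst (hp _)]
    have : ∀ i, (Prod.fst ∘ fun a : M d => (a, A.x i)) = id := fun i => rfl
    simp_rw [this, Measure.map_id]
    ext s hs
    simp only [Measure.coe_finsetSum, Finset.sum_apply]
    simp_rw [withDensity_apply _ hs]
    rw [← lintegral_finsetSum _ fun i _ => hm i]
    have h1 : ∀ a, ∑ i, ENNReal.ofReal (A.w i a) = 1 := fun a => by
      rw [← ENNReal.ofReal_sum_of_nonneg fun i _ => A.nonneg i a, A.sum_eq, ENNReal.ofReal_one]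
    simp [h1]
  · rw [plan, Measure.map_finset_sum' measurable_snd.aemeasurable]
    simp_rw [Measure.map_map measurable_snd (hp _)]
    have : ∀ i, (Prod.snd ∘ fun a : M d => (a, A.x i)) = fun _ => A.x i := fun i => rfl
    simp_rw [this, Measure.map_const, withDensity_apply _ MeasurableSet.univ,
      Measure.restrict_univ, A.lintegral_w (NeZero.ne m)]
    simp [empirical, Finset.smul_sum]

lemma cost_plan (A : Alloc μ m) : cost A.plan = A.tcost := by
  have hp : ∀ i, Measurable fun a : M d => (a, A.x i) := fun i => by fun_prop
  have hm : ∀ i, Measurable fun a => ENNReal.ofReal (A.w i a) := fun i =>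
    (A.meas i).ennreal_ofReal
  have hfin : ∀ i, ∀ᵐ a ∂μ.meas, ENNReal.ofReal (A.w i a) < ⊤ := fun i =>
    ae_of_all _ fun a => ENNReal.ofReal_lt_top
  have hmeas : ∀ ρ : Measure (M d × M d),
      AEStronglyMeasurable (fun p : M d × M d => ‖p.1 - p.2‖ ^ 2) ρ := fun ρ => by
    fun_prop
  rw [cost, plan, integral_finsetSum_measure, tcost]
  · unfold dev
    rw [integral_finsetSum _ fun i _ => A.integrable_w_mul i (integrable_sq_sub μ _)]
    refine Finset.sum_congr rfl fun i _ => ?_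
    rw [integral_map (hp i).aemeasurable (hmeas _),
      integral_withDensity_eq_integral_toReal_smul (hm i) (hfin i)]
    simp [ENNReal.toReal_ofReal (A.nonneg i _)]
  · intro i _
    rw [integrable_map_measure (hmeas _) (hp i).aemeasurable,
      integrable_withDensity_iff (hm i) (hfin i)]
    simpa [ENNReal.toReal_ofReal (A.nonneg i _), mul_comm] using
      A.integrable_w_mul i (integrable_sq_sub μ (A.x i))

/-- The transport that sends a fraction of the mass to two further points at the origin. -/
def ext [NeZero n] (A : Alloc μ n) : Alloc μ (n + 2) where
  x := cfg 0 0 A.x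
  w := Fin.cons (fun _ => ((n + 2 : ℕ) : ℝ)⁻¹) (Fin.cons (fun _ => ((n + 2 : ℕ) : ℝ)⁻¹)
    fun i a => n * ((n + 2 : ℕ) : ℝ)⁻¹ * A.w i a)
  meas := by
    refine fun k => Fin.cases ?_ (fun k => Fin.cases ?_ (fun i => ?_) k) k
    · exact measurable_const
    · exact measurable_const
    · exact (A.meas i).const_mul _
  nonneg := by
    refine fun k a => Fin.cases ?_ (fun k => Fin.cases ?_ (fun i => ?_) k) k
    · simp only [Fin.cons_zero]; positivity
    · simp only [Fin.cons_zero, Fin.cons_succ]; positivity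
    · have := A.nonneg i a
      simp only [Fin.cons_succ]; positivity
  sum_eq := fun a => by
    rw [Fin.sum_univ_succ, Fin.sum_univ_succ]
    simp only [Fin.cons_zero, Fin.cons_succ]
    rw [← Finset.mul_sum, A.sum_eq]
    push_cast
    field_simp; ring
  integral_eq := by
    have hn : (n : ℝ) ≠ 0 := by exact_mod_cast NeZero.ne n
    refine fun k => Fin.cases ?_ (fun k => Fin.cases ?_ (fun i => ?_) k) k
    · simp
    · simp
    · simp only [Fin.cons_succ]
      rw [integral_const_mul, A.integral_eq]
      field_simp

/-- The two points at the origin each receive the fraction `(n + 2)⁻¹` of all mass, so the padding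
has vanishing cost. It makes `cfg 0 0 A.x` an empirical approximation of `μ` with the same number of
points as `gradApx`. -/
lemma tcost_ext_le [NeZero n] (A : Alloc μ n) :
    A.ext.tcost ≤ ((n + 2 : ℕ) : ℝ)⁻¹ * (2 * ∫ a, ‖a‖ ^ 2 ∂μ.meas) + A.tcost := by
  have h : ∀ a, A.ext.dev a ≤ ((n + 2 : ℕ) : ℝ)⁻¹ * (2 * ‖a‖ ^ 2) + A.dev a := fun a => by
    have e : A.ext.dev a = ((n + 2 : ℕ) : ℝ)⁻¹ * (2 * ‖a‖ ^ 2) +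
        n * ((n + 2 : ℕ) : ℝ)⁻¹ * A.dev a := by
      rw [dev, Fin.sum_univ_succ, Fin.sum_univ_succ, dev, Finset.mul_sum]
      have e1 : ∀ i : Fin n, A.ext.w i.succ.succ a * ‖a - A.ext.x i.succ.succ‖ ^ 2 =
        n * ((n + 2 : ℕ) : ℝ)⁻¹ * (A.w i a * ‖a - A.x i‖ ^ 2) := fun i => by
          simp only [ext, Fin.cons_succ, cfg_succ_succ]; ring
      simp_rw [e1]
      have e2 : A.ext.w 0 a * ‖a - A.ext.x 0‖ ^ 2 = ((n + 2 : ℕ) : ℝ)⁻¹ * ‖a‖ ^ 2 := by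
        simp [ext]
      have e3 : A.ext.w (Fin.succ 0) a * ‖a - A.ext.x (Fin.succ 0)‖ ^ 2 =
          ((n + 2 : ℕ) : ℝ)⁻¹ * ‖a‖ ^ 2 := by
        simp [ext, cfg]
      rw [e2, e3]; ring
    rw [e]
    gcongr
    refine mul_le_of_le_one_left (A.dev_nonneg a) ?_
    rw [← div_eq_mul_inv]
    exact div_le_one_of_le₀ (by push_cast; linarith) (by positivity)
  refine (integral_mono A.ext.integrable_dev (((μ.integrable_sq.const_mul 2).const_mul _).add
    A.integrable_dev) h).trans (le_of_eq ?_)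
  rw [integral_add' ((μ.integrable_sq.const_mul 2).const_mul _) A.integrable_dev,
    integral_const_mul, integral_const_mul]
  rfl

end Alloc

/-- A function with small mean takes a small value on a set of positive measure. -/
lemma exists_lt_of_integral_lt {E : Type*} [MeasurableSpace E] {γ : Measure E}
    [IsFiniteMeasure γ] {f : E → ℝ} (hf : Integrable f γ) (h0 : ∀ p, 0 ≤ f p) {S : Set E}
    (hS : MeasurableSet S) {P : E → Prop} (hP : ∀ᵐ p ∂γ, P p) {c : ℝ}
    (h : ∫ p, f p ∂γ < γ.real S * c) : ∃ p ∈ S, P p ∧ f p < c := by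
  by_contra! hcon
  refine not_le.2 h ?_
  have e : γ.real S * c = ∫ p, indicator S (fun _ => c) p ∂γ := by
    rw [integral_indicator hS]; simp
  rw [e]
  refine integral_mono_ae ((integrable_const c).indicator hS) hf ?_
  filter_upwards [hP] with p hp
  by_cases hpS : p ∈ S
  · simpa [hpS] using hcon p hpS hp
  · simpa [hpS] using h0 p

/-- Once the first marked point is moved from the origin onto point `k`, the two coincide, and
exchanging them identifies the derivatives at `0` and at `k`. In the estimate for the derivative at
`k` the move affects another point, so it counts only through the mean displacement. -/
lemma gradApx_sub_le {R C : ℝ} (hS : ScaledOn (restr U (n + 2)) R C) {x : Fin n → M d}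
    (k : Fin (n + 2)) (hz : cfg 0 0 x ∈ ballM d (n + 2) R)
    (hz' : cfg (cfg 0 0 x k) 0 x ∈ ballM d (n + 2) R) (α : Fin d) :
    |gradApx U (cfg 0 0 x k) x α - ((n + 2 : ℕ) : ℝ) * D1 (restr U (n + 2)) (cfg 0 0 x) k α| ≤
      d * C * (((n + 2 : ℕ) : ℝ)⁻¹ * ‖cfg 0 0 x k‖) := by
  set z := cfg 0 0 x with hz_def
  have hz'_def : cfg (z k) 0 x = Function.update z 0 (z k) := by
    rw [hz_def, cfg, cfg, Fin.update_cons_zero]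
  rw [gradApx]
  rw [hz'_def] at hz' ⊢
  set z' := Function.update z 0 (z k)
  have hk : z' k = z k := by
    by_cases h : k = 0
    · subst h; simp [z']
    · simp [z', h]
  have hswap : z' ∘ Equiv.swap 0 k = z' := by
    funext l
    simp only [Function.comp_apply]
    rcases eq_or_ne l 0 with rfl | h0
    · rw [Equiv.swap_apply_left, hk]; simp [z']
    rcases eq_or_ne l k with rfl | h1
    · rw [Equiv.swap_apply_right, hk]; simp [z']
    · rw [Equiv.swap_apply_of_ne_of_ne h0 h1]
  have e : D1 (restr U (n + 2)) z' 0 α = D1 (restr U (n + 2)) z' k α := by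
    conv_lhs => rw [← hswap]
    rw [D1_perm (hS.smooth.differentiable (by norm_num)) _ (fun w => restr_comp_perm U w _),
      Equiv.swap_apply_left]
  rw [e]
  refine (hS.lip_grad hz hz' k α).trans (le_of_eq ?_)
  rw [hk, sub_self, norm_zero, zero_add, mul_assoc]
  congr 3
  rw [Finset.sum_eq_single 0]
  · simp [z', hz_def]
  · intro l _ hl; simp [z', hl]
  · simp

lemma ballP2_mono {r r' : ℝ} (h : r ≤ r') : ballP2 d r ⊆ ballP2 d r' :=
  fun _ hμ => le_trans (α := ℝ) hμ h

/-- On the support the gradient is the limit of the first derivatives at the marked point. -/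
lemma tendsto_gradApx (hU : IsC11Loc U) {r C : ℝ} (hr : 0 < r) (hμ : μ ∈ ballP2 d r)
    (hS : ∀ n, ScaledOn (restr U (n + 2)) (3 * r) C) {q : M d} (hq : q ∈ μ.spt) (α : Fin d) :
    Tendsto (fun m => gradApx U q (allocSeq μ m).x α) atTop (𝓝 (wgrad U μ q α)) := by
  have hC : 0 ≤ C := (hS 0).nonneg
  have h3r : 0 < 3 * r := by positivity
  obtain ⟨⟨hdiff, hcont⟩, CL, hCL, hLip, -⟩ := hU (3 * r) h3r
  have hμ3 : μ ∈ ballP2 d (3 * r) := ballP2_mono (by linarith) hμ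
  have hbound : ∀ η : ℝ, 0 < η → η ≤ 1 → ∀ᶠ m in atTop,
      |gradApx U q (allocSeq μ m).x α - wgrad U μ q α| ≤ (5 * (d * C) + 1 + CL) * η := by
    intro η hη hη1
    set κ := μ.meas.real (Metric.ball q η) with hκ_def
    have hκ : 0 < κ := by
      have h := (Measure.mem_support_iff_forall q).1 hq (Metric.ball q η)
        (Metric.ball_mem_nhds q hη)
      exact ENNReal.toReal_pos h.ne' (measure_ne_top _ _)
    -- The gradient gap and the displacement are each made to integrate, in square, to less than
    -- half of `κ * η ^ 2`, with `κ` the mass of the ball around `q`. Some pair starting in that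
    -- ball then has both below `η`, as selected by `exists_lt_of_integral_lt`.
    have hε : 0 < κ * η ^ 2 / 2 := by positivity
    obtain ⟨δ, hδ, hcontδ⟩ := hcont μ hμ3 _ hε
    have hlim : Tendsto (fun m : ℕ => ((m + 1 + 2 : ℕ) : ℝ)⁻¹ * (2 * ∫ a, ‖a‖ ^ 2 ∂μ.meas) +
        (allocSeq μ m).tcost) atTop (𝓝 0) := by
      have h1 : Tendsto (fun m : ℕ => ((m + 1 + 2 : ℕ) : ℝ)⁻¹) atTop (𝓝 0) :=
        (tendsto_inv_atTop_nhds_zero_nat (𝕜 := ℝ)).comp (tendsto_add_atTop_nat 3)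
      simpa using (h1.mul_const _).add (tendsto_tcost μ)
    filter_upwards [hlim.eventually (gt_mem_nhds hδ), hlim.eventually (gt_mem_nhds hε),
      eventually_cfg_mem hr hμ ((‖q‖ + 1) ^ 2), eventually_norm_x_le hr hμ hη]
      with m hm1 hm2 hmem hx
    set A := allocSeq μ m
    set z := cfg 0 0 A.x with hz_def
    have hγ := A.ext.plan_mem
    set γ := A.ext.plan
    have := coupling_isProb hγ
    have hsum0 : 0 ≤ ∑ i, ‖A.x i‖ ^ 2 := Finset.sum_nonneg fun _ _ => sq_nonneg _
    have h0mem : ‖(0 : M d)‖ ^ 2 ≤ (‖q‖ + 1) ^ 2 + ∑ i, ‖A.x i‖ ^ 2 := by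
      rw [norm_zero, zero_pow two_ne_zero]; exact add_nonneg (sq_nonneg _) hsum0
    have hzball : z ∈ ballM d (m + 1 + 2) (3 * r) := hmem 0 0 h0mem h0mem
    have hνball : empirical A.ext.x ∈ ballP2 d (3 * r) := empirical_mem_ballP2 h3r.le hzball
    have hcostle : cost γ ≤ _ := A.ext.cost_plan.le.trans A.tcost_ext_le
    have hint := hcontδ _ hνball γ hγ (hcostle.trans_lt hm1)
    set ζ := wgrad U (empirical A.ext.x) with hζ
    have hi1 : Integrable (fun p : M d × M d => ‖ζ p.2 - wgrad U μ p.1‖ ^ 2) γ := by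
      have h : MemLp (fun p : M d × M d => ζ p.2 - wgrad U μ p.1) 2 γ :=
        ((memLp_wgrad (hdiff _ hνball)).comp_measurePreserving (coupling_mp_snd hγ)).sub
          ((memLp_wgrad (hdiff _ hμ3)).comp_measurePreserving (coupling_mp_fst hγ))
      exact (memLp_two_iff_integrable_sq_norm h.1).1 h
    have hi2 := coupling_integrable_sq hγ
    have hreal : γ.real (Prod.fst ⁻¹' Metric.ball q η) = κ := by
      rw [hκ_def, Measure.real, Measure.real,
        (coupling_mp_fst hγ).measure_preimage measurableSet_ball.nullMeasurableSet]
    have hae : ∀ᵐ p ∂γ, p.1 ∈ μ.spt ∧ ∃ k, p.2 = A.ext.x k := by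
      have h1 : ∀ᵐ a ∂μ.meas, a ∈ μ.spt := Measure.support_mem_ae
      exact ((coupling_mp_fst hγ).quasiMeasurePreserving.ae h1).and
        ((coupling_mp_snd hγ).quasiMeasurePreserving.ae (ae_empirical A.ext.x))
    obtain ⟨p, hpball, ⟨hpspt, k, hpk⟩, hp⟩ := exists_lt_of_integral_lt (hi1.add hi2)
      (fun p => add_nonneg (sq_nonneg _) (sq_nonneg _)) (measurable_fst measurableSet_ball) hae (c := η ^ 2) (by
        rw [integral_add' hi1 hi2, hreal]
        have : ∫ p, ‖p.1 - p.2‖ ^ 2 ∂γ < κ * η ^ 2 / 2 := hcostle.trans_lt hm2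
        linarith)
    have hp1 : ‖ζ p.2 - wgrad U μ p.1‖ ≤ η := by
      refine le_of_sq_le_sq (le_trans ?_ hp.le) hη.le
      exact le_add_of_nonneg_right (sq_nonneg _)
    have hp2 : ‖p.1 - p.2‖ ≤ η := by
      refine le_of_sq_le_sq (le_trans ?_ hp.le) hη.le
      exact le_add_of_nonneg_left (sq_nonneg _)
    have hp3 : ‖q - p.1‖ ≤ η := by
      have := Metric.mem_ball.1 hpball
      rw [dist_eq_norm, norm_sub_rev] at this; exact this.le
    have hpk' : p.2 = z k := hpk
    have hzk : ‖z k‖ ≤ η * ((m + 1 + 2 : ℕ) : ℝ) := by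
      refine Fin.cases ?_ (fun k => Fin.cases ?_ (fun i => ?_) k) k
      · simp only [hz_def, cfg_zero, norm_zero]; positivity
      · simp only [hz_def, Fin.succ_zero_eq_one, cfg_one, norm_zero]; positivity
      · exact hx i
    have hzk2 : ‖z k‖ ^ 2 ≤ (‖q‖ + 1) ^ 2 + ∑ i, ‖A.x i‖ ^ 2 := by
      refine Fin.cases ?_ (fun k => Fin.cases ?_ (fun i => ?_) k) k
      · exact h0mem
      · exact h0mem
      · have := Finset.single_le_sum (f := fun i => ‖A.x i‖ ^ 2) (fun _ _ => sq_nonneg _)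
          (Finset.mem_univ i)
        exact le_add_of_nonneg_of_le (sq_nonneg _) this
    have hq2 : ‖q‖ ^ 2 ≤ (‖q‖ + 1) ^ 2 + ∑ i, ‖A.x i‖ ^ 2 := by
      nlinarith [norm_nonneg q]
    have hpp : ‖p.1‖ ^ 2 ≤ (‖q‖ + 1) ^ 2 + ∑ i, ‖A.x i‖ ^ 2 := by
      have h1 : ‖p.1‖ ≤ ‖q‖ + 1 := by
        have := norm_sub_le q (q - p.1); rw [sub_sub_cancel] at this; linarith
      have h2 : ‖p.1‖ ^ 2 ≤ (‖q‖ + 1) ^ 2 := by gcongr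
      linarith
    -- Chain from `q` to `p.1`, then to the nearby point `z k`, then to the derivative at index `k`,
    -- which is the gradient of the empirical measure, then to `wgrad U μ` at `p.1` and back to `q`.
    -- The costs `2 + 2 + 1` times `d * C`, `1` and `CL` make up the constant in `hbound`.
    have b1 : |gradApx U q A.x α - gradApx U p.1 A.x α| ≤ d * C * (2 * η) := by
      refine (gradApx_lip (hS _) (hmem q 0 hq2 h0mem) (hmem p.1 0 hpp h0mem) α).trans ?_
      simp only [sub_self, norm_zero, Finset.sum_const_zero, mul_zero, add_zero]
      gcongr
    have b2 : |gradApx U p.1 A.x α - gradApx U (z k) A.x α| ≤ d * C * (2 * η) := by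
      refine (gradApx_lip (hS _) (hmem p.1 0 hpp h0mem) (hmem (z k) 0 hzk2 h0mem) α).trans ?_
      simp only [sub_self, norm_zero, Finset.sum_const_zero, mul_zero, add_zero]
      rw [hpk'] at hp2
      gcongr
    have b3 := gradApx_sub_le (hS (m + 1)) (x := A.x) k hzball (hmem (z k) 0 hzk2 h0mem) α
    have b3' : d * C * (((m + 1 + 2 : ℕ) : ℝ)⁻¹ * ‖cfg 0 0 A.x k‖) ≤ d * C * η := by
      gcongr
      rw [inv_mul_le_iff₀ (by positivity), mul_comm]; exact hzk
    have e := wgrad_empirical hU ((hS (m + 1)).smooth.differentiable (by norm_num)) A.ext.x k α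
    change ζ (z k) α = ((m + 1 + 2 : ℕ) : ℝ) * D1 (restr U (m + 1 + 2)) z k α at e
    rw [← hz_def, ← e] at b3
    have b4 : |ζ (z k) α - wgrad U μ p.1 α| ≤ η := by
      rw [← hpk']
      exact (abs_coord_le (ζ p.2 - wgrad U μ p.1) α).trans hp1
    have b5 : |wgrad U μ p.1 α - wgrad U μ q α| ≤ CL * η := by
      refine (abs_coord_le (wgrad U μ p.1 - wgrad U μ q) α).trans
        ((hLip μ hμ3 _ hpspt _ hq).trans ?_)
      rw [norm_sub_rev]; gcongr
    rw [abs_le] at *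
    constructor <;> linarith
  rw [Metric.tendsto_atTop']
  intro ε hε
  have hB : 0 < 5 * (d * C) + 1 + CL := by positivity
  obtain ⟨η, hη, hη1, hlt⟩ : ∃ η : ℝ, 0 < η ∧ η ≤ 1 ∧ (5 * (d * C) + 1 + CL) * η < ε := by
    refine ⟨min 1 (ε / (2 * (5 * (d * C) + 1 + CL))), by positivity, min_le_left _ _, ?_⟩
    calc (5 * (d * C) + 1 + CL) * min 1 (ε / (2 * (5 * (d * C) + 1 + CL)))
        ≤ (5 * (d * C) + 1 + CL) * (ε / (2 * (5 * (d * C) + 1 + CL))) := by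
          gcongr; exact min_le_right _ _
      _ = ε / 2 := by field_simp
      _ < ε := by linarith
  obtain ⟨N, hN⟩ := eventually_atTop.1 (hbound η hη hη1)
  exact ⟨N, fun m hm => by rw [Real.dist_eq]; exact (hN m hm.le).trans_lt hlt⟩

end Gradient

/-! ### The coefficients as ultrafilter limits, and the Taylor expansion along a matching -/

section SecondOrder
open Filter Topology
variable {d n : ℕ} {U : P2 d → ℝ} {μ ν : P2 d} {r C : ℝ}

/-- The limit of a bounded sequence along a fixed free ultrafilter. -/
def ulim (u : ℕ → ℝ) : ℝ := limUnder (hyperfilter ℕ : Filter ℕ) u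

/-- Compactness of `[-B, B]`. One ultrafilter serves all points, measures and matrix entries
simultaneously, so no subsequence has to be extracted and no uniqueness of the limit is needed. -/
lemma tendsto_ulim {u : ℕ → ℝ} {B : ℝ} (h : ∀ᶠ m in atTop, |u m| ≤ B) :
    Tendsto u (hyperfilter ℕ : Filter ℕ) (𝓝 (ulim u)) := by
  have h1 : ((hyperfilter ℕ).map u : Filter ℝ) ≤ 𝓟 (Icc (-B) B) := by
    rw [Ultrafilter.coe_map, le_principal_iff, mem_map]
    filter_upwards [Nat.hyperfilter_le_atTop h] with m hm
    exact abs_le.1 hm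
  obtain ⟨t, -, ht⟩ := isCompact_Icc.ultrafilter_le_nhds _ h1
  exact tendsto_nhds_limUnder ⟨t, ht⟩

lemma W2_self (μ : P2 d) : W2 μ μ = 0 := by
  have hm : Measurable fun a : M d => (a, a) := by fun_prop
  have h : μ.meas.map (fun a => (a, a)) ∈ couplings μ μ := by
    constructor
    · rw [Measure.map_map measurable_fst hm]; exact Measure.map_id
    · rw [Measure.map_map measurable_snd hm]; exact Measure.map_id
  have hc : cost (μ.meas.map (fun a => (a, a))) = 0 := by
    rw [cost, integral_map hm.aemeasurable (by fun_prop)]; simp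
  have := W2_sq_eq_of_forall_le h fun γ' _ => by rw [hc]; exact cost_nonneg γ'
  rw [hc] at this
  exact pow_eq_zero_iff two_ne_zero |>.1 this

variable (U) in
/-- The second order coefficient `Λ₀`. -/
def LamZero (q : M d) (μ : P2 d) : Mat d :=
  Matrix.of fun α β => ulim fun m => lamZero U q (allocSeq μ m).x α β

variable (U) in
/-- The second order coefficient `Λ₁`. -/
def LamOne (q p : M d) (μ : P2 d) : Mat d :=
  Matrix.of fun α β => ulim fun m => lamOne U q p (allocSeq μ m).x α β

lemma eventually_cfg_mem_of_fixed (hr : 0 < r) (hμ : μ ∈ ballP2 d r) (q p : M d) :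
    ∀ᶠ m in atTop, cfg q p (allocSeq μ m).x ∈ ballM d (m + 1 + 2) (3 * r) := by
  filter_upwards [eventually_cfg_mem hr hμ (‖q‖ ^ 2 + ‖p‖ ^ 2)] with m hm
  have h : 0 ≤ ∑ i, ‖(allocSeq μ m).x i‖ ^ 2 := Finset.sum_nonneg fun _ _ => sq_nonneg _
  exact hm q p (by nlinarith) (by nlinarith)

lemma ballM_comp_perm {m : ℕ} {R : ℝ} {z : Fin m → M d} (hz : z ∈ ballM d m R)
    (σ : Equiv.Perm (Fin m)) : z ∘ σ ∈ ballM d m R := by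
  change (m : ℝ)⁻¹ * ∑ j, ‖z (σ j)‖ ^ 2 ≤ R ^ 2
  rw [Equiv.sum_comp σ (fun j => ‖z j‖ ^ 2)]; exact hz

section Bounds
variable (hr : 0 < r) (hμ : μ ∈ ballP2 d r) (hν : ν ∈ ballP2 d r)
  (hS : ∀ n, ScaledOn (restr U (n + 2)) (3 * r) C)
include hr hμ hS

lemma eventually_lamZero_le (q : M d) (α β : Fin d) :
    ∀ᶠ m in atTop, |lamZero U q (allocSeq μ m).x α β| ≤ C := by
  filter_upwards [eventually_cfg_mem_of_fixed hr hμ q 0] with m hm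
  exact lamZero_bound (hS _) hm α β

lemma eventually_lamOne_le (q p : M d) (α β : Fin d) :
    ∀ᶠ m in atTop, |lamOne U q p (allocSeq μ m).x α β| ≤ C := by
  filter_upwards [eventually_cfg_mem_of_fixed hr hμ q p] with m hm
  exact lamOne_bound (hS _) hm α β

lemma tendsto_lamZero (q : M d) (α β : Fin d) :
    Tendsto (fun m => lamZero U q (allocSeq μ m).x α β) (hyperfilter ℕ : Filter ℕ)
      (𝓝 (LamZero U q μ α β)) := tendsto_ulim (eventually_lamZero_le hr hμ hS q α β)

lemma tendsto_lamOne (q p : M d) (α β : Fin d) :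
    Tendsto (fun m => lamOne U q p (allocSeq μ m).x α β) (hyperfilter ℕ : Filter ℕ)
      (𝓝 (LamOne U q p μ α β)) := tendsto_ulim (eventually_lamOne_le hr hμ hS q p α β)

lemma abs_LamZero_le (q : M d) (α β : Fin d) : |LamZero U q μ α β| ≤ C :=
  le_of_tendsto (tendsto_lamZero hr hμ hS q α β).abs
    (Nat.hyperfilter_le_atTop (eventually_lamZero_le hr hμ hS q α β))

lemma abs_LamOne_le (q p : M d) (α β : Fin d) : |LamOne U q p μ α β| ≤ C :=
  le_of_tendsto (tendsto_lamOne hr hμ hS q p α β).abs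
    (Nat.hyperfilter_le_atTop (eventually_lamOne_le hr hμ hS q p α β))

include hν

lemma LamZero_lip (q q' : M d) (α β : Fin d) :
    |LamZero U q μ α β - LamZero U q' ν α β| ≤ d * C * (2 * ‖q - q'‖ + W2 μ ν) := by
  have hC : 0 ≤ C := (hS 0).nonneg
  refine abs_sub_le_of_matchings Nat.hyperfilter_le_atTop (by positivity)
    (tendsto_lamZero hr hμ hS q α β) (tendsto_lamZero hr hν hS q' α β) ?_
  filter_upwards [eventually_cfg_mem_of_fixed hr hμ q 0, eventually_cfg_mem_of_fixed hr hν q' 0]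
    with m h1 h2 σ
  rw [← lamZero_perm (hS _).smooth q' _ σ]
  exact lamZero_lip (hS _) h1 (by rw [cfg_comp_perm]; exact ballM_comp_perm h2 _) α β

lemma LamOne_lip (q q' p p' : M d) (α β : Fin d) :
    |LamOne U q p μ α β - LamOne U q' p' ν α β| ≤
      d * C * (2 * (‖q - q'‖ + ‖p - p'‖) + W2 μ ν) := by
  have hC : 0 ≤ C := (hS 0).nonneg
  refine abs_sub_le_of_matchings Nat.hyperfilter_le_atTop (by positivity)
    (tendsto_lamOne hr hμ hS q p α β) (tendsto_lamOne hr hν hS q' p' α β) ?_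
  filter_upwards [eventually_cfg_mem_of_fixed hr hμ q p, eventually_cfg_mem_of_fixed hr hν q' p']
    with m h1 h2 σ
  rw [← lamOne_perm (hS _).smooth q' p' _ σ]
  exact lamOne_lip (hS _) h1 (by rw [cfg_comp_perm]; exact ballM_comp_perm h2 _) α β

lemma wgrad_lip (hU : IsC11Loc U) {q q' : M d} (hq : q ∈ μ.spt) (hq' : q' ∈ ν.spt) (α : Fin d) :
    |wgrad U μ q α - wgrad U ν q' α| ≤ d * C * (2 * ‖q - q'‖ + W2 μ ν) := by
  have hC : 0 ≤ C := (hS 0).nonneg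
  refine abs_sub_le_of_matchings le_rfl (by positivity)
    (tendsto_gradApx hU hr hμ hS hq α) (tendsto_gradApx hU hr hν hS hq' α) ?_
  filter_upwards [eventually_cfg_mem_of_fixed hr hμ q 0, eventually_cfg_mem_of_fixed hr hν q' 0]
    with m h1 h2 σ
  rw [← gradApx_perm (hS _).smooth q' _ σ]
  exact gradApx_lip (hS _) h1 (by rw [cfg_comp_perm]; exact ballM_comp_perm h2 _) α

omit hν

/-- The Lipschitz estimate with both measures equal to `μ`. It gives measurability of the integrand
in the expansion and compares `LamOne` at an arbitrary point with its values on a finite net. -/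
lemma LamOne_lip_right (q p p' : M d) (α β : Fin d) :
    |LamOne U q p μ α β - LamOne U q p' μ α β| ≤ 2 * (d * C) * ‖p - p'‖ := by
  refine (LamOne_lip hr hμ hμ hS q q p p' α β).trans (le_of_eq ?_)
  rw [W2_self, sub_self, norm_zero]; ring

lemma continuous_LamOne_right (q : M d) (α β : Fin d) :
    Continuous fun p => LamOne U q p μ α β := by
  refine (LipschitzWith.of_dist_le_mul (K := (2 * (d * C)).toNNReal) fun p p' => ?_).continuous
  have hC : 0 ≤ C := (hS 0).nonneg
  rw [Real.dist_eq, dist_eq_norm, Real.coe_toNNReal _ (by positivity)]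
  exact LamOne_lip_right hr hμ hS q p p' α β

end Bounds

/-- The scaled mixed derivative with respect to the marked point and the `i`-th point. -/
def mixedApx (U : P2 d → ℝ) (q : M d) (x : Fin n → M d) (i : Fin n) (α β : Fin d) : ℝ :=
  ((n : ℝ) * ((n + 2 : ℕ) : ℝ)) * D2 (restr U (n + 2)) (cfg q 0 x) i.succ.succ 0 β α

lemma mixedApx_bound {R : ℝ} (hS : ScaledOn (restr U (n + 2)) R C) {q : M d} {x : Fin n → M d}
    (hz : cfg q 0 x ∈ ballM d (n + 2) R) (i : Fin n) (α β : Fin d) : |mixedApx U q x i α β| ≤ C :=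
  hS.abs_off_le hz (by positivity) mul_succ_succ_le_sq (Fin.succ_ne_zero _) β α

/-- With the second marked point placed on `x i`, points `1` and `i + 2` coincide and exchanging
them identifies the two mixed derivatives. Bringing that marked point from the origin to `x i` moves
none of the points of differentiation and so costs only `‖x i‖ / (n + 2)`. -/
lemma mixedApx_sub_lamOne_le {R : ℝ} (hS : ScaledOn (restr U (n + 2)) R C) {q : M d}
    {x : Fin n → M d} {i : Fin n} (hz : cfg q 0 x ∈ ballM d (n + 2) R)
    (hz' : cfg q (x i) x ∈ ballM d (n + 2) R) (α β : Fin d) :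
    |mixedApx U q x i α β - lamOne U q (x i) x α β| ≤
      d * C * (((n + 2 : ℕ) : ℝ)⁻¹ * ‖x i‖) := by
  have hne : i.succ.succ ≠ (1 : Fin (n + 2)) := by
    rw [← Fin.succ_zero_eq_one]; exact fun h => Fin.succ_ne_zero _ (Fin.succ_injective _ h)
  have hswap : cfg q (x i) x ∘ Equiv.swap 1 i.succ.succ = cfg q (x i) x := by
    funext l
    simp only [Function.comp_apply]
    rcases eq_or_ne l 1 with rfl | h0
    · rw [Equiv.swap_apply_left]; simp
    rcases eq_or_ne l i.succ.succ with rfl | h1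
    · rw [Equiv.swap_apply_right]; simp
    · rw [Equiv.swap_apply_of_ne_of_ne h0 h1]
  have e : D2 (restr U (n + 2)) (cfg q (x i) x) 1 0 β α =
      D2 (restr U (n + 2)) (cfg q (x i) x) i.succ.succ 0 β α := by
    conv_lhs => rw [← hswap]
    rw [D2_perm (hS.smooth.of_le (by norm_num)) _ (fun w => restr_comp_perm U w _),
      Equiv.swap_apply_left, Equiv.swap_apply_of_ne_of_ne (by simp) (Fin.succ_ne_zero _).symm]
  rw [lamOne, e, mixedApx]
  refine (hS.lip_off hz' hz (by positivity) mul_succ_succ_le_sq (Fin.succ_ne_zero _) β α).trans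
    (le_of_eq ?_)
  rw [sum_cfg]
  simp [mul_assoc]

/-- The expansion of the approximate gradient along a matching. -/
lemma gradApx_taylor [NeZero n] {R : ℝ} (hS : ScaledOn (restr U (n + 2)) R C) {q q' : M d}
    {x y : Fin n → M d} (hz : cfg q 0 x ∈ ballM d (n + 2) R)
    (hz' : cfg q' 0 y ∈ ballM d (n + 2) R) (α : Fin d) (σ : Equiv.Perm (Fin n)) :
    |(gradApx U q' y α - gradApx U q x α - ∑ β, (q' - q) β * lamZero U q x α β) -
      (n : ℝ)⁻¹ * ∑ i, ∑ β, (y (σ i) - x i) β * mixedApx U q x i α β| ≤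
      6 * d ^ 2 * C * ‖q - q'‖ ^ 2 +
        (n : ℝ)⁻¹ * ∑ i, 3 * d ^ 2 * C * ‖y (σ i) - x i‖ ^ 2 := by
  have hn : (1 : ℝ) ≤ n := one_le_natCast
  have hC : 0 ≤ C := hS.nonneg
  have hz'' : cfg q' 0 (y ∘ σ) ∈ ballM d (n + 2) R := by
    rw [cfg_comp_perm]; exact ballM_comp_perm hz' _
  have h := hS.taylor_grad hz hz'' 0 α
  rw [sum_cfg, sum_cfg] at h
  simp only [cfg_zero, cfg_one, cfg_succ_succ, sub_self, norm_zero, Function.comp_apply] at h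
  have e1 : ∑ β, (0 : M d) β * (((n + 2 : ℕ) : ℝ) * D2 (restr U (n + 2)) (cfg q 0 x) 1 0 β α) = 0 := by
    simp
  have e2 : ∑ i, ∑ β, (y (σ i) - x i) β *
      (((n + 2 : ℕ) : ℝ) * D2 (restr U (n + 2)) (cfg q 0 x) i.succ.succ 0 β α) =
      (n : ℝ)⁻¹ * ∑ i, ∑ β, (y (σ i) - x i) β * mixedApx U q x i α β := by
    rw [Finset.mul_sum]
    refine Finset.sum_congr rfl fun i _ => ?_
    rw [Finset.mul_sum]
    refine Finset.sum_congr rfl fun β _ => ?_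
    rw [mixedApx]; field_simp
  rw [e1, zero_add, e2] at h
  have e3 : ((n + 2 : ℕ) : ℝ) * D1 (restr U (n + 2)) (cfg q' 0 (y ∘ σ)) 0 α = gradApx U q' y α :=
    gradApx_perm hS.smooth q' y σ α
  rw [e3] at h
  have e4 : ∀ a b c e : ℝ, a - b - c - e = a - b - (c + e) := fun a b c e => by ring
  rw [e4]
  refine le_trans h ?_
  rw [← Finset.mul_sum]
  set s := ∑ i, ‖y (σ i) - x i‖ ^ 2 with hs
  have hs0 : 0 ≤ s := Finset.sum_nonneg fun _ _ => sq_nonneg _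
  have h1 : ((n + 2 : ℕ) : ℝ)⁻¹ ≤ 1 := inv_le_one_of_one_le₀ (by push_cast; linarith)
  have h2 : ((n + 2 : ℕ) : ℝ)⁻¹ ≤ (n : ℝ)⁻¹ := inv_anti₀ (by linarith) (by push_cast; linarith)
  have h3 := mul_le_mul_of_nonneg_right h2 hs0
  have h4 := mul_le_mul_of_nonneg_right h1 (sq_nonneg ‖q' - q‖)
  rw [norm_sub_rev q q']
  have h5 : 0 ≤ 3 * (d : ℝ) ^ 2 * C := by positivity
  -- The marked point counts once by itself and at most once more in the mean, which doubles its
  -- constant; the parked point does not move.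
  calc 3 * (d : ℝ) ^ 2 * C * (‖q' - q‖ ^ 2 + ((n + 2 : ℕ) : ℝ)⁻¹ * (‖q' - q‖ ^ 2 + (0 ^ 2 + s)))
      ≤ 3 * (d : ℝ) ^ 2 * C * (2 * ‖q' - q‖ ^ 2 + (n : ℝ)⁻¹ * s) :=
        mul_le_mul_of_nonneg_left (by linarith) h5
    _ = _ := by ring

end SecondOrder

/-! ### From sums of mixed derivatives to the integral of `Λ₁` along a plan -/

section Expansion
open Filter Topology
variable {d n : ℕ} {U : P2 d → ℝ} {μ ν : P2 d} {r C : ℝ}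

lemma mul_le_young {s t η : ℝ} (hη : 0 < η) : s * t ≤ η * s ^ 2 + η⁻¹ * t ^ 2 := by
  have h : η * s ^ 2 + η⁻¹ * t ^ 2 - s * t = η * ((s - η⁻¹ * t / 2) ^ 2) + 3 / 4 * (η⁻¹ * t ^ 2) := by
    field_simp; ring
  have : 0 ≤ η * ((s - η⁻¹ * t / 2) ^ 2) + 3 / 4 * (η⁻¹ * t ^ 2) := by positivity
  linarith

lemma Alloc.mul_dev1_le (A : Alloc μ n) {η : ℝ} (hη : 0 < η) (s : ℝ) (a : M d) :
    s * A.dev1 a ≤ η * s ^ 2 + η⁻¹ * A.dev a :=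
  (mul_le_young hη).trans (by gcongr; exact A.dev1_sq_le a)

/-- Averaging over `l` with the fractions at `a` replaces the choice of a nearest point of the net,
and yields an error whose integral is controlled by the transport cost. -/
lemma Alloc.le_of_forall_le_add (A : Alloc μ n) {t c K : ℝ} {a : M d}
    (h : ∀ l, t ≤ c + K * ‖a - A.x l‖) : t ≤ c + K * A.dev1 a := by
  have e : ∀ s : ℝ, s = ∑ l, A.w l a * s := fun s => by rw [← Finset.sum_mul, A.sum_eq, one_mul]
  rw [Alloc.dev1, Finset.mul_sum, e t, e c, ← Finset.sum_add_distrib]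
  refine Finset.sum_le_sum fun l _ => ?_
  have := mul_le_mul_of_nonneg_left (h l) (A.nonneg l a)
  linarith

lemma Alloc.integral_mix_sq_le (A : Alloc μ n) (B : Alloc ν n) {γ : Measure (M d × M d)}
    (hγ : γ ∈ couplings μ ν) :
    ∫ p, A.mix B (fun i j => ‖B.x j - A.x i‖ ^ 2) p ∂γ ≤ 3 * (cost γ + A.tcost + B.tcost) := by
  have hA := A.integrable_dev_fst hγ
  have hB := B.integrable_dev_snd hγ
  have hc := coupling_integrable_sq hγ
  have hle : ∀ p : M d × M d, A.mix B (fun i j => ‖B.x j - A.x i‖ ^ 2) p ≤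
      3 * ((‖p.1 - p.2‖ ^ 2 + A.dev p.1) + B.dev p.2) := fun p => by
    have h := A.mix_le_of_separated B (h := fun i j => ‖B.x j - A.x i‖ ^ 2)
      (c := 3 * ‖p.1 - p.2‖ ^ 2) (f := fun i => 3 * ‖p.1 - A.x i‖ ^ 2)
      (g := fun j => 3 * ‖p.2 - B.x j‖ ^ 2) (fun i j => by
        have h1 : ‖B.x j - A.x i‖ ≤ ‖p.1 - p.2‖ + ‖p.1 - A.x i‖ + ‖p.2 - B.x j‖ := by
          calc ‖B.x j - A.x i‖ = ‖(p.1 - A.x i) - (p.1 - p.2) - (p.2 - B.x j)‖ := by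
                congr 1; abel
            _ ≤ ‖(p.1 - A.x i) - (p.1 - p.2)‖ + ‖p.2 - B.x j‖ := norm_sub_le _ _
            _ ≤ ‖p.1 - A.x i‖ + ‖p.1 - p.2‖ + ‖p.2 - B.x j‖ := by
                gcongr; exact norm_sub_le _ _
            _ = _ := by ring
        have h2 : ‖B.x j - A.x i‖ ^ 2 ≤ (‖p.1 - p.2‖ + ‖p.1 - A.x i‖ + ‖p.2 - B.x j‖) ^ 2 := by
          gcongr
        nlinarith [sq_nonneg (‖p.1 - p.2‖ - ‖p.1 - A.x i‖), sq_nonneg (‖p.1 - p.2‖ - ‖p.2 - B.x j‖),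
          sq_nonneg (‖p.1 - A.x i‖ - ‖p.2 - B.x j‖)]) p
    refine h.trans (le_of_eq ?_)
    have e1 : ∑ i, A.w i p.1 * (3 * ‖p.1 - A.x i‖ ^ 2) = 3 * A.dev p.1 := by
      rw [Alloc.dev, Finset.mul_sum]; exact Finset.sum_congr rfl fun i _ => by ring
    have e2 : ∑ j, B.w j p.2 * (3 * ‖p.2 - B.x j‖ ^ 2) = 3 * B.dev p.2 := by
      rw [Alloc.dev, Finset.mul_sum]; exact Finset.sum_congr rfl fun i _ => by ring
    rw [e1, e2]; ring
  have hi1 : Integrable (fun p : M d × M d => ‖p.1 - p.2‖ ^ 2 + A.dev p.1) γ := hc.add hA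
  refine (integral_mono (A.integrable_mix B hγ _) ((hi1.add hB).const_mul 3) hle).trans
    (le_of_eq ?_)
  rw [integral_const_mul, integral_add' hi1 hB, integral_add hc hA, A.integral_dev_fst hγ,
    B.integral_dev_snd hγ]
  rfl

section
variable (hr : 0 < r) (hμ : μ ∈ ballP2 d r) (hν : ν ∈ ballP2 d r)
  (hS : ∀ n, ScaledOn (restr U (n + 2)) (3 * r) C)
include hr hμ hS

/-- The mixed derivatives are close to `Λ₁`, with an error controlled by the displacements of two
transports, one of them fixed. -/
lemma eventually_abs_mixedApx_sub_LamOne_le (q : M d) (α : Fin d) {η : ℝ} (hη : 0 < η) (k : ℕ) :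
    ∀ᶠ m in (hyperfilter ℕ : Filter ℕ), ∀ β a i,
      |mixedApx U q (allocSeq μ m).x i α β - LamOne U q a μ α β| ≤
        (d * C + 1) * η + 2 * (d * C) * ‖a - (allocSeq μ m).x i‖ +
          4 * (d * C) * (allocSeq μ k).dev1 a := by
  have hC : 0 ≤ C := (hS 0).nonneg
  set B := allocSeq μ k
  -- Convergence to `LamOne` is known only pointwise, hence uniformly on finite sets: the points of
  -- the fixed transport `B` serve as a net, and Lipschitz bounds before and after the limit bridge
  -- from `x i` to `B.x l` and from `B.x l` to `a`.
  have hnet : ∀ᶠ m in (hyperfilter ℕ : Filter ℕ), ∀ β l,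
      |lamOne U q (B.x l) (allocSeq μ m).x α β - LamOne U q (B.x l) μ α β| < η := by
    refine eventually_all.2 fun β => eventually_all.2 fun l => ?_
    have h := tendsto_lamOne hr hμ hS q (B.x l) α β
    have h2 := h.eventually (Metric.ball_mem_nhds _ hη)
    filter_upwards [h2] with m hm
    exact hm
  have hnetball : ∀ᶠ m in atTop, ∀ l, cfg q (B.x l) (allocSeq μ m).x ∈
      ballM d (m + 1 + 2) (3 * r) :=
    eventually_all.2 fun l => eventually_cfg_mem_of_fixed hr hμ q (B.x l)
  filter_upwards [hnet, Nat.hyperfilter_le_atTop hnetball,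
    Nat.hyperfilter_le_atTop (eventually_cfg_mem_of_fixed hr hμ q 0),
    Nat.hyperfilter_le_atTop (eventually_norm_x_le hr hμ hη),
    Nat.hyperfilter_le_atTop (eventually_cfg_mem hr hμ (‖q‖ ^ 2))] with m h1 h2 h3 h4 h5 β a i
  set A := allocSeq μ m
  have hsum0 : 0 ≤ ∑ i, ‖A.x i‖ ^ 2 := Finset.sum_nonneg fun _ _ => sq_nonneg _
  have hxi : cfg q (A.x i) A.x ∈ ballM d (m + 1 + 2) (3 * r) :=
    h5 q (A.x i) (le_add_of_nonneg_right hsum0) (le_add_of_nonneg_of_le (sq_nonneg _)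
      (Finset.single_le_sum (f := fun i => ‖A.x i‖ ^ 2) (fun _ _ => sq_nonneg _)
        (Finset.mem_univ i)))
  refine B.le_of_forall_le_add fun l => ?_
  have b1 : |mixedApx U q A.x i α β - lamOne U q (A.x i) A.x α β| ≤ d * C * η := by
    refine (mixedApx_sub_lamOne_le (hS _) h3 hxi α β).trans ?_
    gcongr
    rw [inv_mul_le_iff₀ (by positivity), mul_comm]; exact h4 i
  have b2 : |lamOne U q (A.x i) A.x α β - lamOne U q (B.x l) A.x α β| ≤
      d * C * (2 * (‖a - A.x i‖ + ‖a - B.x l‖)) := by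
    refine (lamOne_lip (hS _) hxi (h2 l) α β).trans ?_
    simp only [sub_self, norm_zero, Finset.sum_const_zero, mul_zero, add_zero, zero_add]
    gcongr
    calc ‖A.x i - B.x l‖ = ‖(a - B.x l) - (a - A.x i)‖ := by congr 1; abel
      _ ≤ _ := (norm_sub_le _ _).trans (add_comm _ _).le
  have b3 := (h1 β l).le
  have b4 := LamOne_lip_right hr hμ hS q (B.x l) a α β
  rw [norm_sub_rev] at b4
  rw [abs_le] at *
  constructor <;> linarith

lemma integrable_LamOne_mul {γ : Measure (M d × M d)} (hγ : γ ∈ couplings μ ν) (q : M d)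
    (α β : Fin d) :
    Integrable (fun p : M d × M d => (p.2 - p.1) β * LamOne U q p.1 μ α β) γ := by
  have h1 : Integrable (fun p : M d × M d => (p.2 - p.1) β) γ := by
    refine (coupling_integrable_norm hγ).mono' (by fun_prop) (ae_of_all _ fun p => ?_)
    rw [norm_sub_rev]; exact abs_coord_le (p.2 - p.1) β
  refine h1.mul_bdd (c := C) ?_ (ae_of_all _ fun p => ?_)
  · exact ((continuous_LamOne_right hr hμ hS q α β).comp continuous_fst).aestronglyMeasurable
  · exact abs_LamOne_le hr hμ hS q p.1 α β

/-- The displacement between approximating points is `p.2 - p.1` up to the two transport errors. The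
errors meet bounded coefficients; the main part meets the difference between the mixed derivative
and `Λ₁`. Products of `‖p.1 - p.2‖` with a mean displacement are split by Young's inequality, so
that everything integrates to a multiple of `η`. -/
lemma integral_abs_mix_sub_le {γ : Measure (M d × M d)} (hγ : γ ∈ couplings μ ν) (q : M d)
    (α : Fin d) {η : ℝ} (hη : 0 < η) :
    ∀ᶠ m in (hyperfilter ℕ : Filter ℕ),
      |∫ p, (allocSeq μ m).mix (allocSeq ν m) (fun i j => ∑ β,
          ((allocSeq ν m).x j - (allocSeq μ m).x i) β * mixedApx U q (allocSeq μ m).x i α β) p ∂γ -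
        ∫ p, ∑ β, (p.2 - p.1) β * LamOne U q p.1 μ α β ∂γ| ≤
      (d * (d * C + 1) + 6 * d ^ 2 * C + 2 * d * C) * (η * (4 + cost γ)) := by
  have hC : 0 ≤ C := (hS 0).nonneg
  have := coupling_isProb hγ
  set G : ℝ := d * (d * C + 1) + 6 * d ^ 2 * C + 2 * d * C with hG
  have hη2 : 0 < η ^ 2 := by positivity
  -- The net is fixed, with cost below `η ^ 2`, before `m` is sent to infinity.
  obtain ⟨k, hk⟩ := ((tendsto_tcost μ).eventually (gt_mem_nhds hη2)).exists
  filter_upwards [eventually_abs_mixedApx_sub_LamOne_le hr hμ hS q α hη k,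
    Nat.hyperfilter_le_atTop ((tendsto_tcost μ).eventually (gt_mem_nhds hη2)),
    Nat.hyperfilter_le_atTop ((tendsto_tcost ν).eventually (gt_mem_nhds hη2)),
    Nat.hyperfilter_le_atTop (eventually_cfg_mem_of_fixed hr hμ q 0)] with m h1 h2 h3 h4
  set A := allocSeq μ m
  set B := allocSeq ν m
  set E := allocSeq μ k
  set h : Fin (m + 1) → Fin (m + 1) → ℝ := fun i j => ∑ β, (B.x j - A.x i) β * mixedApx U q A.x i α β
  have hgi : Integrable (fun p : M d × M d => ∑ β, (p.2 - p.1) β * LamOne U q p.1 μ α β) γ :=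
    integrable_finsetSum _ fun β _ => integrable_LamOne_mul hr hμ hS hγ q α β
  have hmi := A.integrable_mix B hγ h
  rw [← integral_sub hmi hgi]
  refine (abs_integral_le_integral_abs).trans ?_
  have hpt : ∀ p : M d × M d, |A.mix B h p - ∑ β, (p.2 - p.1) β * LamOne U q p.1 μ α β| ≤
      G * ((η * 1 + η * ‖p.1 - p.2‖ ^ 2) + (η⁻¹ * E.dev p.1 + (η⁻¹ * A.dev p.1 + η⁻¹ * B.dev p.2))) := by
    intro p
    set s := ‖p.1 - p.2‖ with hs
    have hs0 : 0 ≤ s := norm_nonneg _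
    have hij : ∀ i j, |h i j - ∑ β, (p.2 - p.1) β * LamOne U q p.1 μ α β| ≤
        (d * s * ((d * C + 1) * η) + 4 * d ^ 2 * C * (s * E.dev1 p.1)) +
          (d * C + 2 * d ^ 2 * C * s) * ‖p.1 - A.x i‖ + d * C * ‖p.2 - B.x j‖ := fun i j => by
      have e : h i j - ∑ β, (p.2 - p.1) β * LamOne U q p.1 μ α β =
          ∑ β, (p.1 - A.x i) β * mixedApx U q A.x i α β -
          ∑ β, (p.2 - B.x j) β * mixedApx U q A.x i α β +
          ∑ β, (p.2 - p.1) β * (mixedApx U q A.x i α β - LamOne U q p.1 μ α β) := by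
        rw [← Finset.sum_sub_distrib, ← Finset.sum_sub_distrib, ← Finset.sum_add_distrib]
        refine Finset.sum_congr rfl fun β _ => ?_
        simp only [PiLp.sub_apply]; ring
      have t1 := abs_sum_coord_mul_le (p.1 - A.x i) (fun β => mixedApx U q A.x i α β) C
        (fun β => mixedApx_bound (hS _) h4 i α β)
      have t2 := abs_sum_coord_mul_le (p.2 - B.x j) (fun β => mixedApx U q A.x i α β) C
        (fun β => mixedApx_bound (hS _) h4 i α β)
      have t3 := abs_sum_coord_mul_le (p.2 - p.1)
        (fun β => mixedApx U q A.x i α β - LamOne U q p.1 μ α β) _ (fun β => h1 β p.1 i)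
      rw [norm_sub_rev p.2 p.1, ← hs] at t3
      rw [e]
      refine (abs_add_le _ _).trans ((add_le_add ((abs_sub _ _).trans (add_le_add t1 t2)) t3).trans
        (le_of_eq ?_))
      ring
    refine (A.abs_mix_sub_le B h _ p).trans ((A.mix_le_of_separated B hij p).trans ?_)
    have e1 : ∑ i, A.w i p.1 * ((d * C + 2 * d ^ 2 * C * s) * ‖p.1 - A.x i‖) =
        (d * C + 2 * d ^ 2 * C * s) * A.dev1 p.1 := by
      rw [Alloc.dev1, Finset.mul_sum]; exact Finset.sum_congr rfl fun i _ => by ring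
    have e2 : ∑ j, B.w j p.2 * (d * C * ‖p.2 - B.x j‖) = d * C * B.dev1 p.2 := by
      rw [Alloc.dev1, Finset.mul_sum]; exact Finset.sum_congr rfl fun i _ => by ring
    rw [e1, e2]
    have y1 : s ≤ 1 + s ^ 2 := by nlinarith [sq_nonneg (s - 1)]
    have y2 := E.mul_dev1_le hη s p.1
    have y3 := A.mul_dev1_le hη s p.1
    have y4 := A.dev1_le hη p.1
    have y5 := B.dev1_le hη p.2
    have c1 : 0 ≤ (d : ℝ) * C := by positivity
    have c2 : 0 ≤ (d : ℝ) ^ 2 * C := by positivity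
    have c3 : 0 ≤ (d : ℝ) * (d * C + 1) := by positivity
    have z1 := mul_le_mul_of_nonneg_left y1 (mul_nonneg c3 hη.le)
    have z2 := mul_le_mul_of_nonneg_left y2 c2
    have z3 := mul_le_mul_of_nonneg_left y3 c2
    have z4 := mul_le_mul_of_nonneg_left y4 c1
    have z5 := mul_le_mul_of_nonneg_left y5 c1
    have dE : 0 ≤ η⁻¹ * E.dev p.1 := mul_nonneg (by positivity) (E.dev_nonneg _)
    have dA : 0 ≤ η⁻¹ * A.dev p.1 := mul_nonneg (by positivity) (A.dev_nonneg _)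
    have dB : 0 ≤ η⁻¹ * B.dev p.2 := mul_nonneg (by positivity) (B.dev_nonneg _)
    have ds : 0 ≤ η * s ^ 2 := by positivity
    have k1 : (d : ℝ) * s * ((d * C + 1) * η) ≤ d * (d * C + 1) * (η + η * s ^ 2) :=
      (le_of_eq (by ring)).trans (z1.trans (le_of_eq (by ring)))
    clear z1
    -- With these products as atoms the claim is linear in their products with the nonnegative
    -- constants; the coefficient `G` is chosen generously, so only nonnegative terms are discarded.
    generalize η⁻¹ * E.dev p.1 = vE at *
    generalize η⁻¹ * A.dev p.1 = vA at *
    generalize η⁻¹ * B.dev p.2 = vB at *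
    generalize η * s ^ 2 = vs at *
    have f1 := mul_nonneg c1 dE
    have f2 := mul_nonneg c2 dE
    have f3 := mul_nonneg c3 dE
    have f4 := mul_nonneg c1 dA
    have f5 := mul_nonneg c2 dA
    have f6 := mul_nonneg c3 dA
    have f7 := mul_nonneg c1 dB
    have f8 := mul_nonneg c2 dB
    have f9 := mul_nonneg c3 dB
    have g1 := mul_nonneg c1 ds
    have g2 := mul_nonneg c2 ds
    have g3 := mul_nonneg c2 hη.le
    have hGe : G * (η * 1 + vs + (vE + (vA + vB))) =
        d * (d * C + 1) * (η + vs) + d * (d * C + 1) * vE + d * (d * C + 1) * vA +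
        d * (d * C + 1) * vB + 6 * (d ^ 2 * C * η) + 6 * (d ^ 2 * C * vs) + 6 * (d ^ 2 * C * vE) +
        6 * (d ^ 2 * C * vA) + 6 * (d ^ 2 * C * vB) + 2 * (d * C * η) + 2 * (d * C * vs) +
        2 * (d * C * vE) + 2 * (d * C * vA) + 2 * (d * C * vB) := by rw [hG]; ring
    rw [hGe]
    linarith
  have hA := (A.integrable_dev_fst hγ).const_mul η⁻¹
  have hB := (B.integrable_dev_snd hγ).const_mul η⁻¹
  have hE := (E.integrable_dev_fst hγ).const_mul η⁻¹
  have hc := (coupling_integrable_sq hγ).const_mul η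
  have i1 : Integrable (fun p : M d × M d => η * 1 + η * ‖p.1 - p.2‖ ^ 2) γ :=
    (integrable_const _).add hc
  have i2 : Integrable (fun p : M d × M d => η⁻¹ * A.dev p.1 + η⁻¹ * B.dev p.2) γ := hA.add hB
  have i3 : Integrable (fun p : M d × M d =>
    η⁻¹ * E.dev p.1 + (η⁻¹ * A.dev p.1 + η⁻¹ * B.dev p.2)) γ := hE.add i2
  refine (integral_mono (hmi.sub hgi).abs ((i1.add i3).const_mul G) hpt).trans ?_
  rw [integral_const_mul, integral_add' i1 i3, integral_add (integrable_const _) hc,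
    integral_add hE i2, integral_add hA hB, integral_const_mul η⁻¹, integral_const_mul η⁻¹,
    integral_const_mul η⁻¹, integral_const_mul η, A.integral_dev_fst hγ, B.integral_dev_snd hγ,
    E.integral_dev_fst hγ]
  have hG0 : 0 ≤ G := by positivity
  refine mul_le_mul_of_nonneg_left ?_ hG0
  simp only [integral_const, probReal_univ, one_smul]
  have t1 : η⁻¹ * A.tcost ≤ η⁻¹ * η ^ 2 := by gcongr
  have t2 : η⁻¹ * B.tcost ≤ η⁻¹ * η ^ 2 := by gcongr
  have t3 : η⁻¹ * E.tcost ≤ η⁻¹ * η ^ 2 := by gcongr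
  have t4 : η⁻¹ * η ^ 2 = η := by field_simp
  rw [integral_const_mul]
  change η * 1 + η * cost γ + _ ≤ _
  linarith

include hν

/-- The second order expansion of a component of the gradient along an arbitrary plan. -/
lemma abs_wgrad_expansion_le (hU : IsC11Loc U) {γ : Measure (M d × M d)}
    (hγ : γ ∈ couplings μ ν) {q q' : M d} (hq : q ∈ μ.spt) (hq' : q' ∈ ν.spt) (α : Fin d) :
    |(wgrad U ν q' α - wgrad U μ q α - ∑ β, (q' - q) β * LamZero U q μ α β) -
      ∫ p, ∑ β, (p.2 - p.1) β * LamOne U q p.1 μ α β ∂γ| ≤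
      9 * d ^ 2 * C * (‖q - q'‖ ^ 2 + cost γ) := by
  have hC : 0 ≤ C := (hS 0).nonneg
  have hcost := cost_nonneg γ
  set I := ∫ p, ∑ β, (p.2 - p.1) β * LamOne U q p.1 μ α β ∂γ
  set G : ℝ := d * (d * C + 1) + 6 * d ^ 2 * C + 2 * d * C with hG
  have hG0 : 0 ≤ G := by positivity
  have hlim : Tendsto (fun m => gradApx U q' (allocSeq ν m).x α - gradApx U q (allocSeq μ m).x α -
      ∑ β, (q' - q) β * lamZero U q (allocSeq μ m).x α β) (hyperfilter ℕ : Filter ℕ)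
      (𝓝 (wgrad U ν q' α - wgrad U μ q α - ∑ β, (q' - q) β * LamZero U q μ α β)) :=
    (((tendsto_gradApx hU hr hν hS hq' α).mono_left Nat.hyperfilter_le_atTop).sub
      ((tendsto_gradApx hU hr hμ hS hq α).mono_left Nat.hyperfilter_le_atTop)).sub
      (tendsto_finsetSum _ fun β _ => (tendsto_lamZero hr hμ hS q α β).const_mul _)
  have key : ∀ η : ℝ, 0 < η → η ≤ 1 →
      |(wgrad U ν q' α - wgrad U μ q α - ∑ β, (q' - q) β * LamZero U q μ α β) - I| ≤
      9 * d ^ 2 * C * (‖q - q'‖ ^ 2 + cost γ) + η * (18 * d ^ 2 * C + G * (4 + cost γ)) := by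
    intro η hη hη1
    refine le_of_tendsto (hlim.sub_const I).abs ?_
    have hη2 : 0 < η ^ 2 := by positivity
    filter_upwards [integral_abs_mix_sub_le hr hμ hS hγ q α hη,
      Nat.hyperfilter_le_atTop ((tendsto_tcost μ).eventually (gt_mem_nhds hη2)),
      Nat.hyperfilter_le_atTop ((tendsto_tcost ν).eventually (gt_mem_nhds hη2)),
      Nat.hyperfilter_le_atTop (eventually_cfg_mem_of_fixed hr hμ q 0),
      Nat.hyperfilter_le_atTop (eventually_cfg_mem_of_fixed hr hν q' 0)] with m h1 h2 h3 h4 h5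
    have h6 := (allocSeq μ m).abs_sub_integral_mix_le (allocSeq ν m) hγ
      (fun i j => ∑ β, ((allocSeq ν m).x j - (allocSeq μ m).x i) β *
        mixedApx U q (allocSeq μ m).x i α β)
      (fun i j => 3 * d ^ 2 * C * ‖(allocSeq ν m).x j - (allocSeq μ m).x i‖ ^ 2)
      (gradApx U q' (allocSeq ν m).x α - gradApx U q (allocSeq μ m).x α -
        ∑ β, (q' - q) β * lamZero U q (allocSeq μ m).x α β) (6 * d ^ 2 * C * ‖q - q'‖ ^ 2)
      (fun σ => gradApx_taylor (hS _) h4 h5 α σ)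
    -- A factor 3 from the Taylor remainder and another from squaring a three-term triangle
    -- inequality give the constant 9; the constant 6 at the marked point is then enlarged to match.
    have h7 : ∫ p, (allocSeq μ m).mix (allocSeq ν m) (fun i j => 3 * d ^ 2 * C *
        ‖(allocSeq ν m).x j - (allocSeq μ m).x i‖ ^ 2) p ∂γ ≤
        3 * d ^ 2 * C * (3 * (cost γ + η ^ 2 + η ^ 2)) := by
      have e : ∀ p, (allocSeq μ m).mix (allocSeq ν m) (fun i j => 3 * d ^ 2 * C *
          ‖(allocSeq ν m).x j - (allocSeq μ m).x i‖ ^ 2) p = 3 * d ^ 2 * C *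
          (allocSeq μ m).mix (allocSeq ν m) (fun i j =>
          ‖(allocSeq ν m).x j - (allocSeq μ m).x i‖ ^ 2) p := fun p => by
        simp only [Alloc.mix, Finset.mul_sum]
        exact Finset.sum_congr rfl fun i _ => Finset.sum_congr rfl fun j _ => by ring
      simp_rw [e]
      rw [integral_const_mul]
      gcongr
      refine ((allocSeq μ m).integral_mix_sq_le (allocSeq ν m) hγ).trans ?_
      gcongr
    have h8 : 3 * (d : ℝ) ^ 2 * C * (3 * (cost γ + η ^ 2 + η ^ 2)) ≤
        9 * d ^ 2 * C * cost γ + η * (18 * d ^ 2 * C) := by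
      have : (d : ℝ) ^ 2 * C * η ^ 2 ≤ (d : ℝ) ^ 2 * C * η :=
        mul_le_mul_of_nonneg_left (by nlinarith) (by positivity)
      linarith
    have h9 : 6 * (d : ℝ) ^ 2 * C * ‖q - q'‖ ^ 2 ≤ 9 * d ^ 2 * C * ‖q - q'‖ ^ 2 := by
      gcongr; norm_num
    refine (abs_sub_le _ _ _).trans ((add_le_add h6 h1).trans ?_)
    linarith
  refine le_of_forall_pos_le_add fun ε hε => ?_
  set P := 18 * (d : ℝ) ^ 2 * C + G * (4 + cost γ) with hP
  have hP0 : 0 ≤ P := by positivity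
  refine (key (min 1 (ε / (P + 1))) (by positivity) (min_le_left _ _)).trans ?_
  gcongr
  calc min 1 (ε / (P + 1)) * P ≤ ε / (P + 1) * P := by gcongr; exact min_le_right _ _
    _ = P / (P + 1) * ε := by ring
    _ ≤ ε := mul_le_of_le_one_left hε.le ((div_le_one (by linarith)).2 (by linarith))

end
end Expansion

/-! ### Norm estimates, continuity of the coefficients, and the theorem -/

section Assembly
open Filter Topology
variable {d : ℕ} {U : P2 d → ℝ} {μ ν : P2 d} {r C : ℝ}

/-- A common nondecreasing constant for the two scalings of the derivatives. -/
lemma exists_scaledOn (h₂ : SecondDerivScaling U) (h₃ : ThirdDerivScaling U) :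
    ∃ K : ℝ → ℝ, MonotoneOn K (Ioi 0) ∧ (∀ R, 0 ≤ K R) ∧
      ∀ R : ℝ, 0 < R → ∀ (m : ℕ) [NeZero m], ScaledOn (restr U m) R (K R) := by
  obtain ⟨-, C₂, hm₂, hC₂⟩ := h₂
  obtain ⟨hs, C₃, hm₃, hC₃⟩ := h₃
  refine ⟨fun R => max (max (C₂ R) (C₃ R)) 0, fun R hR R' hR' h => ?_, fun R => le_max_right _ _,
    fun R hR m _ => ⟨hs m, le_max_right _ _, fun q hq i j α β => ?_, fun q hq i j k α β κ => ?_⟩⟩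
  · exact max_le_max (max_le_max (hm₂ hR hR' h) (hm₃ hR hR' h)) le_rfl
  · have hle : C₂ R ≤ max (max (C₂ R) (C₃ R)) 0 := (le_max_left _ _).trans (le_max_left _ _)
    obtain ⟨h1, h2⟩ := hC₂ R hR m q hq i j α β
    exact ⟨fun h => (h1 h).trans (by gcongr), fun h => (h2 h).trans (by gcongr)⟩
  · have hle : C₃ R ≤ max (max (C₂ R) (C₃ R)) 0 := (le_max_right _ _).trans (le_max_left _ _)
    obtain ⟨h1, h2, h3⟩ := hC₃ R hR m q hq i j k α β κ
    exact ⟨fun h => (h1 h).trans (by gcongr), fun h => (h2 h).trans (by gcongr),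
      fun h => (h3 h).trans (by gcongr)⟩

/-- A `W₂`-neighbourhood of a measure is contained in a ball centered at `δ₀`. -/
lemma exists_ballP2_of_W2_lt_one (μ : P2 d) :
    ∃ r : ℝ, 0 < r ∧ μ ∈ ballP2 d r ∧ ∀ ν, W2 μ ν < 1 → ν ∈ ballP2 d r := by
  have h0 : 0 ≤ ∫ a, ‖a‖ ^ 2 ∂μ.meas := integral_nonneg fun _ => sq_nonneg _
  set s := ∫ a, ‖a‖ ^ 2 ∂μ.meas with hs
  have hr : 0 < Real.sqrt (2 * s + 2) := Real.sqrt_pos.2 (by linarith)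
  refine ⟨Real.sqrt (2 * s + 2), hr, ?_, fun ν hν => ?_⟩
  · rw [mem_ballP2_iff hr.le, Real.sq_sqrt (by linarith)]; linarith
  · rw [mem_ballP2_iff hr.le, Real.sq_sqrt (by linarith)]
    obtain ⟨γ, hγ, hc⟩ := exists_coupling_cost_lt μ ν
      (show W2 μ ν ^ 2 < 1 by have := W2_nonneg μ ν; nlinarith)
    have e1 : ∫ p, ‖p.1‖ ^ 2 ∂γ = s := by
      rw [hs, ← hγ.1, integral_map measurable_fst.aemeasurable (by fun_prop)]
    have e2 : ∫ p, ‖p.2‖ ^ 2 ∂γ = ∫ a, ‖a‖ ^ 2 ∂ν.meas := by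
      rw [← hγ.2, integral_map measurable_snd.aemeasurable (by fun_prop)]
    have i1 : Integrable (fun p : M d × M d => ‖p.1‖ ^ 2) γ :=
      (coupling_mp_fst hγ).integrable_comp_of_integrable μ.integrable_sq
    have i2 : Integrable (fun p : M d × M d => ‖p.2‖ ^ 2) γ :=
      (coupling_mp_snd hγ).integrable_comp_of_integrable ν.integrable_sq
    rw [← e2]
    calc ∫ p, ‖p.2‖ ^ 2 ∂γ ≤ ∫ p, (2 * ‖p.1‖ ^ 2 + 2 * ‖p.1 - p.2‖ ^ 2) ∂γ := by
          refine integral_mono i2 ((i1.const_mul 2).add ((coupling_integrable_sq hγ).const_mul 2))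
            fun p => ?_
          have h : ‖p.2‖ ≤ ‖p.1‖ + ‖p.1 - p.2‖ := by
            have := norm_sub_le p.1 (p.1 - p.2); rwa [sub_sub_cancel] at this
          change ‖p.2‖ ^ 2 ≤ 2 * ‖p.1‖ ^ 2 + 2 * ‖p.1 - p.2‖ ^ 2
          nlinarith [norm_nonneg p.2, sq_nonneg (‖p.1‖ - ‖p.1 - p.2‖)]
      _ = 2 * s + 2 * cost γ := by
          rw [integral_add (i1.const_mul 2) ((coupling_integrable_sq hγ).const_mul 2),
            integral_const_mul, integral_const_mul, e1]; rfl
      _ ≤ _ := by linarith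

lemma mulV_apply (A : Mat d) (v : M d) (α : Fin d) : mulV A v α = ∑ β, v β * A α β := by
  simp [mulV, Matrix.mulVec, dotProduct, mul_comm]

lemma norm_le_card_mul {v : M d} {b : ℝ} (h : ∀ α, |v α| ≤ b) : ‖v‖ ≤ d * b := by
  refine (norm_le_sum_coord v).trans ((Finset.sum_le_sum fun α _ => h α).trans ?_)
  simp

/-- A constant that dominates all the constants of the construction. -/
def bigC (d : ℕ) (K : ℝ) : ℝ := (9 * (d : ℝ) ^ 3 + 2 * (d : ℝ) ^ 2 + 2 * d + 1) * (K + 1)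

/-- The `+ 1` next to `K` keeps the constant positive even when `K = 0`. -/
lemma bigC_pos {K : ℝ} (hK : 0 ≤ K) : 0 < bigC d K := by
  unfold bigC; positivity

lemma le_bigC {K c : ℝ} (hK : 0 ≤ K) (hc : c ≤ 9 * (d : ℝ) ^ 3 + 2 * (d : ℝ) ^ 2 + 2 * d + 1) :
    c * K ≤ bigC d K := by
  unfold bigC
  have h0 : (0 : ℝ) ≤ 9 * (d : ℝ) ^ 3 + 2 * (d : ℝ) ^ 2 + 2 * d + 1 := by positivity
  nlinarith [mul_le_mul_of_nonneg_right hc hK]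

section
variable (hr : 0 < r) (hμ : μ ∈ ballP2 d r) (hν : ν ∈ ballP2 d r)
  (hS : ∀ n, ScaledOn (restr U (n + 2)) (3 * r) C)
include hr hμ hS

lemma norm_LamZero_le (q : M d) : ‖LamZero U q μ‖ ≤ bigC d C := by
  have hC : 0 ≤ C := (hS 0).nonneg
  refine (Matrix.norm_le_iff (bigC_pos hC).le).2 fun α β => ?_
  refine (abs_LamZero_le hr hμ hS q α β).trans ?_
  simpa using le_bigC (d := d) (c := 1) hC (by
    have hd : (0 : ℝ) ≤ d := Nat.cast_nonneg d
    nlinarith [sq_nonneg (d : ℝ), pow_nonneg hd 3])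

lemma norm_LamOne_le (q p : M d) : ‖LamOne U q p μ‖ ≤ bigC d C := by
  have hC : 0 ≤ C := (hS 0).nonneg
  refine (Matrix.norm_le_iff (bigC_pos hC).le).2 fun α β => ?_
  refine (abs_LamOne_le hr hμ hS q p α β).trans ?_
  simpa using le_bigC (d := d) (c := 1) hC (by
    have hd : (0 : ℝ) ≤ d := Nat.cast_nonneg d
    nlinarith [sq_nonneg (d : ℝ), pow_nonneg hd 3])

include hν

lemma norm_LamZero_sub_le (q q' : M d) :
    ‖LamZero U q μ - LamZero U q' ν‖ ≤ bigC d C * (‖q - q'‖ + W2 μ ν) := by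
  have hC : 0 ≤ C := (hS 0).nonneg
  have hW := W2_nonneg μ ν
  have hd : (0 : ℝ) ≤ d := Nat.cast_nonneg d
  refine (Matrix.norm_le_iff (by have := bigC_pos (d := d) hC; positivity)).2 fun α β => ?_
  refine (LamZero_lip hr hμ hν hS q q' α β).trans ?_
  calc (d : ℝ) * C * (2 * ‖q - q'‖ + W2 μ ν) ≤ d * C * (2 * (‖q - q'‖ + W2 μ ν)) := by
        gcongr; linarith
    _ = (2 * d) * C * (‖q - q'‖ + W2 μ ν) := by ring
    _ ≤ _ := by gcongr; exact le_bigC hC (by nlinarith [sq_nonneg (d : ℝ), pow_nonneg hd 3])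

lemma norm_LamOne_sub_le (q q' p p' : M d) :
    ‖LamOne U q p μ - LamOne U q' p' ν‖ ≤ bigC d C * (‖q - q'‖ + ‖p - p'‖ + W2 μ ν) := by
  have hC : 0 ≤ C := (hS 0).nonneg
  have hW := W2_nonneg μ ν
  have hd : (0 : ℝ) ≤ d := Nat.cast_nonneg d
  refine (Matrix.norm_le_iff (by have := bigC_pos (d := d) hC; positivity)).2 fun α β => ?_
  refine (LamOne_lip hr hμ hν hS q q' p p' α β).trans ?_
  calc (d : ℝ) * C * (2 * (‖q - q'‖ + ‖p - p'‖) + W2 μ ν)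
      ≤ d * C * (2 * (‖q - q'‖ + ‖p - p'‖ + W2 μ ν)) := by gcongr; linarith
    _ = (2 * d) * C * (‖q - q'‖ + ‖p - p'‖ + W2 μ ν) := by ring
    _ ≤ _ := by gcongr; exact le_bigC hC (by nlinarith [sq_nonneg (d : ℝ), pow_nonneg hd 3])

lemma norm_wgrad_sub_le (hU : IsC11Loc U) {q q' : M d} (hq : q ∈ μ.spt) (hq' : q' ∈ ν.spt) :
    ‖wgrad U μ q - wgrad U ν q'‖ ≤ bigC d C * (‖q - q'‖ + W2 μ ν) := by
  have hC : 0 ≤ C := (hS 0).nonneg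
  have hW := W2_nonneg μ ν
  have hd : (0 : ℝ) ≤ d := Nat.cast_nonneg d
  refine (norm_le_card_mul fun α => wgrad_lip hr hμ hν hS hU hq hq' α).trans ?_
  calc (d : ℝ) * (d * C * (2 * ‖q - q'‖ + W2 μ ν))
      ≤ d * (d * C * (2 * (‖q - q'‖ + W2 μ ν))) := by gcongr; linarith
    _ = (2 * d ^ 2) * C * (‖q - q'‖ + W2 μ ν) := by ring
    _ ≤ _ := by gcongr; exact le_bigC hC (by nlinarith [pow_nonneg hd 3])

lemma norm_wgrad_expansion_le (hU : IsC11Loc U) {γ : Measure (M d × M d)}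
    (hγ : γ ∈ optPlans μ ν) {q q' : M d} (hq : q ∈ μ.spt) (hq' : q' ∈ ν.spt) :
    ‖wgrad U ν q' - wgrad U μ q - mulV (LamZero U q μ) (q' - q)
        - ∫ p, mulV (LamOne U q p.1 μ) (p.2 - p.1) ∂γ‖ ≤
      bigC d C * (‖q - q'‖ ^ 2 + W2 μ ν ^ 2) := by
  have hC : 0 ≤ C := (hS 0).nonneg
  have hd : (0 : ℝ) ≤ d := Nat.cast_nonneg d
  -- Integrability has to be proved here: it is what allows a coordinate to be taken inside the
  -- vector-valued integral.
  have hcoord : ∀ α, (∫ p, mulV (LamOne U q p.1 μ) (p.2 - p.1) ∂γ) α =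
      ∫ p, ∑ β, (p.2 - p.1) β * LamOne U q p.1 μ α β ∂γ := fun α => by
    have hi : Integrable (fun p : M d × M d => mulV (LamOne U q p.1 μ) (p.2 - p.1)) γ := by
      refine (PiLp.continuousLinearEquiv 2 ℝ fun _ : Fin d => ℝ).integrable_comp_iff.1 ?_
      refine Integrable.of_eval fun α => ?_
      change Integrable (fun p : M d × M d => mulV (LamOne U q p.1 μ) (p.2 - p.1) α) γ
      simp_rw [mulV_apply]
      exact integrable_finsetSum _ fun β _ => integrable_LamOne_mul hr hμ hS hγ.1 q α β
    have h := (EuclideanSpace.proj α : M d →L[ℝ] ℝ).integral_comp_comm hi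
    simp only [PiLp.proj_apply, mulV_apply] at h
    exact h.symm
  refine (norm_le_card_mul (b := 9 * d ^ 2 * C * (‖q - q'‖ ^ 2 + cost γ)) fun α => ?_).trans ?_
  · have h := abs_wgrad_expansion_le hr hμ hν hS hU hγ.1 hq hq' α
    simp only [PiLp.sub_apply, mulV_apply, hcoord] at h ⊢
    exact h
  -- The only use of optimality: the cost of the plan becomes `W2 μ ν ^ 2`.
  · rw [← hγ.2]
    calc (d : ℝ) * (9 * d ^ 2 * C * (‖q - q'‖ ^ 2 + W2 μ ν ^ 2))
        = 9 * (d : ℝ) ^ 3 * C * (‖q - q'‖ ^ 2 + W2 μ ν ^ 2) := by ring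
      _ ≤ _ := by gcongr; exact le_bigC hC (by nlinarith [sq_nonneg (d : ℝ)])

omit hν

lemma continuous_LamZero : Continuous fun q => LamZero U q μ := by
  have hC : 0 ≤ C := (hS 0).nonneg
  refine (LipschitzWith.of_dist_le_mul (K := (bigC d C).toNNReal) fun q q' => ?_).continuous
  rw [dist_eq_norm, dist_eq_norm, Real.coe_toNNReal _ (bigC_pos hC).le]
  simpa [W2_self] using norm_LamZero_sub_le hr hμ hμ hS q q'

lemma continuous_LamOne : Continuous fun p : M d × M d => LamOne U p.1 p.2 μ := by
  have hC : 0 ≤ C := (hS 0).nonneg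
  have hB := bigC_pos (d := d) hC
  refine (LipschitzWith.of_dist_le_mul (K := (2 * bigC d C).toNNReal) fun p p' => ?_).continuous
  rw [dist_eq_norm, dist_eq_norm, Real.coe_toNNReal _ (by positivity)]
  have h := norm_LamOne_sub_le hr hμ hμ hS p.1 p'.1 p.2 p'.2
  rw [W2_self, add_zero] at h
  have h1 : ‖p.1 - p'.1‖ ≤ ‖p - p'‖ := norm_fst_le (p - p')
  have h2 : ‖p.2 - p'.2‖ ≤ ‖p - p'‖ := norm_snd_le (p - p')
  refine h.trans ?_
  nlinarith

end

/-- Lets continuous matrix fields be strongly measurable, as needed for the `L^∞` statements. -/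
instance : TopologicalSpace.PseudoMetrizableSpace (Mat d) :=
  inferInstanceAs (TopologicalSpace.PseudoMetrizableSpace (Fin d → Fin d → ℝ))

lemma hasSecondOrder_Lam (hr : 0 < r) (hS : ∀ n, ScaledOn (restr U (n + 2)) (3 * r) C)
    (hU : IsC11Loc U) : HasSecondOrder U (ballP2 d r) (LamZero U) (LamOne U) (bigC d C) where
  memLp_zero _ hμ := memLp_top_of_bound (continuous_LamZero hr hμ hS).aestronglyMeasurable _
    (ae_of_all _ fun q => norm_LamZero_le hr hμ hS q)
  memLp_one _ hμ := memLp_top_of_bound (continuous_LamOne hr hμ hS).aestronglyMeasurable _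
    (ae_of_all _ fun p => norm_LamOne_le hr hμ hS p.1 p.2)
  expansion _ hμ _ hν _ hγ _ hq _ hq' := norm_wgrad_expansion_le hr hμ hν hS hU hγ hq hq'
  lip_zero _ hμ _ hν q _ q' _ := norm_LamZero_sub_le hr hμ hν hS q q'
  lip_one _ hμ _ hν q₁ _ q₁' _ q₂ _ q₂' _ := norm_LamOne_sub_le hr hμ hν hS q₁ q₁' q₂ q₂'

section
variable {K : ℝ → ℝ}
  (hS : ∀ R : ℝ, 0 < R → ∀ (m : ℕ) [NeZero m], ScaledOn (restr U m) R (K R))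
include hS

/-- The Lipschitz bound holds for all points of `𝕄`, not only those in the supports, and a unit
`W₂`-neighbourhood of `μ` lies in a single ball, so the field is locally Lipschitz. -/
lemma continuousMP_LamZero : ContinuousMP (LamZero U) := by
  intro q μ ε hε
  obtain ⟨r, hr, hμ, hball⟩ := exists_ballP2_of_W2_lt_one μ
  have h3r : 0 < 3 * r := by positivity
  have hB := bigC_pos (d := d) (hS _ h3r 1).nonneg
  refine ⟨min 1 (ε / (2 * bigC d (K (3 * r)))), by positivity, fun q' ν hq hW => ?_⟩
  have hν := hball ν (hW.trans_le (min_le_left _ _))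
  refine (norm_LamZero_sub_le hr hμ hν (fun n => hS _ h3r (n + 2)) q q').trans_lt ?_
  have h1 := hq.trans_le (min_le_right _ _)
  have h2 := hW.trans_le (min_le_right _ _)
  rw [lt_div_iff₀ (by positivity)] at h1 h2
  nlinarith

lemma continuousMMP_LamOne : ContinuousMMP (LamOne U) := by
  intro q p μ ε hε
  obtain ⟨r, hr, hμ, hball⟩ := exists_ballP2_of_W2_lt_one μ
  have h3r : 0 < 3 * r := by positivity
  have hB := bigC_pos (d := d) (hS _ h3r 1).nonneg
  refine ⟨min 1 (ε / (3 * bigC d (K (3 * r)))), by positivity, fun q' p' ν hq hp hW => ?_⟩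
  have hν := hball ν (hW.trans_le (min_le_left _ _))
  refine (norm_LamOne_sub_le hr hμ hν (fun n => hS _ h3r (n + 2)) q q' p p').trans_lt ?_
  have h1 := hq.trans_le (min_le_right _ _)
  have h2 := hW.trans_le (min_le_right _ _)
  have h3 := hp.trans_le (min_le_right _ _)
  rw [lt_div_iff₀ (by positivity)] at h1 h2 h3
  nlinarith

end
end Assembly
end Wass

end

open Wass
theorem mainTheorem5 (d : ℕ) (U : P2 d → ℝ) (hU : IsC11Loc U)
    (h₂ : SecondDerivScaling U) (h₃ : ThirdDerivScaling U) :
    IsC21wLoc U ∧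
    ∃ (C : ℝ → ℝ) (Λ₀ : M d → P2 d → Mat d) (Λ₁ : M d → M d → P2 d → Mat d),
      (∀ r : ℝ, 0 < r → 0 < C r) ∧ MonotoneOn C (Set.Ioi 0) ∧
      ContinuousMP Λ₀ ∧ ContinuousMMP Λ₁ ∧
      ∀ r : ℝ, 0 < r →
        HasSecondOrder U (ballP2 d r) Λ₀ Λ₁ (C r) ∧
        (∀ μ ∈ ballP2 d r,
          MeasureTheory.eLpNorm (fun q => Λ₀ q μ) ⊤ μ.meas ≤ ENNReal.ofReal (C r) ∧
          MeasureTheory.eLpNorm (fun p : M d × M d => Λ₁ p.1 p.2 μ) ⊤ (μ.meas.prod μ.meas)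
            ≤ ENNReal.ofReal (C r)) ∧
        (∀ μ ∈ ballP2 d r, ∀ ν ∈ ballP2 d r, ∀ γ ∈ optPlans μ ν, ∀ q ∈ μ.spt, ∀ q' ∈ ν.spt,
          ‖wgrad U ν q' - wgrad U μ q - mulV (Λ₀ q μ) (q' - q)
              - ∫ p, mulV (Λ₁ q p.1 μ) (p.2 - p.1) ∂γ‖ ≤ C r * (‖q - q'‖ ^ 2 + W2 μ ν ^ 2)) ∧
        (∀ μ ∈ ballP2 d r, ∀ ν ∈ ballP2 d r, ∀ q ∈ μ.spt, ∀ q' ∈ ν.spt,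
          ‖wgrad U μ q - wgrad U ν q'‖ ≤ C r * (‖q - q'‖ + W2 μ ν)) := by
  obtain ⟨K, hKm, hK0, hS⟩ := exists_scaledOn h₂ h₃
  -- For measures in the ball of radius `r` the approximating configurations eventually lie in the
  -- ball of radius `3 * r`, so the constant is read off there; `r ↦ K (3 * r)` is still
  -- nondecreasing.
  have hS' : ∀ r : ℝ, 0 < r → ∀ n, ScaledOn (restr U (n + 2)) (3 * r) (K (3 * r)) :=
    fun r hr n => hS _ (by positivity) (n + 2)
  refine ⟨fun r hr => ⟨hU r hr, bigC d (K (3 * r)), bigC_pos (hK0 _), LamZero U, LamOne U,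
    hasSecondOrder_Lam hr (hS' r hr) hU⟩,
    fun r => bigC d (K (3 * r)), LamZero U, LamOne U, fun r _ => bigC_pos (hK0 _), ?_,
    continuousMP_LamZero hS, continuousMMP_LamOne hS, fun r hr =>
    ⟨hasSecondOrder_Lam hr (hS' r hr) hU, fun μ hμ => ⟨?_, ?_⟩, ?_, ?_⟩⟩
  · intro r hr r' hr' h
    have : K (3 * r) ≤ K (3 * r') := hKm (mem_Ioi.2 (mul_pos three_pos (mem_Ioi.1 hr)))
      (mem_Ioi.2 (mul_pos three_pos (mem_Ioi.1 hr'))) (by linarith)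
    change bigC d (K (3 * r)) ≤ bigC d (K (3 * r'))
    unfold bigC
    gcongr
  · rw [eLpNorm_exponent_top]
    exact eLpNormEssSup_le_of_ae_bound
      (MeasureTheory.ae_of_all _ fun q => norm_LamZero_le hr hμ (hS' r hr) q)
  · rw [eLpNorm_exponent_top]
    exact eLpNormEssSup_le_of_ae_bound
      (MeasureTheory.ae_of_all _ fun p => norm_LamOne_le hr hμ (hS' r hr) p.1 p.2)
  · exact (hasSecondOrder_Lam hr (hS' r hr) hU).expansion
  · intro μ hμ ν hν q hq q' hq'
    exact norm_wgrad_sub_le hr hμ hν (hS' r hr) hU hq hq'
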